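/- **Setting.** Let $\mathcal A$ be a finite nonempty set of $n=|\mathcal A|$ agents, numbered $0,\dots,n-1$, with $\mathcal A=\mathcal A_1\cup\mathcal A_2$, and let $\mathcal G$ be a set of nonempty subsets of $\mathcal A$. The language $\mathcal L^C_{\mathcal G}$ is built from primitive propositions $p_0,p_1,p_2,\dots$ by $\neg$, $\wedge$, $K_i$ ($i\in\mathcal A$), $E_G$ and $C_G$ ($G\in\mathcal G$). The length $|\varphi|$ is the number of symbols of $\varphi$ (without parentheses), where each proposition, $\neg$, $\wedge$, $K_i$ and $E_G$ counts $1$ and $C_G$ counts $3$. In a Kripke structure $M=(S,\pi,\{\mathcal K_i\}_{i\in\mathcal A})$, $K_i\varphi$ holds at $s$ iff $\varphi$ holds at all $t$ with $(s,t)\in\mathcal K_i$; $E_G\varphi$ holds iff $K_i\varphi$ holds for all $i\in G$; $C_G\varphi$ holds iff $E_G^k\varphi$ holds for all $k\ge 1$. The class $\mathcal M^{rst}_{\mathcal A_1+\mathcal A_2}$ consists of the structures in which $\mathcal K_i$ is reflexive, symmetric and transitive for each $i\in\mathcal A_1$, and reflexive and symmetric for each $i\in\mathcal A_2$. A formula is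 satisfiable in this class if it is true at some state of some structure of the class. Algorithms are programs of a random access machine with unit-cost addition and truncated subtraction; propositions, agents and (by an injective naming) the sets $G\in\mathcal G$ are single input symbols, each one a natural number. **Theorem.** There is a constant $c>0$, independent of $\mathcal A$, $\mathcal A_1$, $\mathcal A_2$ and $\mathcal G$, such that the following hold. 1. For every $K$ there is a $C$ such that for all $\mathcal A=\mathcal A_1\cup\mathcal A_2$ and $\mathcal G$ as above (with names of its members): if some algorithm decides, given $i\in\mathcal A$ and $G\in\mathcal G$, whether $i\in G$ in time at most $K|\mathcal A|$, then some algorithm, given any $\varphi\in\mathcal L^C_{\mathcal G}$, decides whether $\varphi$ is satisfiable in $\mathcal M^{rst}_{\mathcal A_1+\mathcal A_2}$ in time at most $C\,|\mathcal A|\,2^{c|\varphi|}$. 2. There are a constant $C$ and a single algorithm that, for all $\mathcal A=\mathcal A_1\cup\mathcal A_2$ and $\mathcal G$ as above, given as input $|\mathcal A|$, the characteristic function of $\mathcal A_1$ and a formula $\varphi\in\mathcal L^C_{\mathcal G}$, and given an oracle that answers each question "$i\in G$?" ($i\in\mathcal A$, $G\in\mathcal G$) in one step, decides whether $\varphi$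 is satisfiable in $\mathcal M^{rst}_{\mathcal A_1+\mathcal A_2}$ in time at most $C\,|\mathcal A|\,2^{c|\varphi|}$. -/

import Mathlib

namespace MixedRST

/-! ### The logic of common knowledge -/

/-- Formulas of the language of common knowledge over a set `𝒜` of agents and a collection `𝒢` of
sets of agents: primitive propositions (named by natural numbers), `¬`, `∧`, `K_i` for `i ∈ 𝒜`,
and `E_G`, `C_G` for `G ∈ 𝒢`. -/
inductive Fml (𝒜 : Type) (𝒢 : Set (Set 𝒜)) : Type
  | prop (p : ℕ) : Fml 𝒜 𝒢
  | neg (φ : Fml 𝒜 𝒢) : Fml 𝒜 𝒢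
  | conj (φ ψ : Fml 𝒜 𝒢) : Fml 𝒜 𝒢
  | know (i : 𝒜) (φ : Fml 𝒜 𝒢) : Fml 𝒜 𝒢
  | every (G : 𝒢) (φ : Fml 𝒜 𝒢) : Fml 𝒜 𝒢
  | common (G : 𝒢) (φ : Fml 𝒜 𝒢) : Fml 𝒜 𝒢

/-- The length of a formula: every symbol counts `1` (parentheses are not needed and not counted),
except that `C_G` counts `3`. -/
def Fml.length {𝒜 : Type} {𝒢 : Set (Set 𝒜)} : Fml 𝒜 𝒢 → ℕ
  | .prop _ => 1
  | .neg φ => φ.length + 1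
  | .conj φ ψ => φ.length + ψ.length + 1
  | .know _ φ => φ.length + 1
  | .every _ φ => φ.length + 1
  | .common _ φ => φ.length + 3

/-- Kripke structures over the agents `𝒜`; `rel i` is the relation of agent `i`. -/
structure Kripke (𝒜 : Type) where
  State : Type
  val : State → ℕ → Prop
  rel : 𝒜 → State → State → Prop

/-- The states at which everyone in `G` knows the event `X`. -/
def Kripke.everyone {𝒜 : Type} (M : Kripke 𝒜) (G : Set 𝒜) (X : Set M.State) : Set M.State :=
  {s | ∀ i ∈ G, ∀ t, M.rel i s t → t ∈ X}

/-- The set of states at which a formula is true. `C_G φ` holds iff `E_G^k φ` does for all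
`k = 1, 2, 3, …`. -/
def Kripke.truth {𝒜 : Type} {𝒢 : Set (Set 𝒜)} (M : Kripke 𝒜) : Fml 𝒜 𝒢 → Set M.State
  | .prop p => {s | M.val s p}
  | .neg φ => {s | s ∉ M.truth φ}
  | .conj φ ψ => {s | s ∈ M.truth φ ∧ s ∈ M.truth ψ}
  | .know i φ => {s | ∀ t, M.rel i s t → t ∈ M.truth φ}
  | .every G φ => M.everyone G.1 (M.truth φ)
  | .common G φ => {s | ∀ k : ℕ, 1 ≤ k → s ∈ (M.everyone G.1)^[k] (M.truth φ)}

/-- Mixed *rst* structures: the relations of the agents in `A₁` are reflexive, symmetric and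
transitive, those of the agents in `A₂` are reflexive and symmetric. -/
structure Kripke.IsMixedRST {𝒜 : Type} (M : Kripke 𝒜) (A₁ A₂ : Set 𝒜) : Prop where
  refl₁ : ∀ i ∈ A₁, ∀ s, M.rel i s s
  symm₁ : ∀ i ∈ A₁, ∀ s t, M.rel i s t → M.rel i t s
  trans₁ : ∀ i ∈ A₁, ∀ s t u, M.rel i s t → M.rel i t u → M.rel i s u
  refl₂ : ∀ i ∈ A₂, ∀ s, M.rel i s s
  symm₂ : ∀ i ∈ A₂, ∀ s t, M.rel i s t → M.rel i t s

/-- Satisfiability in the class of mixed *rst* structures. -/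
def Fml.SatMixedRST {𝒜 : Type} {𝒢 : Set (Set 𝒜)} (φ : Fml 𝒜 𝒢) (A₁ A₂ : Set 𝒜) : Prop :=
  ∃ M : Kripke 𝒜, M.IsMixedRST A₁ A₂ ∧ ∃ s : M.State, s ∈ M.truth φ

/-! ### The machine model: a random access machine with unit costs

A machine has registers and finitely many (as many as its program names) arrays, all of them
holding natural numbers. Its arithmetic is addition and truncated subtraction only. Programs are
structured programs over single instructions. -/

/-- The contents of the registers and of the arrays. -/
structure Store where
  reg : ℕ → ℕ
  arr : ℕ → ℕ → ℕ

/-- `reg x := v` -/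
def Store.setReg (σ : Store) (x v : ℕ) : Store :=
  { σ with reg := Function.update σ.reg x v }

/-- `arr a [j] := v` -/
def Store.setArr (σ : Store) (a j v : ℕ) : Store :=
  { σ with arr := Function.update σ.arr a (Function.update (σ.arr a) j v) }

/-- Programs. -/
inductive Prog : Type
  /-- `reg x := k` -/
  | const (x k : ℕ) : Prog
  /-- `reg x := reg y + reg z` -/
  | add (x y z : ℕ) : Prog
  /-- `reg x := reg y - reg z`, truncated at `0` -/
  | sub (x y z : ℕ) : Prog
  /-- `reg x := arr a [reg y]` -/
  | load (x a y : ℕ) : Prog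
  /-- `arr a [reg y] := reg z` -/
  | store (a y z : ℕ) : Prog
  /-- `reg x :=` the answer of the oracle to the query `(reg y, reg z)` -/
  | query (x y z : ℕ) : Prog
  /-- first `P`, then `Q` -/
  | seq (P Q : Prog) : Prog
  /-- `if reg x ≠ 0 then P else Q` -/
  | ite (x : ℕ) (P Q : Prog) : Prog
  /-- `while reg x ≠ 0 do P` -/
  | loop (x : ℕ) (P : Prog) : Prog

/-- `Exec O P σ t τ`: with oracle `O` and started in `σ`, the program `P` halts in `τ` after exactly
`t` steps. Every instruction (an oracle query included) and every test is one step. -/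
inductive Exec (O : ℕ → ℕ → ℕ) : Prog → Store → ℕ → Store → Prop
  | const (σ : Store) (x k : ℕ) : Exec O (.const x k) σ 1 (σ.setReg x k)
  | add (σ : Store) (x y z : ℕ) : Exec O (.add x y z) σ 1 (σ.setReg x (σ.reg y + σ.reg z))
  | sub (σ : Store) (x y z : ℕ) : Exec O (.sub x y z) σ 1 (σ.setReg x (σ.reg y - σ.reg z))
  | load (σ : Store) (x a y : ℕ) : Exec O (.load x a y) σ 1 (σ.setReg x (σ.arr a (σ.reg y)))
  | store (σ : Store) (a y z : ℕ) : Exec O (.store a y z) σ 1 (σ.setArr a (σ.reg y) (σ.reg z))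
  | query (σ : Store) (x y z : ℕ) :
      Exec O (.query x y z) σ 1 (σ.setReg x (O (σ.reg y) (σ.reg z)))
  | seq {P Q : Prog} {σ τ υ : Store} {t u : ℕ} (hP : Exec O P σ t τ) (hQ : Exec O Q τ u υ) :
      Exec O (.seq P Q) σ (t + u) υ
  | iteTrue {x : ℕ} {P Q : Prog} {σ τ : Store} {t : ℕ} (hx : σ.reg x ≠ 0)
      (hP : Exec O P σ t τ) : Exec O (.ite x P Q) σ (t + 1) τ
  | iteFalse {x : ℕ} {P Q : Prog} {σ τ : Store} {t : ℕ} (hx : σ.reg x = 0)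
      (hQ : Exec O Q σ t τ) : Exec O (.ite x P Q) σ (t + 1) τ
  | loopDone {x : ℕ} {P : Prog} {σ : Store} (hx : σ.reg x = 0) : Exec O (.loop x P) σ 1 σ
  | loopStep {x : ℕ} {P : Prog} {σ τ υ : Store} {t u : ℕ} (hx : σ.reg x ≠ 0)
      (hP : Exec O P σ t τ) (hL : Exec O (.loop x P) τ u υ) :
      Exec O (.loop x P) σ (t + 1 + u) υ

open Classical in
/-- With oracle `O`, from the initial store `σ`, the program `P` halts within `T` steps and tells in
register `0` (`1` for yes, `0` for no) whether `A` holds. -/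
def DecidesIn (O : ℕ → ℕ → ℕ) (P : Prog) (σ : Store) (A : Prop) (T : ℕ) : Prop :=
  ∃ t τ, Exec O P σ t τ ∧ t ≤ T ∧ τ.reg 0 = if A then 1 else 0

/-- The oracle that always answers `0`: a query to it is a mere assignment, so that a program run
with it is a program without an oracle. -/
def noOracle : ℕ → ℕ → ℕ := fun _ _ => 0

/-! ### Inputs

The agents are `0, …, n - 1`, and each `G ∈ 𝒢` has a name `name G : ℕ`. Names of propositions,
agents and sets of agents are single symbols, each of them one number. -/

/-- A formula in prefix notation; each operator or proposition is a pair consisting of its kind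
(`0`, …, `5` for propositions, `¬`, `∧`, `K`, `E`, `C`) and its index. -/
def Fml.tokens {n : ℕ} {𝒢 : Set (Set (Fin n))} (name : 𝒢 → ℕ) : Fml (Fin n) 𝒢 → List (ℕ × ℕ)
  | .prop p => [(0, p)]
  | .neg φ => (1, 0) :: φ.tokens name
  | .conj φ ψ => (2, 0) :: (φ.tokens name ++ ψ.tokens name)
  | .know i φ => (3, i) :: φ.tokens name
  | .every G φ => (4, name G) :: φ.tokens name
  | .common G φ => (5, name G) :: φ.tokens name

/-- The input `φ`: the number of its tokens is in register `0`, their kinds are in array `0`, their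
indices in array `1`; all else is `0`. -/
def formulaInput {n : ℕ} {𝒢 : Set (Set (Fin n))} (name : 𝒢 → ℕ) (φ : Fml (Fin n) 𝒢) : Store where
  reg x := if x = 0 then (φ.tokens name).length else 0
  arr a j :=
    if a = 0 then ((φ.tokens name).getD j (0, 0)).1
    else if a = 1 then ((φ.tokens name).getD j (0, 0)).2
    else 0

open Classical in
/-- The input `(n, A₁, φ)`: as `formulaInput`, and moreover the number `n` of agents is in register
`1` and the characteristic function of `A₁` is in array `2`. -/
noncomputable def agentsFormulaInput {n : ℕ} (A₁ : Set (Fin n)) {𝒢 : Set (Set (Fin n))}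
    (name : 𝒢 → ℕ) (φ : Fml (Fin n) 𝒢) : Store where
  reg x := if x = 1 then n else (formulaInput name φ).reg x
  arr a j :=
    if a = 2 then (if ∃ i ∈ A₁, (i : ℕ) = j then 1 else 0)
    else (formulaInput name φ).arr a j

open Classical in
/-- The membership oracle: it answers the query `(i, name G)` by `1` if `i ∈ G` and by `0` if
`i ∉ G`. -/
noncomputable def memberOracle {n : ℕ} {𝒢 : Set (Set (Fin n))} (name : 𝒢 → ℕ) : ℕ → ℕ → ℕ :=
  fun j g => if ∃ (i : Fin n) (G : 𝒢), (i : ℕ) = j ∧ name G = g ∧ i ∈ G.1 then 1 else 0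

/-- The input `(i, name G)` of an algorithm that decides membership: `i` is in register `0`, the
name of `G` in register `1`; all else is `0`. -/
def memberInput (i g : ℕ) : Store where
  reg x := if x = 0 then i else if x = 1 then g else 0
  arr _ _ := 0

/-- There is an algorithm that decides, given `i < n` and (the name of) `G ∈ 𝒢`, whether `i ∈ G`, in
at most `K * n` steps. -/
def LinearMembership {n : ℕ} {𝒢 : Set (Set (Fin n))} (name : 𝒢 → ℕ) (K : ℕ) : Prop :=
  ∃ Q : Prog, ∀ (i : Fin n) (G : 𝒢),
    DecidesIn noOracle Q (memberInput i (name G)) (i ∈ G.1) (K * n)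

end MixedRST

/-!
Satisfiability in mixed *rst* structures is decided by elimination of types. A *type* is a truth
assignment to the `L` subformula positions of `φ`. For each agent a world lies in a *class*: for a
transitive agent the equivalence class, of which one records the modal subformulas whose bodies (`ψ`
for `K_i ψ` and `E_G ψ`, and `ψ ∧ C_G ψ` for `C_G ψ`) are known there; for any other agent a class
is just a pair of related worlds, of which one records the modal subformulas that are true at one of
the two. As far as `φ` is concerned, an agent is determined by its *profile*, that is, the set of
the modal subformulas it takes part in, and whether it is transitive. So the triples of a type, a
class and a profile, along with a set of obligations for bookkeeping, can be coded by the numbers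
below `N = 2 ^ (4 * L + 2)`.

A code is eliminated if some obligation of a world as described cannot be met with the codes that
are left: the false modal subformulas must be refuted by neighbours, and those of the form `C_G ψ`
in finitely many steps, which is a least fixed point computation (`Shape.reach`). All obligations of
one world have to be met by one choice of classes for the agents; this choice is found agent by
agent, with a record of the obligations met so far (`Shape.mem_cover`). The codes that survive are
those of the worlds of a model built from them: `Shape.sat_iff_exists_survivor`, where one direction
is `Shape.truth_model`, and the other holds since the codes of the worlds of any given model are
never eliminated (`Shape.Rep.mem_iterate`).

There are at most `L + 1` obligations, so at most `L + 1` agents of each profile matter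
(`Shape.covers_keep`). Once the others are discarded, everything is polynomial in `N`; before
that, the time is linear in the number of agents, times a polynomial in `N`.
To get from this to programs, expressions and commands with bounded sums and loops are compiled
(`Expr.runs_code`, `Cmd.runs_code`), with polynomial bounds on the running time by induction on
their structure (`Expr.time_le`, `Cmd.time_le`); `runs_decideP` is the outcome.

It remains to compute the profiles. With an oracle this takes one query for each agent and each
position (`runs_uniformP`). Without an oracle the program may depend on the agents and on `𝒢`: a
binary search tree for the at most `2 ^ n` names of sets finds the leaf for a given `G` in `O(n)`
steps, and there the characteristic function of `G` is written down in another `O(n)` steps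
(`exists_runs_formulaInput`). Finally `N ^ d` is at most `2 ^ (6 * d * |φ|)`, as `1 ≤ L ≤ |φ|`. -/

namespace MixedRST

/-! ### Running programs within a time bound -/

/-- `P`, started in `σ`, halts in `τ` within `T` steps. -/
def Runs (O : ℕ → ℕ → ℕ) (P : Prog) (σ : Store) (T : ℕ) (τ : Store) : Prop :=
  ∃ t ≤ T, Exec O P σ t τ

/-- Sequential composition. -/
infixr:60 " ;; " => Prog.seq

section Runs

variable {O : ℕ → ℕ → ℕ} {P Q : Prog} {σ τ υ : Store} {T U : ℕ}

theorem Exec.runs {t : ℕ} (h : Exec O P σ t τ) : Runs O P σ t τ := ⟨t, le_rfl, h⟩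

theorem Runs.mono (h : Runs O P σ T τ) (hT : T ≤ U) : Runs O P σ U τ :=
  let ⟨t, ht, he⟩ := h
  ⟨t, ht.trans hT, he⟩

theorem Runs.seq (hP : Runs O P σ T τ) (hQ : Runs O Q τ U υ) : Runs O (P ;; Q) σ (T + U) υ :=
  let ⟨_, ht, he⟩ := hP
  let ⟨_, hu, hf⟩ := hQ
  ⟨_, Nat.add_le_add ht hu, .seq he hf⟩

theorem Runs.ite {x : ℕ} (hP : σ.reg x ≠ 0 → Runs O P σ T τ) (hQ : σ.reg x = 0 → Runs O Q σ T τ) :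
    Runs O (.ite x P Q) σ (T + 1) τ := by
  by_cases hx : σ.reg x = 0
  · obtain ⟨t, ht, he⟩ := hQ hx
    exact ⟨t + 1, by omega, .iteFalse hx he⟩
  · obtain ⟨t, ht, he⟩ := hP hx
    exact ⟨t + 1, by omega, .iteTrue hx he⟩

theorem Runs.loopDone {x : ℕ} (hx : σ.reg x = 0) : Runs O (.loop x P) σ 1 σ :=
  ⟨1, le_rfl, .loopDone hx⟩

theorem Runs.loopStep {x : ℕ} (hx : σ.reg x ≠ 0) (hP : Runs O P σ T τ)
    (hL : Runs O (.loop x P) τ U υ) : Runs O (.loop x P) σ (T + 1 + U) υ := by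
  obtain ⟨t, ht, he⟩ := hP
  obtain ⟨u, hu, hf⟩ := hL
  exact ⟨t + 1 + u, by omega, .loopStep hx he hf⟩

end Runs

@[simp] theorem Store.setReg_reg_self (σ : Store) (x v : ℕ) : (σ.setReg x v).reg x = v := by
  simp [Store.setReg]

theorem Store.setReg_reg_of_ne (σ : Store) {x y : ℕ} (v : ℕ) (h : y ≠ x) :
    (σ.setReg x v).reg y = σ.reg y := by
  simp [Store.setReg, h]

theorem Store.setReg_reg (σ : Store) (x y v : ℕ) :
    (σ.setReg x v).reg y = if y = x then v else σ.reg y := by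
  simp [Store.setReg, Function.update_apply]

@[simp] theorem Store.setReg_arr (σ : Store) (x v : ℕ) : (σ.setReg x v).arr = σ.arr := rfl

@[simp] theorem Store.setArr_reg (σ : Store) (a j v : ℕ) : (σ.setArr a j v).reg = σ.reg := rfl

theorem Store.setArr_arr (σ : Store) (a j v b k : ℕ) :
    (σ.setArr a j v).arr b k = if b = a ∧ k = j then v else σ.arr b k := by
  by_cases hb : b = a
  · subst hb; simp [Store.setArr, Function.update_apply]
  · simp [Store.setArr, hb]

theorem Store.setArr_arr_of_ne (σ : Store) {a b : ℕ} (j v : ℕ) (h : b ≠ a) :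
    (σ.setArr a j v).arr b = σ.arr b := by
  simp [Store.setArr, h]

/-- `τ` has the same arrays as `σ` and the same registers below `d`; the registers from `d` on are
scratch space. -/
def Agree (d : ℕ) (σ τ : Store) : Prop := (∀ r < d, τ.reg r = σ.reg r) ∧ τ.arr = σ.arr

theorem Agree.refl (d : ℕ) (σ : Store) : Agree d σ σ := ⟨fun _ _ => rfl, rfl⟩

theorem Agree.trans {d : ℕ} {σ τ υ : Store} (h : Agree d σ τ) (k : Agree d τ υ) : Agree d σ υ :=
  ⟨fun r hr => (k.1 r hr).trans (h.1 r hr), k.2.trans h.2⟩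

theorem Agree.mono {d e : ℕ} {σ τ : Store} (h : Agree d σ τ) (he : e ≤ d) : Agree e σ τ :=
  ⟨fun r hr => h.1 r (hr.trans_le he), h.2⟩

theorem Agree.setReg {d : ℕ} {σ τ : Store} (h : Agree d σ τ) {x : ℕ} (hx : d ≤ x) (v : ℕ) :
    Agree d σ (τ.setReg x v) :=
  ⟨fun r hr => by rw [Store.setReg_reg_of_ne _ _ (by omega), h.1 r hr], h.2⟩

/-! ### Expressions -/

/-- Expressions with values in `ℕ`: literals, registers, variables bound by a sum (de Bruijn
indices), addition, truncated subtraction, array entries, oracle queries, case distinction on `≠ 0`,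
and sums `∑ k < reg c, e k`. Read as truth values (`≠ 0`), sums are bounded existential
quantifiers. -/
inductive Expr : Type
  | lit (k : ℕ)
  | reg (r : ℕ)
  | var (k : ℕ)
  | add (e f : Expr)
  | sub (e f : Expr)
  | get (a : ℕ) (e : Expr)
  | ask (e f : Expr)
  | ite (e f g : Expr)
  | sum (c : ℕ) (e : Expr)

namespace Expr

/-- The value of an expression; `ρ` lists the values of the bound variables. (An index that is not
bound stands for register `0`.) -/
def eval (O : ℕ → ℕ → ℕ) (σ : Store) : Expr → List ℕ → ℕ
  | lit k, _ => k
  | reg r, _ => σ.reg r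
  | var k, ρ => ρ.getD k (σ.reg 0)
  | add e f, ρ => e.eval O σ ρ + f.eval O σ ρ
  | sub e f, ρ => e.eval O σ ρ - f.eval O σ ρ
  | get a e, ρ => σ.arr a (e.eval O σ ρ)
  | ask e f, ρ => O (e.eval O σ ρ) (f.eval O σ ρ)
  | ite e f g, ρ => if e.eval O σ ρ ≠ 0 then f.eval O σ ρ else g.eval O σ ρ
  | sum c e, ρ => ∑ k ∈ Finset.range (σ.reg c), e.eval O σ (k :: ρ)

/-- A program that computes the expression into register `d`, with scratch space from `d` on; `Γ`
lists the registers that hold the bound variables. -/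
def code : Expr → List ℕ → ℕ → Prog
  | lit k, _, d => .const d k
  | reg r, _, d => .const d 0 ;; .add d r d
  | var k, Γ, d => .const d 0 ;; .add d (Γ.getD k 0) d
  | add e f, Γ, d => e.code Γ d ;; f.code Γ (d + 1) ;; .add d d (d + 1)
  | sub e f, Γ, d => e.code Γ d ;; f.code Γ (d + 1) ;; .sub d d (d + 1)
  | get a e, Γ, d => e.code Γ d ;; .load d a d
  | ask e f, Γ, d => e.code Γ d ;; f.code Γ (d + 1) ;; .query d d (d + 1)
  | ite e f g, Γ, d => e.code Γ d ;; .ite d (f.code Γ d) (g.code Γ d)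
  | sum c e, Γ, d =>
    .const d 0 ;; .const (d + 1) 0 ;; .const (d + 2) 0 ;; .add (d + 2) c (d + 2) ;;
      .loop (d + 2) (e.code ((d + 1) :: Γ) (d + 3) ;; .add d d (d + 3) ;; .const (d + 3) 1 ;;
        .add (d + 1) (d + 1) (d + 3) ;; .sub (d + 2) (d + 2) (d + 3))

/-- A bound for the running time of `code`; `β` gives the contents of the registers. -/
def time (β : ℕ → ℕ) : Expr → ℕ
  | lit _ => 1
  | reg _ => 2
  | var _ => 2
  | add e f => e.time β + f.time β + 1
  | sub e f => e.time β + f.time β + 1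
  | get _ e => e.time β + 1
  | ask e f => e.time β + f.time β + 1
  | ite e f g => e.time β + f.time β + g.time β + 1
  | sum c e => 5 + β c * (e.time β + 5)

/-- The registers that bound sums. -/
def counters : Expr → List ℕ
  | lit _ => []
  | reg _ => []
  | var _ => []
  | add e f => e.counters ++ f.counters
  | sub e f => e.counters ++ f.counters
  | get _ e => e.counters
  | ask e f => e.counters ++ f.counters
  | ite e f g => e.counters ++ (f.counters ++ g.counters)
  | sum c e => c :: e.counters

/-- All registers mentioned are below `D`. -/
def Below (D : ℕ) : Expr → Prop
  | lit _ => True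
  | reg r => r < D
  | var _ => True
  | add e f => e.Below D ∧ f.Below D
  | sub e f => e.Below D ∧ f.Below D
  | get _ e => e.Below D
  | ask e f => e.Below D ∧ f.Below D
  | ite e f g => e.Below D ∧ f.Below D ∧ g.Below D
  | sum c e => c < D ∧ e.Below D

instance decidableBelow (D : ℕ) : (e : Expr) → Decidable (e.Below D)
  | lit _ => isTrue trivial
  | reg r => Nat.decLt r D
  | var _ => isTrue trivial
  | add e f => @instDecidableAnd _ _ (decidableBelow D e) (decidableBelow D f)
  | sub e f => @instDecidableAnd _ _ (decidableBelow D e) (decidableBelow D f)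
  | get _ e => decidableBelow D e
  | ask e f => @instDecidableAnd _ _ (decidableBelow D e) (decidableBelow D f)
  | ite e f g => @instDecidableAnd _ _ (decidableBelow D e)
      (@instDecidableAnd _ _ (decidableBelow D f) (decidableBelow D g))
  | sum c e => @instDecidableAnd _ _ (Nat.decLt c D) (decidableBelow D e)

theorem time_congr {β γ : ℕ → ℕ} (e : Expr) (h : ∀ r ∈ e.counters, β r = γ r) :
    e.time β = e.time γ := by
  induction e with
  | lit | reg | var => rfl
  | add e f he hf | sub e f he hf | ask e f he hf =>
    simp only [counters, List.mem_append] at h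
    simp only [time]
    rw [he fun r hr => h r (.inl hr), hf fun r hr => h r (.inr hr)]
  | get a e he => simp only [time]; rw [he h]
  | ite e f g he hf hg =>
    simp only [counters, List.mem_append] at h
    simp only [time]
    rw [he fun r hr => h r (.inl hr), hf fun r hr => h r (.inr (.inl hr)),
      hg fun r hr => h r (.inr (.inr hr))]
  | sum c e he =>
    simp only [counters, List.mem_cons] at h
    simp only [time]
    rw [h c (.inl rfl), he fun r hr => h r (.inr hr)]

/-- The coefficient in the polynomial time bound `time_le`. -/
def size : Expr → ℕ
  | lit _ => 1
  | reg _ => 2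
  | var _ => 2
  | add e f => e.size + f.size + 1
  | sub e f => e.size + f.size + 1
  | get _ e => e.size + 1
  | ask e f => e.size + f.size + 1
  | ite e f g => e.size + f.size + g.size + 1
  | sum _ e => e.size + 10

/-- The exponent in the polynomial time bound `time_le`. -/
def deg : Expr → ℕ
  | lit _ => 0
  | reg _ => 0
  | var _ => 0
  | add e f => e.deg + f.deg
  | sub e f => e.deg + f.deg
  | get _ e => e.deg
  | ask e f => e.deg + f.deg
  | ite e f g => e.deg + (f.deg + g.deg)
  | sum _ e => e.deg + 1

end Expr

/-- A bound that serves to add up polynomial time bounds. -/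
theorem add_add_one_le_mul_pow {a b m n B i j : ℕ} (hB : 1 ≤ B) (ha : a ≤ m * B ^ i)
    (hb : b ≤ n * B ^ j) : a + b + 1 ≤ (m + n + 1) * B ^ (i + j) := by
  have h1 : B ^ i ≤ B ^ (i + j) := Nat.pow_le_pow_right hB (by omega)
  have h2 : B ^ j ≤ B ^ (i + j) := Nat.pow_le_pow_right hB (by omega)
  have h3 : 1 ≤ B ^ (i + j) := Nat.one_le_pow _ _ hB
  have h4 := Nat.mul_le_mul_left m h1
  have h5 := Nat.mul_le_mul_left n h2
  rw [add_mul, add_mul, one_mul]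
  omega

theorem Expr.time_le {β : ℕ → ℕ} {B : ℕ} (hB : 1 ≤ B) (e : Expr)
    (h : ∀ r ∈ e.counters, β r ≤ B) : e.time β ≤ e.size * B ^ e.deg := by
  induction e with
  | lit | reg | var => simp [time, size, deg]
  | add e f he hf | sub e f he hf | ask e f he hf =>
    simp only [counters, List.mem_append] at h
    exact add_add_one_le_mul_pow hB (he fun r hr => h r (.inl hr)) (hf fun r hr => h r (.inr hr))
  | get a e he =>
    have := add_add_one_le_mul_pow (b := 0) (n := 0) (j := 0) hB (he h) (by simp)
    simpa [time, size, deg] using this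
  | ite e f g he hf hg =>
    simp only [counters, List.mem_append] at h
    have h1 : f.time β + g.time β ≤ (f.size + g.size) * B ^ (f.deg + g.deg) := by
      rw [add_mul]
      exact add_le_add
        ((hf fun r hr => h r (.inr (.inl hr))).trans
          (Nat.mul_le_mul_left _ (Nat.pow_le_pow_right hB (by omega))))
        ((hg fun r hr => h r (.inr (.inr hr))).trans
          (Nat.mul_le_mul_left _ (Nat.pow_le_pow_right hB (by omega))))
    have := add_add_one_le_mul_pow hB (he fun r hr => h r (.inl hr)) h1
    simpa only [time, size, deg, add_assoc] using this
  | sum c e he =>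
    simp only [counters, List.mem_cons] at h
    have h1 := he fun r hr => h r (.inr hr)
    have h2 : 1 ≤ B ^ e.deg := Nat.one_le_pow _ _ hB
    simp only [time, size, deg, pow_succ]
    calc
      _ ≤ 5 * (B ^ e.deg * B) + B * (e.size * B ^ e.deg + 5 * B ^ e.deg) := by
          have h3 : 1 ≤ B ^ e.deg * B := one_le_mul h2 hB
          have h4 : β c * (e.time β + 5) ≤ B * (e.size * B ^ e.deg + 5 * B ^ e.deg) :=
            Nat.mul_le_mul (h c (.inl rfl)) (by omega)
          omega
      _ = (e.size + 10) * (B ^ e.deg * B) := by ring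

theorem List.getD_cons_agree {ρ Γ : List ℕ} {v x : ℕ} {σ τ : Store}
    (h : ∀ k, ρ.getD k (σ.reg 0) = τ.reg (Γ.getD k 0)) (hx : τ.reg x = v) (k : ℕ) :
    (v :: ρ).getD k (σ.reg 0) = τ.reg ((x :: Γ).getD k 0) := by
  cases k with
  | zero => simp [hx]
  | succ k => simpa using h k

/-- Compiled expressions are correct: in a store that agrees with `σ` below `D`, with the values `ρ`
of the bound variables in the registers `Γ`, the code computes the value into register `d` and
changes nothing below `d`. -/
theorem Expr.runs_code (O : ℕ → ℕ → ℕ) {D : ℕ} (e : Expr) (he : e.Below D) {Γ ρ : List ℕ}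
    {d : ℕ} (hd : D ≤ d) {σ τ : Store} (hA : Agree D σ τ)
    (hρ : ∀ k, ρ.getD k (σ.reg 0) = τ.reg (Γ.getD k 0)) (hΓ : ∀ k, Γ.getD k 0 < d) :
    ∃ υ, Runs O (e.code Γ d) τ (e.time σ.reg) υ ∧ υ.reg d = e.eval O σ ρ ∧ Agree d τ υ := by
  induction e generalizing Γ ρ d τ with
  | lit k => exact ⟨_, (Exec.const τ d k).runs, by simp [eval], (Agree.refl _ _).setReg le_rfl _⟩
  | reg r =>
    refine ⟨_, ((Exec.const τ d 0).runs).seq (Exec.add _ d r d).runs, ?_,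
      ((Agree.refl _ _).setReg le_rfl _).setReg le_rfl _⟩
    have hr : r < D := he
    simp [eval, Store.setReg_reg, (show r ≠ d by omega), hA.1 r hr]
  | var k =>
    refine ⟨_, ((Exec.const τ d 0).runs).seq (Exec.add _ d (Γ.getD k 0) d).runs, ?_,
      ((Agree.refl _ _).setReg le_rfl _).setReg le_rfl _⟩
    rw [Store.setReg_reg_self, Store.setReg_reg_self, Store.setReg_reg_of_ne _ _ (hΓ k).ne, eval,
      hρ k, add_zero]
  | add e f ihe ihf | sub e f ihe ihf | ask e f ihe ihf =>
    obtain ⟨υ, h1, h2, h3⟩ := ihe he.1 hd hA hρ hΓ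
    obtain ⟨χ, k1, k2, k3⟩ := ihf he.2 (Γ := Γ) (ρ := ρ) (d := d + 1) (by omega)
      (hA.trans (h3.mono hd)) (fun k => by rw [hρ k, h3.1 _ (hΓ k)])
      (fun k => (hΓ k).trans (by omega))
    have hv : χ.reg d = e.eval O σ ρ := by rw [k3.1 d (by omega), h2]
    first
      | exact ⟨_, (h1.seq (k1.seq (Exec.add χ d d (d + 1)).runs)).mono
          (by simp only [time]; omega),
          by simp [eval, hv, k2], (h3.trans (k3.mono (by omega))).setReg le_rfl _⟩
      | exact ⟨_, (h1.seq (k1.seq (Exec.sub χ d d (d + 1)).runs)).mono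
          (by simp only [time]; omega),
          by simp [eval, hv, k2], (h3.trans (k3.mono (by omega))).setReg le_rfl _⟩
      | exact ⟨_, (h1.seq (k1.seq (Exec.query χ d d (d + 1)).runs)).mono
          (by simp only [time]; omega),
          by simp [eval, hv, k2], (h3.trans (k3.mono (by omega))).setReg le_rfl _⟩
  | get a e ihe =>
    obtain ⟨υ, h1, h2, h3⟩ := ihe he hd hA hρ hΓ
    refine ⟨_, h1.seq (Exec.load υ d a d).runs, ?_, h3.setReg le_rfl _⟩
    rw [Store.setReg_reg_self, h2, h3.2, hA.2, eval]
  | ite e f g ihe ihf ihg =>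
    obtain ⟨υ, h1, h2, h3⟩ := ihe he.1 hd hA hρ hΓ
    have hρ' : ∀ k, ρ.getD k (σ.reg 0) = υ.reg (Γ.getD k 0) := fun k => by rw [hρ k, h3.1 _ (hΓ k)]
    by_cases hc : e.eval O σ ρ = 0
    · obtain ⟨χ, k1, k2, k3⟩ := ihg he.2.2 hd (hA.trans (h3.mono hd)) hρ' hΓ
      refine ⟨χ, (h1.seq (Runs.ite (T := g.time σ.reg) ?_ fun _ => k1)).mono
          (by simp only [time]; omega),
        by simp [eval, hc, k2], h3.trans k3⟩
      exact fun h => (h (h2.trans hc)).elim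
    · obtain ⟨χ, k1, k2, k3⟩ := ihf he.2.1 hd (hA.trans (h3.mono hd)) hρ' hΓ
      refine ⟨χ, (h1.seq (Runs.ite (T := f.time σ.reg) (fun _ => k1) ?_)).mono
          (by simp only [time]; omega),
        by simp [eval, hc, k2], h3.trans k3⟩
      exact fun h => (hc (h2.symm.trans h)).elim
  | sum c e ihe =>
    have hc : c < D := he.1
    set B : Prog := e.code ((d + 1) :: Γ) (d + 3) ;; .add d d (d + 3) ;; .const (d + 3) 1 ;;
        .add (d + 1) (d + 1) (d + 3) ;; .sub (d + 2) (d + 2) (d + 3) with hB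
    have loop : ∀ m j : ℕ, ∀ υ : Store, j + m = σ.reg c → Agree d τ υ →
        υ.reg d = ∑ k ∈ Finset.range j, e.eval O σ (k :: ρ) → υ.reg (d + 1) = j →
        υ.reg (d + 2) = m → ∃ χ, Runs O (.loop (d + 2) B) υ (1 + m * (e.time σ.reg + 5)) χ ∧
          χ.reg d = ∑ k ∈ Finset.range (σ.reg c), e.eval O σ (k :: ρ) ∧ Agree d τ χ := by
      intro m
      induction m with
      | zero =>
        intro j υ hj hυ h0 h1 h2
        exact ⟨υ, (Runs.loopDone h2).mono (by omega), by rw [h0, ← hj, add_zero], hυ⟩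
      | succ m ihm =>
        intro j υ hj hυ h0 h1 h2
        obtain ⟨χ, k1, k2, k3⟩ := ihe he.2 (Γ := (d + 1) :: Γ) (ρ := j :: ρ) (d := d + 3)
          (τ := υ) (by omega) (hA.trans (hυ.mono hd))
          (List.getD_cons_agree (fun k => by rw [hρ k, hυ.1 _ (hΓ k)]) h1)
          (fun k => by
            cases k with
            | zero => simp
            | succ k => simpa using (hΓ k).trans (by omega))
        have e0 := k3.1 d (by omega)
        have e1 := k3.1 (d + 1) (by omega)
        have e2 := k3.1 (d + 2) (by omega)
        obtain ⟨ω, hω, hrun⟩ : ∃ ω, ω = _ ∧ Runs O B υ (e.time σ.reg + (1 + (1 + (1 + 1)))) ω :=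
          ⟨_, rfl, k1.seq ((Exec.add χ d d (d + 3)).runs.seq ((Exec.const _ (d + 3) 1).runs.seq
            ((Exec.add _ (d + 1) (d + 1) (d + 3)).runs.seq
              (Exec.sub _ (d + 2) (d + 2) (d + 3)).runs)))⟩
        obtain ⟨ψ, l1, l2, l3⟩ := ihm (j + 1) ω (by omega)
          (by
            rw [hω]
            exact ((((hυ.trans (k3.mono (by omega))).setReg le_rfl _).setReg (by omega) _).setReg
              (by omega) _).setReg (by omega) _)
          (by simp [hω, Store.setReg_reg, e0, h0, k2, Finset.sum_range_succ])
          (by simp [hω, Store.setReg_reg, e1, h1]) (by simp [hω, Store.setReg_reg, e2, h2])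
        refine ⟨ψ, (Runs.loopStep (by omega) hrun l1).mono ?_, l2, l3⟩
        rw [add_mul]
        omega
    obtain ⟨χ, k1, k2, k3⟩ := loop (σ.reg c) 0
      ((((τ.setReg d 0).setReg (d + 1) 0).setReg (d + 2) 0).setReg (d + 2)
        ((((τ.setReg d 0).setReg (d + 1) 0).setReg (d + 2) 0).reg c +
          (((τ.setReg d 0).setReg (d + 1) 0).setReg (d + 2) 0).reg (d + 2))) (by omega)
      (((((Agree.refl _ _).setReg le_rfl _).setReg (by omega) _).setReg (by omega) _).setReg
        (by omega) _)
      (by simp [Store.setReg_reg]) (by simp [Store.setReg_reg])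
      (by
        have h1 : c ≠ d := by omega
        have h2 : c ≠ d + 1 := by omega
        have h3 : c ≠ d + 2 := by omega
        simp [Store.setReg_reg, h1, h2, h3, hA.1 c hc])
    refine ⟨χ, ((Exec.const τ d 0).runs.seq ((Exec.const _ (d + 1) 0).runs.seq
      ((Exec.const _ (d + 2) 0).runs.seq ((Exec.add _ (d + 2) c (d + 2)).runs.seq k1)))).mono ?_,
      k2, k3⟩
    simp only [time]
    omega

/-! ### Commands -/

/-- Commands: assignment to a register, assignment to an array entry, composition, conditional
execution, and the loop `for i < reg n do c`. -/
inductive Cmd : Type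
  | set (r : ℕ) (e : Expr)
  | put (a : ℕ) (e f : Expr)
  | seq (c c' : Cmd)
  | cond (e : Expr) (c : Cmd)
  | loop (i n : ℕ) (c : Cmd)

namespace Cmd

/-- The effect of a command. -/
def run (O : ℕ → ℕ → ℕ) : Cmd → Store → Store
  | set r e, σ => σ.setReg r (e.eval O σ [])
  | put a e f, σ => σ.setArr a (e.eval O σ []) (f.eval O σ [])
  | seq c c', σ => c'.run O (c.run O σ)
  | cond e c, σ => if e.eval O σ [] ≠ 0 then c.run O σ else σ
  | loop i n c, σ =>
    (fun τ => (c.run O τ).setReg i ((c.run O τ).reg i + 1))^[σ.reg n] (σ.setReg i 0)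

/-- The program that a command stands for, with scratch space from register `D` on. -/
def code (D : ℕ) : Cmd → Prog
  | set r e => e.code [] D ;; .const (D + 1) 0 ;; .add r D (D + 1)
  | put a e f => e.code [] D ;; f.code [] (D + 1) ;; .store a D (D + 1)
  | seq c c' => c.code D ;; c'.code D
  | cond e c => e.code [] D ;; .ite D (c.code D) (.const D 0)
  | loop i n c => .const i 0 ;; .sub D n i ;;
      .loop D (c.code D ;; .const D 1 ;; .add i i D ;; .sub D n i)

/-- A bound for the running time of `code`; `β` gives the contents of the registers. -/
def time (β : ℕ → ℕ) : Cmd → ℕ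
  | set _ e => e.time β + 2
  | put _ e f => e.time β + f.time β + 1
  | seq c c' => c.time β + c'.time β
  | cond e c => e.time β + c.time β + 2
  | loop _ n c => 3 + β n * (c.time β + 4)

/-- The registers that a command may change. -/
def targets : Cmd → List ℕ
  | set r _ => [r]
  | put _ _ _ => []
  | seq c c' => c.targets ++ c'.targets
  | cond _ c => c.targets
  | loop i _ c => i :: c.targets

/-- The registers that bound sums and loops. -/
def counters : Cmd → List ℕ
  | set _ e => e.counters
  | put _ e f => e.counters ++ f.counters
  | seq c c' => c.counters ++ c'.counters
  | cond e c => e.counters ++ c.counters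
  | loop _ n c => n :: c.counters

/-- All registers mentioned are below `D`, and no loop changes its own index. -/
def Regular (D : ℕ) : Cmd → Prop
  | set r e => r < D ∧ e.Below D
  | put _ e f => e.Below D ∧ f.Below D
  | seq c c' => c.Regular D ∧ c'.Regular D
  | cond e c => e.Below D ∧ c.Regular D
  | loop i n c => i < D ∧ n < D ∧ i ∉ c.targets ∧ c.Regular D

instance decidableRegular (D : ℕ) : (c : Cmd) → Decidable (c.Regular D)
  | set r e => inferInstanceAs (Decidable (r < D ∧ e.Below D))
  | put _ e f => inferInstanceAs (Decidable (e.Below D ∧ f.Below D))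
  | seq c c' => @instDecidableAnd _ _ (decidableRegular D c) (decidableRegular D c')
  | cond e c => @instDecidableAnd _ _ (inferInstanceAs (Decidable (e.Below D)))
      (decidableRegular D c)
  | loop i n c => @instDecidableAnd _ _ (Nat.decLt i D) (@instDecidableAnd _ _ (Nat.decLt n D)
      (@instDecidableAnd _ _ (inferInstanceAs (Decidable (i ∉ c.targets))) (decidableRegular D c)))

/-- No register that bounds a sum or a loop is changed. -/
def Stable (c : Cmd) : Prop := ∀ r ∈ c.counters, r ∉ c.targets

instance (c : Cmd) : Decidable c.Stable := inferInstanceAs (Decidable (∀ r ∈ c.counters, _))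

theorem time_congr {β γ : ℕ → ℕ} (c : Cmd) (h : ∀ r ∈ c.counters, β r = γ r) :
    c.time β = c.time γ := by
  induction c with
  | set r e => simp only [time]; rw [e.time_congr h]
  | put a e f =>
    simp only [counters, List.mem_append] at h
    simp only [time]
    rw [e.time_congr fun r hr => h r (.inl hr), f.time_congr fun r hr => h r (.inr hr)]
  | seq c c' ih ih' =>
    simp only [counters, List.mem_append] at h
    simp only [time]
    rw [ih fun r hr => h r (.inl hr), ih' fun r hr => h r (.inr hr)]
  | cond e c ih =>
    simp only [counters, List.mem_append] at h
    simp only [time]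
    rw [e.time_congr fun r hr => h r (.inl hr), ih fun r hr => h r (.inr hr)]
  | loop i n c ih =>
    simp only [counters, List.mem_cons] at h
    simp only [time]
    rw [h n (.inl rfl), ih fun r hr => h r (.inr hr)]

/-- The coefficient in the polynomial time bound `time_le`. -/
def size : Cmd → ℕ
  | set _ e => e.size + 2
  | put _ e f => e.size + f.size + 1
  | seq c c' => c.size + c'.size + 1
  | cond e c => e.size + c.size + 2
  | loop _ _ c => c.size + 7

/-- The exponent in the polynomial time bound `time_le`. -/
def deg : Cmd → ℕ
  | set _ e => e.deg
  | put _ e f => e.deg + f.deg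
  | seq c c' => c.deg + c'.deg
  | cond e c => e.deg + c.deg
  | loop _ _ c => c.deg + 1

theorem time_le {β : ℕ → ℕ} {B : ℕ} (hB : 1 ≤ B) (c : Cmd) (h : ∀ r ∈ c.counters, β r ≤ B) :
    c.time β ≤ c.size * B ^ c.deg := by
  induction c with
  | set r e =>
    have h1 := e.time_le hB h
    have h2 : 1 ≤ B ^ e.deg := Nat.one_le_pow _ _ hB
    simp only [time, size, deg, add_mul]
    omega
  | put a e f =>
    simp only [counters, List.mem_append] at h
    exact add_add_one_le_mul_pow hB (e.time_le hB fun r hr => h r (.inl hr))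
      (f.time_le hB fun r hr => h r (.inr hr))
  | seq c c' ih ih' =>
    simp only [counters, List.mem_append] at h
    have := add_add_one_le_mul_pow hB (ih fun r hr => h r (.inl hr)) (ih' fun r hr => h r (.inr hr))
    simp only [time, size, deg]
    omega
  | cond e c ih =>
    simp only [counters, List.mem_append] at h
    have := add_add_one_le_mul_pow hB (e.time_le hB fun r hr => h r (.inl hr))
      (ih fun r hr => h r (.inr hr))
    have h2 : 1 ≤ B ^ (e.deg + c.deg) := Nat.one_le_pow _ _ hB
    simp only [time, size, deg]
    rw [add_mul] at this ⊢
    omega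
  | loop i n c ih =>
    simp only [counters, List.mem_cons] at h
    have h1 := ih fun r hr => h r (.inr hr)
    have h2 : 1 ≤ B ^ c.deg := Nat.one_le_pow _ _ hB
    have h3 : 1 ≤ B ^ c.deg * B := one_le_mul h2 hB
    have h4 : β n * (c.time β + 4) ≤ B * (c.size * B ^ c.deg + 4 * B ^ c.deg) :=
      Nat.mul_le_mul (h n (.inl rfl)) (by omega)
    simp only [time, size, deg, pow_succ]
    calc _ ≤ 3 * (B ^ c.deg * B) + B * (c.size * B ^ c.deg + 4 * B ^ c.deg) := by omega
      _ = _ := by ring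

theorem run_reg_of_notMem (O : ℕ → ℕ → ℕ) {r : ℕ} (c : Cmd) (h : r ∉ c.targets) (σ : Store) :
    (c.run O σ).reg r = σ.reg r := by
  induction c generalizing σ with
  | set x e =>
    have : r ≠ x := by simpa [targets] using h
    exact Store.setReg_reg_of_ne _ _ this
  | put => rfl
  | seq c c' ih ih' =>
    simp only [targets, List.mem_append, not_or] at h
    rw [run, ih' h.2, ih h.1]
  | cond e c ih =>
    rw [run]
    split
    · exact ih h σ
    · rfl
  | loop i n c ih =>
    simp only [targets, List.mem_cons, not_or] at h
    rw [run]
    generalize σ.reg n = m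
    induction m with
    | zero => exact Store.setReg_reg_of_ne _ _ h.1
    | succ m ihm =>
      rw [Function.iterate_succ_apply', Store.setReg_reg_of_ne _ _ h.1, ih h.2, ihm]

/-- Compiled commands are correct, up to the scratch registers from `D` on. -/
theorem runs_code (O : ℕ → ℕ → ℕ) {D : ℕ} (hD : 0 < D) (c : Cmd) (hc : c.Regular D) (hs : c.Stable)
    {σ τ : Store} (hA : Agree D σ τ) :
    ∃ υ, Runs O (c.code D) τ (c.time σ.reg) υ ∧ Agree D (c.run O σ) υ := by
  have nil : ∀ {σ τ : Store}, Agree D σ τ →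
      ∀ k, ([] : List ℕ).getD k (σ.reg 0) = τ.reg (([] : List ℕ).getD k 0) :=
    fun h k => by simp [h.1 0 hD]
  induction c generalizing σ τ with
  | set r e =>
    obtain ⟨υ, h1, h2, h3⟩ := e.runs_code O hc.2 le_rfl hA (nil hA) (by simpa using hD)
    refine ⟨_, h1.seq ((Exec.const υ (D + 1) 0).runs.seq (Exec.add _ r D (D + 1)).runs), ?_, ?_⟩
    · intro x hx
      have hx' : x ≠ D + 1 := by omega
      simp [run, Store.setReg_reg, h2, h3.1 x hx, hA.1 x hx, hx']
    · exact (h3.2.trans hA.2)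
  | put a e f =>
    obtain ⟨υ, h1, h2, h3⟩ := e.runs_code O hc.1 le_rfl hA (nil hA) (by simpa using hD)
    obtain ⟨χ, k1, k2, k3⟩ := f.runs_code O hc.2 (d := D + 1) (by omega) (hA.trans h3)
      (nil (hA.trans h3)) (by simp)
    refine ⟨_, (h1.seq (k1.seq (Exec.store χ a D (D + 1)).runs)).mono
          (by simp only [time]; omega), ?_, ?_⟩
    · intro x hx
      rw [Store.setArr_reg, k3.1 x (by omega), h3.1 x hx, hA.1 x hx, run, Store.setArr_reg]
    · rw [k2, k3.1 D (by omega), h2]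
      simp only [run, Store.setArr, k3.2, h3.2, hA.2]
  | seq c c' ih ih' =>
    have hs1 : c.Stable := fun r hr hr' => hs r (by simp [counters, hr]) (by simp [targets, hr'])
    have hs2 : c'.Stable := fun r hr hr' => hs r (by simp [counters, hr]) (by simp [targets, hr'])
    obtain ⟨υ, h1, h2⟩ := ih hc.1 hs1 hA
    obtain ⟨χ, k1, k2⟩ := ih' hc.2 hs2 h2
    refine ⟨χ, (h1.seq k1).mono ?_, k2⟩
    rw [time, c'.time_congr fun r hr => c.run_reg_of_notMem O
      (fun h => hs r (by simp [counters, hr]) (by simp [targets, h])) σ]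
  | cond e c ih =>
    have hs1 : c.Stable := fun r hr hr' => hs r (by simp [counters, hr]) hr'
    obtain ⟨υ, h1, h2, h3⟩ := e.runs_code O hc.1 le_rfl hA (nil hA) (by simpa using hD)
    by_cases h0 : e.eval O σ [] = 0
    · refine ⟨_, (h1.seq (Runs.ite (T := 1) (fun h => (h (h2.trans h0)).elim)
        fun _ => (Exec.const υ D 0).runs)).mono
          (by simp only [time]; omega), ?_⟩
      rw [run, if_neg (by simpa using h0)]
      exact (hA.trans h3).setReg le_rfl _
    · obtain ⟨χ, k1, k2⟩ := ih hc.2 hs1 (hA.trans h3)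
      refine ⟨χ, (h1.seq (Runs.ite (fun _ => k1)
        fun h => (h0 (h2.symm.trans h)).elim)).mono
          (by simp only [time]; omega), ?_⟩
      rwa [run, if_pos h0]
  | loop i n c ih =>
    obtain ⟨hi, hn, hic, hc⟩ := hc
    have hs1 : c.Stable := fun r hr hr' => hs r (by simp [counters, hr]) (by simp [targets, hr'])
    have hnt : n ∉ (loop i n c).targets := hs n (by simp [counters])
    have hni : n ≠ i := fun h => hnt (by simp [targets, h])
    have hnc : n ∉ c.targets := fun h => hnt (by simp [targets, h])
    set F : Store → Store := fun τ => (c.run O τ).setReg i ((c.run O τ).reg i + 1) with hF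
    have hFn : ∀ σ, (F σ).reg n = σ.reg n := fun σ => by
      rw [hF]
      simp only
      rw [Store.setReg_reg_of_ne _ _ hni, c.run_reg_of_notMem O hnc]
    have hFi : ∀ σ, (F σ).reg i = σ.reg i + 1 := fun σ => by
      rw [hF]
      simp only
      rw [Store.setReg_reg_self, c.run_reg_of_notMem O hic]
    have hFt : ∀ σ, c.time (F σ).reg = c.time σ.reg := fun σ => c.time_congr fun r hr => by
      have h1 : r ∉ (loop i n c).targets := hs r (by simp [counters, hr])
      have h2 : r ≠ i := fun h => h1 (by simp [targets, h])
      have h3 : r ∉ c.targets := fun h => h1 (by simp [targets, h])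
      rw [hF]
      simp only
      rw [Store.setReg_reg_of_ne _ _ h2, c.run_reg_of_notMem O h3]
    have main : ∀ m : ℕ, ∀ σ τ : Store, Agree D σ τ → σ.reg n = σ.reg i + m → τ.reg D = m →
        ∃ υ, Runs O (.loop D (c.code D ;; .const D 1 ;; .add i i D ;; .sub D n i)) τ
          (1 + m * (c.time σ.reg + 4)) υ ∧ Agree D (F^[m] σ) υ := by
      intro m
      induction m with
      | zero => exact fun σ τ h h0 h1 => ⟨τ, (Runs.loopDone h1).mono (by omega), h⟩
      | succ m ihm =>
        intro σ τ hA h0 h1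
        obtain ⟨υ, k1, k2⟩ := ih hc hs1 hA
        have r1 : Runs O (c.code D ;; .const D 1 ;; .add i i D ;; .sub D n i) τ
            (c.time σ.reg + (1 + (1 + 1))) _ :=
          k1.seq ((Exec.const υ D 1).runs.seq ((Exec.add _ i i D).runs.seq (Exec.sub _ D n i).runs))
        have hiD : i ≠ D := by omega
        have hnD : n ≠ D := by omega
        have hυi : υ.reg i = σ.reg i := by rw [k2.1 i hi, c.run_reg_of_notMem O hic]
        have hυn : υ.reg n = σ.reg n := by rw [k2.1 n hn, c.run_reg_of_notMem O hnc]
        obtain ⟨χ, l1, l2⟩ := ihm (F σ)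
          (((υ.setReg D 1).setReg i ((υ.setReg D 1).reg i + (υ.setReg D 1).reg D)).setReg D
            (((υ.setReg D 1).setReg i ((υ.setReg D 1).reg i + (υ.setReg D 1).reg D)).reg n -
              ((υ.setReg D 1).setReg i ((υ.setReg D 1).reg i + (υ.setReg D 1).reg D)).reg i))
          (by
            refine Agree.setReg (σ := F σ) (τ := (υ.setReg D 1).setReg i
              ((υ.setReg D 1).reg i + (υ.setReg D 1).reg D)) ⟨fun r hr => ?_, k2.2⟩ le_rfl _
            have hr' : r ≠ D := by omega
            simp only [hF, Store.setReg_reg, k2.1 r hr, k2.1 i hi, hr', hiD, if_false, if_true])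
          (by rw [hFn, hFi, h0]; omega)
          (by simp [Store.setReg_reg, hiD, hnD, hni, hυi, hυn, h0]; omega)
        refine ⟨χ, (Runs.loopStep (by omega) r1 l1).mono ?_, l2⟩
        rw [hFt, add_mul]
        omega
    have hnD : n ≠ D := by omega
    have hiD : i ≠ D := by omega
    obtain ⟨υ, k1, k2⟩ := main (σ.reg n) (σ.setReg i 0)
      ((τ.setReg i 0).setReg D ((τ.setReg i 0).reg n - (τ.setReg i 0).reg i))
      (by
        refine Agree.setReg (σ := σ.setReg i 0) (τ := τ.setReg i 0) ⟨fun r hr => ?_, hA.2⟩ le_rfl _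
        simp only [Store.setReg_reg, hA.1 r hr])
      (by simp [Store.setReg_reg, hni])
      (by simp [Store.setReg_reg, hni, hA.1 n hn])
    refine ⟨υ, ((Exec.const τ i 0).runs.seq ((Exec.sub _ D n i).runs.seq k1)).mono ?_, k2⟩
    have : c.time (σ.setReg i 0).reg = c.time σ.reg := c.time_congr fun r hr =>
      Store.setReg_reg_of_ne _ _ fun h => hs r (by simp [counters, hr]) (by simp [targets, h])
    rw [this, time]
    omega

/-- The invariant rule for loops. -/
theorem run_loop (O : ℕ → ℕ → ℕ) {i n : ℕ} {c : Cmd} (hi : i ∉ c.targets) {σ : Store}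
    (I : ℕ → Store → Prop) (h0 : I 0 (σ.setReg i 0))
    (hI : ∀ k < σ.reg n, ∀ τ, I k τ → τ.reg i = k →
      I (k + 1) ((c.run O τ).setReg i (k + 1))) :
    I (σ.reg n) ((loop i n c).run O σ) := by
  rw [run]
  suffices ∀ m ≤ σ.reg n, ∀ τ, τ = (fun τ =>
      (c.run O τ).setReg i ((c.run O τ).reg i + 1))^[m] (σ.setReg i 0) → I m τ ∧ τ.reg i = m from
    (this _ le_rfl _ rfl).1
  intro m
  induction m with
  | zero => rintro - _ rfl; exact ⟨h0, by simp⟩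
  | succ m ih =>
    rintro hm _ rfl
    obtain ⟨h1, h2⟩ := ih (by omega) _ rfl
    rw [Function.iterate_succ_apply']
    refine ⟨?_, by rw [Store.setReg_reg_self, c.run_reg_of_notMem O hi, h2]⟩
    have := hI m hm _ h1 h2
    rwa [c.run_reg_of_notMem O hi, h2]

end Cmd

/-! ### Chains of sets of numbers below a bound -/

theorem exists_testBit (W : ℕ) (p : ℕ → Prop) : ∃ x < 2 ^ W, ∀ j < W, x.testBit j ↔ p j := by
  classical
  induction W with
  | zero => exact ⟨0, by simp, by simp⟩
  | succ W ih =>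
    obtain ⟨x, hx, h⟩ := ih
    by_cases hp : p W
    · refine ⟨2 ^ W + x, by rw [pow_succ]; omega, fun j hj => ?_⟩
      rcases Nat.lt_succ_iff_lt_or_eq.1 hj with hj | rfl
      · rw [Nat.testBit_two_pow_add_gt hj, h j hj]
      · rw [Nat.testBit_two_pow_add_eq, Nat.testBit_lt_two_pow hx]; simpa using hp
    · refine ⟨x, by rw [pow_succ]; omega, fun j hj => ?_⟩
      rcases Nat.lt_succ_iff_lt_or_eq.1 hj with hj | rfl
      · exact h j hj
      · rw [Nat.testBit_lt_two_pow hx]; simpa using hp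

/-- A decreasing iteration on subsets of `{0, …, N - 1}` is stationary after `N` steps. -/
theorem iterate_fixed_of_subset {N : ℕ} (G : Set ℕ → Set ℕ) (hG : ∀ X, G X ⊆ X) {X : Set ℕ}
    (hX : X ⊆ Set.Iio N) : G (G^[N] X) = G^[N] X := by
  by_contra hne
  have hsub : ∀ k, G^[k] X ⊆ Set.Iio N := fun k => by
    induction k with
    | zero => exact hX
    | succ k ih => rw [Function.iterate_succ_apply']; exact (hG _).trans ih
  have hlt : ∀ k ≤ N, (G^[k + 1] X).ncard < (G^[k] X).ncard := fun k hk => by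
    refine Set.ncard_lt_ncard ?_ ((Set.finite_Iio N).subset (hsub k))
    rw [Function.iterate_succ_apply']
    refine (hG _).ssubset_of_ne fun h => hne ?_
    obtain ⟨m, rfl⟩ := Nat.exists_eq_add_of_le' hk
    have : G^[m] (G^[k] X) = G^[k] X := Function.iterate_fixed h m
    rw [Function.iterate_add_apply, this, h]
  have hle : ∀ k ≤ N + 1, (G^[k] X).ncard + k ≤ N := fun k => by
    induction k with
    | zero =>
      intro _
      have := Set.ncard_le_ncard hX (Set.finite_Iio N)
      simpa [Set.ncard_eq_toFinset_card'] using this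
    | succ k ih =>
      intro hk
      have h1 := hlt k (by omega)
      have h2 := ih (by omega)
      omega
  have := hle (N + 1) le_rfl
  omega

/-- The least fixed point of a monotone operator on subsets of `{0, …, N - 1}` is reached after `N`
steps. -/
theorem iterate_fixed_of_mono {N : ℕ} (H : Set ℕ → Set ℕ) (hH : Monotone H)
    (hN : ∀ X, H X ⊆ Set.Iio N) : H (H^[N] ∅) = H^[N] ∅ := by
  by_contra hne
  have hmono : ∀ k, H^[k] ∅ ⊆ H^[k + 1] ∅ := fun k => by
    induction k with
    | zero => exact Set.empty_subset _
    | succ k ih =>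
      rw [Function.iterate_succ_apply', Function.iterate_succ_apply' (n := k + 1)]
      exact hH ih
  have hsub : ∀ k, H^[k] ∅ ⊆ Set.Iio N := fun k => by
    cases k with
    | zero => exact Set.empty_subset _
    | succ k => rw [Function.iterate_succ_apply']; exact hN _
  have hle : ∀ k ≤ N + 1, k ≤ (H^[k] ∅).ncard := fun k => by
    induction k with
    | zero => intro _; exact Nat.zero_le _
    | succ k ih =>
      intro hk
      have : (H^[k] ∅).ncard < (H^[k + 1] ∅).ncard := by
        refine Set.ncard_lt_ncard ((hmono k).ssubset_of_ne fun h => hne ?_)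
          ((Set.finite_Iio N).subset (hsub _))
        rw [Function.iterate_succ_apply'] at h
        obtain ⟨m, hm⟩ := Nat.exists_eq_add_of_le' (Nat.le_of_lt_succ hk)
        have : H^[m] (H^[k] ∅) = H^[k] ∅ := Function.iterate_fixed h.symm m
        rw [hm, Function.iterate_add_apply, this, ← h]
      have := ih (by omega)
      omega
  have h1 := hle (N + 1) le_rfl
  have h2 := Set.ncard_le_ncard (hsub (N + 1)) (Set.finite_Iio N)
  have h3 : (Set.Iio N).ncard = N := by simp [Set.ncard_eq_toFinset_card']
  omega

/-! ### Bounding multiplicities in a list -/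

/-- The list `l` with all but the first `m` occurrences of each entry deleted. -/
def keep (m : ℕ) (l : List ℕ) : List ℕ :=
  l.foldl (fun acc q => if acc.count q < m then acc ++ [q] else acc) []

theorem keep_append_singleton (m : ℕ) (l : List ℕ) (q : ℕ) :
    keep m (l ++ [q]) = if (keep m l).count q < m then keep m l ++ [q] else keep m l := by
  rw [keep, List.foldl_append]
  rfl

theorem count_keep (m : ℕ) (l : List ℕ) (q : ℕ) : (keep m l).count q = min (l.count q) m := by
  induction l using List.reverseRecOn with
  | nil => simp [keep]
  | append_singleton l p ih =>
    rw [keep_append_singleton, List.count_append]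
    by_cases hpq : p = q
    · subst hpq
      split <;> simp_all <;> omega
    · split <;> simp [hpq, ih]

theorem length_keep_le (m b : ℕ) (l : List ℕ) (hl : ∀ q ∈ l, q < b) :
    (keep m l).length ≤ b * m := by
  have hmem : ∀ q ∈ keep m l, q < b := fun q hq => by
    have h1 := List.count_pos_iff.2 hq
    rw [count_keep] at h1
    exact hl q (List.count_pos_iff.1 (by omega))
  have h := Multiset.sum_count_eq_card (s := Finset.range b) (m := (keep m l : Multiset ℕ))
    (by simpa using hmem)
  rw [Multiset.coe_card] at h
  rw [← h]
  refine (Finset.sum_le_card_nsmul _ _ m fun q _ => ?_).trans (by simp)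
  rw [Multiset.coe_count, count_keep]
  exact min_le_right _ _

theorem exists_perm_map_eq {α β : Type*} (f : α → β) {l m : List β} (h : l.Perm m) :
    ∀ Z : List α, Z.map f = l → ∃ Z' : List α, Z'.Perm Z ∧ Z'.map f = m := by
  induction h with
  | nil => exact fun Z hZ => ⟨Z, .refl _, hZ⟩
  | cons x h ih =>
    intro Z hZ
    cases Z with
    | nil => simp at hZ
    | cons z Z =>
      simp only [List.map_cons, List.cons.injEq] at hZ
      obtain ⟨Z', h1, h2⟩ := ih Z hZ.2
      exact ⟨z :: Z', h1.cons z, by simp [hZ.1, h2]⟩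
  | swap x y l =>
    intro Z hZ
    match Z, hZ with
    | a :: b :: Z, hZ =>
      simp only [List.map_cons, List.cons.injEq] at hZ
      exact ⟨b :: a :: Z, .swap _ _ _, by simp [hZ.1, hZ.2.1, hZ.2.2]⟩
  | trans h k ih jh =>
    intro Z hZ
    obtain ⟨Z', h1, h2⟩ := ih Z hZ
    obtain ⟨Z'', h3, h4⟩ := jh Z' h2
    exact ⟨Z'', h3.trans h1, h4⟩

/-! ### Types of worlds and of classes -/

/-- What the procedure needs to know of the formula: the number `L` of tokens, their kinds and
indices, and `finish t`, the position just after the subformula that starts at position `t`. The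
subformula at position `t` is called subformula `t`. -/
structure Shape where
  L : ℕ
  kind : ℕ → ℕ
  idx : ℕ → ℕ
  finish : ℕ → ℕ

namespace Shape

variable (Λ : Shape)

/-- The number of codes. A code `x < N` consists of four sets of positions, represented by bits:
`S`, the subformulas true at a world; `F`, what the class of the world for some agent demands; `P`,
the profile of the agent; and `D`, a set of obligations. -/
def N : ℕ := 2 ^ (4 * Λ.L + 2)

/-- Subformula `t` is true at worlds of type `x`. -/
def S (x t : ℕ) : Prop := x.testBit t

/-- In the class described by `x`, the body of the modal subformula `t` is known. -/
def F (x t : ℕ) : Prop := x.testBit (Λ.L + t)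

/-- For `t < L`, the agent is among those of the modal subformula `t` (with `K_i` read as
`E_{i}`); for `t = L`, the relation of the agent is transitive. -/
def P (x t : ℕ) : Prop := x.testBit (Λ.L + Λ.L + t)

/-- The obligation `t` has to be met. -/
def D (x t : ℕ) : Prop := x.testBit (Λ.L + Λ.L + Λ.L + 1 + t)

/-- `x` and `y` have the same set `S`. -/
def EqS (x y : ℕ) : Prop := ∀ t < Λ.L, S x t ↔ S y t

/-- `x` and `y` have the same set `F`. -/
def EqF (x y : ℕ) : Prop := ∀ t < Λ.L, Λ.F x t ↔ Λ.F y t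

/-- `x` and `y` have the same set `P`. -/
def EqP (x y : ℕ) : Prop := ∀ t < Λ.L + 1, Λ.P x t ↔ Λ.P y t

/-- What an agent of the modal subformula `t` must know for `t` to be true: the immediate
subformula and, for `C_G`, the formula itself. -/
def Body (x t : ℕ) : Prop := S x (t + 1) ∧ (Λ.kind t = 5 → S x t)

/-- The truth values in `x` respect the Boolean connectives, and knowledge is of true facts. -/
def Cons (x : ℕ) : Prop := ∀ t < Λ.L,
  (Λ.kind t = 0 → ∀ u < Λ.L, Λ.kind u = 0 → Λ.idx u = Λ.idx t → (S x t ↔ S x u)) ∧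
  (Λ.kind t = 1 → (S x t ↔ ¬ S x (t + 1))) ∧
  (Λ.kind t = 2 → (S x t ↔ S x (t + 1) ∧ S x (Λ.finish (t + 1)))) ∧
  (3 ≤ Λ.kind t → S x t → Λ.Body x t)

/-- A world of type `S` can be in a class of type `F` of an agent of profile `P`. -/
def Comp (x : ℕ) : Prop := ∀ t < Λ.L, 3 ≤ Λ.kind t → Λ.P x t →
  (S x t → Λ.F x t) ∧ (Λ.F x t → Λ.Body x t)

/-- The classes `z`, `z'` belong to one agent and one world, and are the same if the relation of the
agent is transitive. (For an agent without transitivity, a class is a pair of related worlds.) -/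
def Link (z z' : ℕ) : Prop := Λ.EqS z z' ∧ Λ.EqP z z' ∧ (Λ.P z Λ.L → Λ.EqF z z')

/-- The obligations at `x`: to refute the false modal subformulas `t < L`, and, as obligation `L`,
to be in the class that `x` describes. -/
def Obliged (x t : ℕ) : Prop := t = Λ.L ∨ (t < Λ.L ∧ 3 ≤ Λ.kind t ∧ ¬ S x t)

/-- The class `z` meets the obligation `t` of `x` by means of a code in `T`. For `t = t₀` of kind
`C_G`, the code met must be a step towards a refutation of the immediate subformula, where `X` is
the set of codes for which such a refutation is already established. -/
def Hit (T X : Set ℕ) (t₀ x z t : ℕ) : Prop :=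
  (t = Λ.L ∧ Λ.EqP x z ∧ Λ.EqF x z) ∨
  (t < Λ.L ∧ Λ.P z t ∧ ∃ x' < Λ.N, x' ∈ T ∧ Λ.EqP z x' ∧ Λ.EqF z x' ∧ ¬ Λ.Body x' t ∧
    (t = t₀ → Λ.kind t = 5 → ¬ S x' (t + 1) ∨ x' ∈ X))

/-- The agent to which `z` gives a class meets the obligation `t` of `x`. -/
def Serve (T X : Set ℕ) (t₀ x z t : ℕ) : Prop :=
  ∃ z' < Λ.N, Λ.Link z z' ∧ Λ.Comp z' ∧ Λ.Hit T X t₀ x z' t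

/-- `z` assigns to the world `x` a class for an agent of profile `q`. -/
def Good (x z q : ℕ) : Prop :=
  z < Λ.N ∧ Λ.EqS x z ∧ (∀ t < Λ.L + 1, Λ.P z t ↔ q.testBit t) ∧ Λ.Comp z

variable {Λ}

theorem EqS.symm {x y : ℕ} (h : Λ.EqS x y) : Λ.EqS y x := fun t ht => (h t ht).symm
theorem EqF.symm {x y : ℕ} (h : Λ.EqF x y) : Λ.EqF y x := fun t ht => (h t ht).symm
theorem EqP.symm {x y : ℕ} (h : Λ.EqP x y) : Λ.EqP y x := fun t ht => (h t ht).symm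
theorem EqS.trans {x y z : ℕ} (h : Λ.EqS x y) (k : Λ.EqS y z) : Λ.EqS x z :=
  fun t ht => (h t ht).trans (k t ht)
theorem EqF.trans {x y z : ℕ} (h : Λ.EqF x y) (k : Λ.EqF y z) : Λ.EqF x z :=
  fun t ht => (h t ht).trans (k t ht)
theorem EqP.trans {x y z : ℕ} (h : Λ.EqP x y) (k : Λ.EqP y z) : Λ.EqP x z :=
  fun t ht => (h t ht).trans (k t ht)

theorem Hit.congr {T X : Set ℕ} {t₀ x y z t : ℕ} (hP : Λ.EqP x y) (hF : Λ.EqF x y)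
    (h : Λ.Hit T X t₀ x z t) : Λ.Hit T X t₀ y z t := by
  rcases h with ⟨h1, h2, h3⟩ | h
  · exact .inl ⟨h1, hP.symm.trans h2, hF.symm.trans h3⟩
  · exact .inr h

theorem Serve.congr {T X : Set ℕ} {t₀ x y z t : ℕ} (hP : Λ.EqP x y) (hF : Λ.EqF x y)
    (h : Λ.Serve T X t₀ x z t) : Λ.Serve T X t₀ y z t :=
  let ⟨z', h1, h2, h3, h4⟩ := h
  ⟨z', h1, h2, h3, h4.congr hP hF⟩

theorem Serve.mono {T X Y : Set ℕ} (hXY : X ⊆ Y) {t₀ x z t : ℕ} (h : Λ.Serve T X t₀ x z t) :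
    Λ.Serve T Y t₀ x z t := by
  obtain ⟨z', h1, h2, h3, h4⟩ := h
  refine ⟨z', h1, h2, h3, h4.imp_right ?_⟩
  rintro ⟨k1, k2, x', k3, k4, k5, k6, k7, k8⟩
  exact ⟨k1, k2, x', k3, k4, k5, k6, k7, fun a b => (k8 a b).imp_right (hXY ·)⟩

theorem Good.congr {x y z q : ℕ} (h : Λ.EqS x y) (hg : Λ.Good x z q) : Λ.Good y z q :=
  ⟨hg.1, h.symm.trans hg.2.1, hg.2.2⟩

theorem Good.link {x z z' q : ℕ} (hg : Λ.Good x z q) (hz : z' < Λ.N) (h : Λ.Link z z')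
    (hc : Λ.Comp z') : Λ.Good x z' q :=
  ⟨hz, hg.2.1.trans h.1, fun t ht => (h.2.1 t ht).symm.trans (hg.2.2.1 t ht), hc⟩

variable (Λ) in
theorem exists_code (s f p d : ℕ → Prop) : ∃ x < Λ.N, (∀ t < Λ.L, S x t ↔ s t) ∧
    (∀ t < Λ.L, Λ.F x t ↔ f t) ∧ (∀ t < Λ.L + 1, Λ.P x t ↔ p t) ∧
    (∀ t < Λ.L + 1, Λ.D x t ↔ d t) := by
  obtain ⟨x, hx, h⟩ := exists_testBit (4 * Λ.L + 2) fun j =>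
    if j < Λ.L then s j else if j < Λ.L + Λ.L then f (j - Λ.L) else
      if j < Λ.L + Λ.L + Λ.L + 1 then p (j - (Λ.L + Λ.L)) else d (j - (Λ.L + Λ.L + Λ.L + 1))
  refine ⟨x, hx, fun t ht => ?_, fun t ht => ?_, fun t ht => ?_, fun t ht => ?_⟩
  · rw [S, h t (by omega), if_pos ht]
  · rw [F, h _ (by omega), if_neg (by omega), if_pos (by omega), Nat.add_sub_cancel_left]
  · rw [P, h _ (by omega), if_neg (by omega), if_neg (by omega), if_pos (by omega),
      Nat.add_sub_cancel_left]
  · rw [D, h _ (by omega), if_neg (by omega), if_neg (by omega), if_neg (by omega),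
      Nat.add_sub_cancel_left]

/-! ### Covering the obligations of a world -/

variable (Λ) in
/-- The codes with no obligation to be met. -/
def start : Set ℕ := {y | ∀ t < Λ.L + 1, ¬ Λ.D y t}

variable (Λ) in
/-- The codes whose obligations can be met by agents that meet those of a code in `Y` and one more
agent, of profile `q`. -/
def extend (T X : Set ℕ) (t₀ q : ℕ) (Y : Set ℕ) : Set ℕ :=
  {y | ∃ y' < Λ.N, y' ∈ Y ∧ Λ.EqS y y' ∧ Λ.EqF y y' ∧ Λ.EqP y y' ∧
    ∃ z < Λ.N, Λ.EqS y z ∧ (∀ t < Λ.L + 1, Λ.P z t ↔ q.testBit t) ∧ Λ.Comp z ∧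
      ∀ t < Λ.L + 1, Λ.D y t → Λ.D y' t ∨ Λ.Serve T X t₀ y z t}

variable (Λ) in
/-- The codes whose obligations can be met by agents whose profiles are listed in `l`. -/
def cover (T X : Set ℕ) (t₀ : ℕ) (l : List ℕ) : Set ℕ :=
  l.foldl (fun Y q => Λ.extend T X t₀ q Y) Λ.start

variable (Λ) in
/-- Agents with the profiles in `l` can be given classes that together meet all obligations of
`x`. -/
def Covers (T X : Set ℕ) (t₀ : ℕ) (l : List ℕ) (x : ℕ) : Prop :=
  ∃ Z : List (ℕ × ℕ), (Z.map Prod.snd).Perm l ∧ (∀ p ∈ Z, Λ.Good x p.1 p.2) ∧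
    ∀ t < Λ.L + 1, Λ.Obliged x t → ∃ p ∈ Z, Λ.Serve T X t₀ x p.1 t

/-- `cover` is a dynamic program for the choice of one class per agent: the set `D` of a code
records which obligations the agents considered so far have to meet. -/
theorem mem_cover {T X : Set ℕ} {t₀ : ℕ} {l : List ℕ} {y : ℕ} :
    y ∈ Λ.cover T X t₀ l ↔ ∃ Z : List (ℕ × ℕ), Z.map Prod.snd = l ∧
      (∀ p ∈ Z, Λ.Good y p.1 p.2) ∧
      ∀ t < Λ.L + 1, Λ.D y t → ∃ p ∈ Z, Λ.Serve T X t₀ y p.1 t := by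
  induction l using List.reverseRecOn generalizing y with
  | nil => simp [cover, start]
  | append_singleton l q ih =>
    rw [cover, List.foldl_append, List.foldl_cons, List.foldl_nil]
    constructor
    · rintro ⟨y', -, hy', hS, hF, hP, z, hz, hzS, hzP, hzc, h⟩
      obtain ⟨Z, h1, h2, h3⟩ := ih.1 hy'
      refine ⟨Z ++ [(z, q)], by simp [h1], ?_, fun t ht hD => ?_⟩
      · simp only [List.mem_append, List.mem_singleton]
        rintro p (hp | rfl)
        · exact (h2 p hp).congr hS.symm
        · exact ⟨hz, hzS, hzP, hzc⟩
      · rcases h t ht hD with h | h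
        · obtain ⟨p, hp, hs⟩ := h3 t ht h
          exact ⟨p, by simp [hp], hs.congr hP.symm hF.symm⟩
        · exact ⟨(z, q), by simp, h⟩
    · rintro ⟨Z, h1, h2, h3⟩
      rcases List.eq_nil_or_concat Z with rfl | ⟨Z', ⟨z, q'⟩, rfl⟩
      · simp at h1
      simp only [List.concat_eq_append, List.map_append, List.map_cons, List.map_nil] at h1
      obtain ⟨hl, hq⟩ := List.append_inj' h1 rfl
      simp only [List.cons.injEq, and_true] at hq
      subst hq
      obtain ⟨y', hy', k1, k2, k3, k4⟩ := Λ.exists_code (S y) (Λ.F y) (Λ.P y)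
        (fun t => ∃ p ∈ Z', Λ.Serve T X t₀ y p.1 t)
      have eS : Λ.EqS y y' := fun t ht => (k1 t ht).symm
      have eF : Λ.EqF y y' := fun t ht => (k2 t ht).symm
      have eP : Λ.EqP y y' := fun t ht => (k3 t ht).symm
      have hg : Λ.Good y z q' := h2 (z, q') (by simp)
      refine ⟨y', hy', ih.2 ⟨Z', hl, fun p hp => (h2 p (by simp [hp])).congr eS, fun t ht hD => ?_⟩,
        eS, eF, eP, z, hg.1, hg.2.1, hg.2.2.1, hg.2.2.2, fun t ht hD => ?_⟩
      · obtain ⟨p, hp, hs⟩ := (k4 t ht).1 hD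
        exact ⟨p, hp, hs.congr eP eF⟩
      · obtain ⟨p, hp, hs⟩ := h3 t ht hD
        simp only [List.concat_eq_append, List.mem_append, List.mem_singleton] at hp
        rcases hp with hp | rfl
        · exact .inl ((k4 t ht).2 ⟨p, hp, hs⟩)
        · exact .inr hs

theorem covers_iff {T X : Set ℕ} {t₀ : ℕ} {l : List ℕ} {x : ℕ} :
    Λ.Covers T X t₀ l x ↔ ∃ y < Λ.N, y ∈ Λ.cover T X t₀ l ∧ Λ.EqS x y ∧ Λ.EqF x y ∧ Λ.EqP x y ∧
      ∀ t < Λ.L + 1, Λ.Obliged x t → Λ.D y t := by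
  constructor
  · rintro ⟨Z₀, h1, h2, h3⟩
    obtain ⟨Z, hZ, h1⟩ := exists_perm_map_eq _ h1 Z₀ rfl
    obtain ⟨y, hy, k1, k2, k3, k4⟩ := Λ.exists_code (S x) (Λ.F x) (Λ.P x) (Λ.Obliged x)
    have eS : Λ.EqS x y := fun t ht => (k1 t ht).symm
    have eF : Λ.EqF x y := fun t ht => (k2 t ht).symm
    have eP : Λ.EqP x y := fun t ht => (k3 t ht).symm
    refine ⟨y, hy, mem_cover.2 ⟨Z, h1, fun p hp => (h2 p (hZ.mem_iff.1 hp)).congr eS,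
      fun t ht hD => ?_⟩, eS, eF, eP, fun t ht => (k4 t ht).2⟩
    obtain ⟨p, hp, hs⟩ := h3 t ht ((k4 t ht).1 hD)
    exact ⟨p, hZ.mem_iff.2 hp, hs.congr eP eF⟩
  · rintro ⟨y, hy, hc, eS, eF, eP, h⟩
    obtain ⟨Z, h1, h2, h3⟩ := mem_cover.1 hc
    refine ⟨Z, .of_eq h1, fun p hp => (h2 p hp).congr eS.symm, fun t ht ho => ?_⟩
    obtain ⟨p, hp, hs⟩ := h3 t ht (h t ht ho)
    exact ⟨p, hp, hs.congr eP.symm eF.symm⟩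

/-- An agent that demands just what is true at `x` can be added without harm. -/
theorem exists_good {x : ℕ} (hx : Λ.Cons x) (hL : ∀ t < Λ.L, 3 ≤ Λ.kind t → t + 1 < Λ.L) (q : ℕ) :
    ∃ z, Λ.Good x z q := by
  obtain ⟨z, hz, k1, k2, k3, -⟩ := Λ.exists_code (S x) (S x) (fun t => q.testBit t) (fun _ => True)
  refine ⟨z, hz, fun t ht => (k1 t ht).symm, k3, fun t ht h3 _ => ⟨fun h => ?_, fun h => ?_⟩⟩
  · rw [k2 t ht]; exact (k1 t ht).1 h
  · have hb := (hx t ht).2.2.2 h3 ((k2 t ht).1 h)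
    exact ⟨(k1 _ (hL t ht h3)).2 hb.1, fun h5 => (k1 t ht).2 (hb.2 h5)⟩

theorem Covers.of_subperm {T X : Set ℕ} {t₀ : ℕ} {l l' : List ℕ} {x : ℕ} (hx : Λ.Cons x)
    (hL : ∀ t < Λ.L, 3 ≤ Λ.kind t → t + 1 < Λ.L) (h : l.Subperm l') (hc : Λ.Covers T X t₀ l x) :
    Λ.Covers T X t₀ l' x := by
  obtain ⟨Z, h1, h2, h3⟩ := hc
  obtain ⟨l₁, hp, hs⟩ := h
  obtain ⟨m, hm⟩ := hs.exists_perm_append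
  replace hm := hm.trans (hp.append_right m)
  choose g hg using exists_good hx hL
  refine ⟨Z ++ m.map fun q => (g q, q), ?_, ?_, fun t ht ho => ?_⟩
  · rw [List.map_append, List.map_map]
    have : (Prod.snd ∘ fun q => (g q, q)) = id := rfl
    rw [this, List.map_id]
    exact (h1.append_right m).trans hm.symm
  · simp only [List.mem_append, List.mem_map]
    rintro p (hp | ⟨q, -, rfl⟩)
    · exact h2 p hp
    · exact hg q
  · obtain ⟨p, hp, hs⟩ := h3 t ht ho
    exact ⟨p, by simp [hp], hs⟩

/-- To meet the `L + 1` obligations, `L + 1` agents suffice. -/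
theorem Covers.exists_subperm {T X : Set ℕ} {t₀ : ℕ} {l : List ℕ} {x : ℕ}
    (hc : Λ.Covers T X t₀ l x) :
    ∃ l', l'.Subperm l ∧ l'.length ≤ Λ.L + 1 ∧ Λ.Covers T X t₀ l' x := by
  classical
  obtain ⟨Z, h1, h2, h3⟩ := hc
  choose! g hg hs using h3
  set A : Finset (ℕ × ℕ) :=
    ((Finset.range (Λ.L + 1)).filter fun t => Λ.Obliged x t).image g with hA
  have hmem : ∀ p ∈ A, p ∈ Z := fun p hp => by
    obtain ⟨t, ht, rfl⟩ := Finset.mem_image.1 hp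
    rw [Finset.mem_filter, Finset.mem_range] at ht
    exact hg t ht.1 ht.2
  have hsub : A.toList.Subperm Z :=
    List.subperm_of_subset (Finset.nodup_toList A) fun p hp => hmem p (Finset.mem_toList.1 hp)
  refine ⟨A.toList.map Prod.snd, ?_, ?_, A.toList, .refl _,
    fun p hp => h2 p (hmem p (Finset.mem_toList.1 hp)), fun t ht ho => ⟨g t, ?_, hs t ht ho⟩⟩
  · obtain ⟨m, hm, hs⟩ := hsub
    exact List.Subperm.trans ⟨_, hm.map Prod.snd, hs.map Prod.snd⟩ h1.subperm
  · rw [List.length_map, Finset.length_toList]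
    exact Finset.card_image_le.trans ((Finset.card_filter_le _ _).trans (by simp))
  · rw [Finset.mem_toList, hA]
    exact Finset.mem_image_of_mem _ (by simp [ho, Nat.lt_succ_iff.1 ht])

/-- Only the first `L + 1` agents of each profile matter. -/
theorem covers_keep {T X : Set ℕ} {t₀ : ℕ} {l : List ℕ} {x : ℕ} (hx : Λ.Cons x)
    (hL : ∀ t < Λ.L, 3 ≤ Λ.kind t → t + 1 < Λ.L) :
    Λ.Covers T X t₀ (keep (Λ.L + 1) l) x ↔ Λ.Covers T X t₀ l x := by
  constructor
  · refine Covers.of_subperm hx hL (List.subperm_ext_iff.2 fun q _ => ?_)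
    rw [count_keep]
    exact min_le_left _ _
  · intro h
    obtain ⟨l', h1, h2, h3⟩ := h.exists_subperm
    refine h3.of_subperm hx hL (List.subperm_ext_iff.2 fun q _ => ?_)
    rw [count_keep]
    exact le_min (h1.count_le q) (List.count_le_length.trans h2)

/-! ### The elimination procedure -/

variable (Λ) in
/-- One step of the computation of the codes in `T` for which the obligation `t₀` can be met in
finitely many steps, along with all other obligations. -/
def reach (l : List ℕ) (T : Set ℕ) (t₀ : ℕ) (X : Set ℕ) : Set ℕ :=
  {x | x < Λ.N ∧ x ∈ T ∧ Λ.Obliged x t₀ ∧ ∃ y < Λ.N, y ∈ Λ.cover T X t₀ l ∧ Λ.EqS x y ∧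
    Λ.EqF x y ∧ Λ.EqP x y ∧ ∀ t < Λ.L + 1, Λ.Obliged x t → Λ.D y t}

variable (Λ) in
/-- Elimination of the codes for which the obligation `t₀` cannot be met. -/
def sieve (l : List ℕ) (T : Set ℕ) (t₀ : ℕ) : Set ℕ :=
  {x | x ∈ T ∧ (Λ.Obliged x t₀ → x ∈ (Λ.reach l T t₀)^[Λ.N] ∅)}

variable (Λ) in
/-- Elimination for all obligations in turn. -/
def round (l : List ℕ) (T : Set ℕ) : Set ℕ := (List.range (Λ.L + 1)).foldl (Λ.sieve l) T

variable (Λ) in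
/-- The codes that survive the elimination. -/
def survivors (l : List ℕ) : Set ℕ := (Λ.round l)^[Λ.N] {x | x < Λ.N ∧ Λ.Cons x}

theorem mem_reach {l : List ℕ} {T X : Set ℕ} {t₀ x : ℕ} : x ∈ Λ.reach l T t₀ X ↔
    x < Λ.N ∧ x ∈ T ∧ Λ.Obliged x t₀ ∧ Λ.Covers T X t₀ l x := by
  rw [covers_iff]; rfl

theorem Covers.mono {T X Y : Set ℕ} {t₀ : ℕ} {l : List ℕ} {x : ℕ} (h : X ⊆ Y)
    (hc : Λ.Covers T X t₀ l x) : Λ.Covers T Y t₀ l x := by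
  obtain ⟨Z, h1, h2, h3⟩ := hc
  refine ⟨Z, h1, h2, fun t ht ho => ?_⟩
  obtain ⟨p, hp, hs⟩ := h3 t ht ho
  exact ⟨p, hp, hs.mono h⟩

theorem reach_fixed (l : List ℕ) (T : Set ℕ) (t₀ : ℕ) :
    Λ.reach l T t₀ ((Λ.reach l T t₀)^[Λ.N] ∅) = (Λ.reach l T t₀)^[Λ.N] ∅ :=
  iterate_fixed_of_mono _ (fun X Y h x hx => by
    rw [mem_reach] at hx ⊢
    exact ⟨hx.1, hx.2.1, hx.2.2.1, hx.2.2.2.mono h⟩) fun X x hx => hx.1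

theorem foldl_sieve_subset (l m : List ℕ) (T : Set ℕ) : m.foldl (Λ.sieve l) T ⊆ T := by
  induction m generalizing T with
  | nil => exact subset_rfl
  | cons t m ih => exact (ih _).trans fun x hx => hx.1

theorem sieve_eq_of_foldl_eq {l m : List ℕ} {T : Set ℕ} (h : m.foldl (Λ.sieve l) T = T) :
    ∀ t ∈ m, Λ.sieve l T t = T := by
  induction m with
  | nil => simp
  | cons t m ih =>
    have h1 : Λ.sieve l T t = T := by
      refine Set.Subset.antisymm (fun x hx => hx.1) ?_
      conv_lhs => rw [← h]
      exact foldl_sieve_subset l m _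
    rw [List.foldl_cons, h1] at h
    intro u hu
    rcases List.mem_cons.1 hu with rfl | hu
    · exact h1
    · exact ih h u hu

theorem survivors_subset (l : List ℕ) : Λ.survivors l ⊆ {x | x < Λ.N ∧ Λ.Cons x} := by
  unfold survivors
  suffices ∀ k, (Λ.round l)^[k] {x | x < Λ.N ∧ Λ.Cons x} ⊆ {x | x < Λ.N ∧ Λ.Cons x} from this _
  intro k
  induction k with
  | zero => exact subset_rfl
  | succ k ih => rw [Function.iterate_succ_apply']; exact (foldl_sieve_subset l _ _).trans ih

/-- Nothing more is eliminated from the survivors. -/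
theorem survivors_reach {l : List ℕ} {x t : ℕ} (hx : x ∈ Λ.survivors l) (ht : t < Λ.L + 1)
    (ho : Λ.Obliged x t) : x ∈ (Λ.reach l (Λ.survivors l) t)^[Λ.N] ∅ := by
  have h1 : Λ.round l (Λ.survivors l) = Λ.survivors l :=
    iterate_fixed_of_subset _ (fun X => foldl_sieve_subset l _ X) fun x hx => hx.1
  rw [← sieve_eq_of_foldl_eq h1 t (by simpa using ht)] at hx
  exact hx.2 ho

/-- A set of consistent codes from which the elimination can remove nothing survives. -/
theorem subset_survivors {l : List ℕ} {R : Set ℕ} (hR : R ⊆ {x | x < Λ.N ∧ Λ.Cons x})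
    (h : ∀ T : Set ℕ, R ⊆ T → T ⊆ {x | x < Λ.N ∧ Λ.Cons x} →
      ∀ x ∈ R, ∀ t < Λ.L + 1, Λ.Obliged x t → x ∈ (Λ.reach l T t)^[Λ.N] ∅) :
    R ⊆ Λ.survivors l := by
  have key : ∀ m : List ℕ, (∀ t ∈ m, t < Λ.L + 1) → ∀ T : Set ℕ, R ⊆ T →
      T ⊆ {x | x < Λ.N ∧ Λ.Cons x} → R ⊆ m.foldl (Λ.sieve l) T := by
    intro m
    induction m with
    | nil => exact fun _ T hT _ => hT
    | cons t m ih =>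
      intro hm T hT hT'
      refine ih (fun u hu => hm u (by simp [hu])) _ (fun x hx => ⟨hT hx, ?_⟩)
        (fun x hx => hT' hx.1)
      exact h T hT hT' x hx t (hm t (by simp))
  unfold survivors
  suffices ∀ k, R ⊆ (Λ.round l)^[k] {x | x < Λ.N ∧ Λ.Cons x} ∧
      (Λ.round l)^[k] {x | x < Λ.N ∧ Λ.Cons x} ⊆ {x | x < Λ.N ∧ Λ.Cons x} from (this _).1
  intro k
  induction k with
  | zero => exact ⟨hR, subset_rfl⟩
  | succ k ih =>
    rw [Function.iterate_succ_apply']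
    exact ⟨key _ (by simp) _ ih.1 ih.2, (foldl_sieve_subset l _ _).trans ih.2⟩

end Shape

/-! ### Formulas and their positions -/

/-- The number of tokens of a formula. -/
def Fml.width {𝒜 : Type} {𝒢 : Set (Set 𝒜)} : Fml 𝒜 𝒢 → ℕ
  | .prop _ => 1
  | .neg φ => φ.width + 1
  | .conj φ ψ => φ.width + ψ.width + 1
  | .know _ φ => φ.width + 1
  | .every _ φ => φ.width + 1
  | .common _ φ => φ.width + 1

theorem Fml.width_pos {𝒜 : Type} {𝒢 : Set (Set 𝒜)} (φ : Fml 𝒜 𝒢) : 0 < φ.width := by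
  cases φ <;> simp [width]

theorem Fml.width_le_length {𝒜 : Type} {𝒢 : Set (Set 𝒜)} (φ : Fml 𝒜 𝒢) : φ.width ≤ φ.length := by
  induction φ <;> simp only [width, length] <;> omega

namespace Shape

variable {Λ : Shape} {n : ℕ} {𝒢 : Set (Set (Fin n))} {prof : Fin n → ℕ}

variable (Λ prof) in
/-- The formula `ψ` occurs at position `t`, where `prof` gives the profiles of the agents. -/
def At : Fml (Fin n) 𝒢 → ℕ → Prop
  | .prop p, t => t < Λ.L ∧ Λ.kind t = 0 ∧ Λ.idx t = p
  | .neg φ, t => t < Λ.L ∧ Λ.kind t = 1 ∧ At φ (t + 1)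
  | .conj φ ψ, t => t < Λ.L ∧ Λ.kind t = 2 ∧ At φ (t + 1) ∧ At ψ (t + 1 + φ.width)
  | .know i φ, t => t < Λ.L ∧ Λ.kind t = 3 ∧ (∀ j, (prof j).testBit t ↔ j = i) ∧ At φ (t + 1)
  | .every G φ, t => t < Λ.L ∧ Λ.kind t = 4 ∧ (∀ j, (prof j).testBit t ↔ j ∈ G.1) ∧ At φ (t + 1)
  | .common G φ, t => t < Λ.L ∧ Λ.kind t = 5 ∧ (∀ j, (prof j).testBit t ↔ j ∈ G.1) ∧ At φ (t + 1)

theorem At.lt {ψ : Fml (Fin n) 𝒢} {t : ℕ} (h : Λ.At prof ψ t) : t < Λ.L := by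
  cases ψ <;> exact h.1

theorem At.unique {ψ χ : Fml (Fin n) 𝒢} {t : ℕ} (h : Λ.At prof ψ t) (k : Λ.At prof χ t) :
    ψ = χ := by
  induction ψ generalizing t χ with
  | prop p =>
    cases χ <;> first | (have := h.2.1.symm.trans k.2.1; omega) | skip
    rw [← h.2.2, ← k.2.2]
  | neg φ ih =>
    cases χ <;> first | (have := h.2.1.symm.trans k.2.1; omega) | skip
    rw [ih h.2.2 k.2.2]
  | conj φ ψ ih ih' =>
    cases χ <;> first | (have := h.2.1.symm.trans k.2.1; omega) | skip
    have := ih h.2.2.1 k.2.2.1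
    subst this
    rw [ih' h.2.2.2 k.2.2.2]
  | know i φ ih =>
    cases χ <;> first | (have := h.2.1.symm.trans k.2.1; omega) | skip
    rw [ih h.2.2.2 k.2.2.2, (k.2.2.1 i).1 ((h.2.2.1 i).2 rfl)]
  | every G φ ih =>
    cases χ <;> first | (have := h.2.1.symm.trans k.2.1; omega) | skip
    rw [ih h.2.2.2 k.2.2.2,
      Subtype.ext (Set.ext fun j => (h.2.2.1 j).symm.trans (k.2.2.1 j))]
  | common G φ ih =>
    cases χ <;> first | (have := h.2.1.symm.trans k.2.1; omega) | skip
    rw [ih h.2.2.2 k.2.2.2,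
      Subtype.ext (Set.ext fun j => (h.2.2.1 j).symm.trans (k.2.2.1 j))]

variable (Λ prof 𝒢) in
/-- `Λ` is the shape of a formula over `𝒢`, and `prof` gives the profiles of the agents. -/
structure Describes (A₁ : Set (Fin n)) : Prop where
  exists_at : ∀ t < Λ.L, ∃ ψ : Fml (Fin n) 𝒢, Λ.At prof ψ t
  stop_eq : ∀ (ψ : Fml (Fin n) 𝒢) t, Λ.At prof ψ t → Λ.finish t = t + ψ.width
  trans_iff : ∀ i, (prof i).testBit Λ.L ↔ i ∈ A₁
  nonempty : ∀ G ∈ 𝒢, G.Nonempty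

variable {A₁ A₂ : Set (Fin n)}

theorem Describes.modal_lt (h : Λ.Describes 𝒢 prof A₁) : ∀ t < Λ.L, 3 ≤ Λ.kind t → t + 1 < Λ.L := by
  intro t ht h3
  obtain ⟨ψ, hψ⟩ := h.exists_at t ht
  cases ψ with
  | prop p => have := hψ.2.1; omega
  | neg φ => have := hψ.2.1; omega
  | conj φ ψ => have := hψ.2.1; omega
  | know i φ | every G φ | common G φ => exact hψ.2.2.2.lt

theorem Body.congr {x y t : ℕ} (hS : Λ.EqS x y) (ht : t + 1 < Λ.L) (h : Λ.Body x t) : Λ.Body y t :=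
  ⟨(hS _ ht).1 h.1, fun h5 => (hS t (by omega)).1 (h.2 h5)⟩

/-! ### Survivors are satisfiable -/

section Model

variable (Λ prof) in
/-- The worlds of the model built from a set `T` of codes: a type together with a class for each
agent, such that the obligations of the type are met. -/
def World (T : Set ℕ) : Type :=
  {w : ℕ × (Fin n → ℕ) // Λ.Cons w.1 ∧ (∀ i, Λ.Good w.1 (w.2 i) (prof i)) ∧
    ∀ t < Λ.L, Λ.Obliged w.1 t → ∃ i, Λ.Serve T ∅ Λ.L w.1 (w.2 i) t}

variable (Λ prof) in
/-- The model built from a set `T` of codes. Two worlds are related for an agent if they can be in a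
common class of that agent, which has to be the class assigned to both of them if the relation of
the agent is transitive. -/
def model (T : Set ℕ) : Kripke (Fin n) where
  State := Λ.World prof T
  val w p := ∃ t < Λ.L, Λ.kind t = 0 ∧ Λ.idx t = p ∧ S w.1.1 t
  rel i w w' := ∃ z z', Λ.Good w.1.1 z (prof i) ∧ Λ.Good w'.1.1 z' (prof i) ∧ Λ.EqF z z' ∧
    ((prof i).testBit Λ.L → Λ.EqF z (w.1.2 i) ∧ Λ.EqF z' (w'.1.2 i))

theorem model_isMixedRST (hd : Λ.Describes 𝒢 prof A₁) (T : Set ℕ) :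
    (Λ.model prof T).IsMixedRST A₁ A₂ := by
  have refl : ∀ i w, (Λ.model prof T).rel i w w := fun i w =>
    ⟨_, _, w.2.2.1 i, w.2.2.1 i, fun _ _ => .rfl, fun _ => ⟨fun _ _ => .rfl, fun _ _ => .rfl⟩⟩
  have symm : ∀ i w w', (Λ.model prof T).rel i w w' → (Λ.model prof T).rel i w' w :=
    fun i w w' ⟨z, z', h1, h2, h3, h4⟩ => ⟨z', z, h2, h1, h3.symm, fun h => (h4 h).symm⟩
  refine ⟨fun i _ => refl i, fun i _ => symm i, ?_, fun i _ => refl i, fun i _ => symm i⟩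
  rintro i hi s t u ⟨z, z', h1, h2, h3, h4⟩ ⟨y, y', k1, k2, k3, k4⟩
  have hi := (hd.trans_iff i).2 hi
  exact ⟨z, y', h1, k2,
    h3.trans ((h4 hi).2.trans ((k4 hi).1.symm.trans k3)), fun _ => ⟨(h4 hi).1, (k4 hi).2⟩⟩

variable {T : Set ℕ}

theorem body_of_rel (hd : Λ.Describes 𝒢 prof A₁) {i : Fin n} {w w' : Λ.World prof T} {t : ℕ}
    (ht : t < Λ.L) (h3 : 3 ≤ Λ.kind t) (hi : (prof i).testBit t) (h : (Λ.model prof T).rel i w w')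
    (hS : S w.1.1 t) : Λ.Body w'.1.1 t := by
  obtain ⟨z, z', hz, hz', hF, -⟩ := h
  have h1 := (hz.2.2.2 t ht h3 ((hz.2.2.1 t (by omega)).2 hi)).1 ((hz.2.1 t ht).1 hS)
  have h2 := (hz'.2.2.2 t ht h3 ((hz'.2.2.1 t (by omega)).2 hi)).2 ((hF t ht).1 h1)
  exact h2.congr hz'.2.1.symm (hd.modal_lt t ht h3)

/-- Codes whose obligations can be met occur in the model, with every agent of the right profile in
the class described. Here agents of equal profile are exchanged. -/
theorem exists_world {X : Set ℕ} {t₀ x : ℕ} (hx : Λ.Cons x)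
    (hc : Λ.Covers T X t₀ (List.ofFn prof) x) {i : Fin n}
    (hi : ∀ t < Λ.L + 1, Λ.P x t ↔ (prof i).testBit t) :
    ∃ w : Λ.World prof T, w.1.1 = x ∧
      (∃ z, Λ.Good x z (prof i) ∧ Λ.EqF x z ∧ ((prof i).testBit Λ.L → Λ.EqF z (w.1.2 i))) ∧
      (t₀ < Λ.L → Λ.Obliged x t₀ → ∃ j, Λ.Serve T X t₀ x (w.1.2 j) t₀) := by
  obtain ⟨Z₀, h1, h2, h3⟩ := hc
  obtain ⟨Z, hZ, h1⟩ := exists_perm_map_eq _ h1 Z₀ rfl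
  have hlen : Z.length = n := by simpa using congrArg List.length h1
  set f : Fin n → ℕ := fun j => (Z[j.1]'(by omega)).1 with hf
  have hfg : ∀ j, Λ.Good x (f j) (prof j) := fun j => by
    have hj : j.1 < Z.length := by omega
    have := h2 Z[j.1] (hZ.mem_iff.1 (List.getElem_mem hj))
    have e : Z[j.1].2 = prof j := by
      have := List.getElem_map (f := Prod.snd) (l := Z) (i := j.1) (h := by simpa using hj)
      rw [← this]
      simp [h1]
    rwa [e] at this
  have hfs : ∀ t < Λ.L + 1, Λ.Obliged x t → ∃ j, Λ.Serve T X t₀ x (f j) t := fun t ht ho => by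
    obtain ⟨p, hp, hs⟩ := h3 t ht ho
    obtain ⟨j, hj, rfl⟩ := List.getElem_of_mem (hZ.mem_iff.2 hp)
    exact ⟨⟨j, by omega⟩, hs⟩
  obtain ⟨j, z, hz, hl, hzc, hh⟩ := hfs Λ.L (by omega) (.inl rfl)
  obtain ⟨-, hP, hF⟩ : _ ∧ Λ.EqP x z ∧ Λ.EqF x z := hh.resolve_right fun h => h.1.ne rfl
  have hij : ∀ t < Λ.L + 1, (prof j).testBit t ↔ (prof i).testBit t := fun t ht =>
    ((hfg j).2.2.1 t ht).symm.trans ((hl.2.1 t ht).trans ((hP t ht).symm.trans (hi t ht)))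
  set g : Fin n → ℕ := fun k => f (Equiv.swap i j k) with hg
  have hgg : ∀ k, Λ.Good x (g k) (prof k) := fun k => by
    have := hfg (Equiv.swap i j k)
    refine ⟨this.1, this.2.1, fun t ht => (this.2.2.1 t ht).trans ?_, this.2.2.2⟩
    by_cases hki : k = i
    · subst hki; rw [Equiv.swap_apply_left]; exact hij t ht
    · by_cases hkj : k = j
      · subst hkj; rw [Equiv.swap_apply_right]; exact (hij t ht).symm
      · rw [Equiv.swap_apply_of_ne_of_ne hki hkj]
  have hgs : ∀ t < Λ.L + 1, Λ.Obliged x t → ∃ k, Λ.Serve T X t₀ x (g k) t := fun t ht ho => by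
    obtain ⟨k, hk⟩ := hfs t ht ho
    exact ⟨Equiv.swap i j k, by simpa [hg] using hk⟩
  refine ⟨⟨(x, g), hx, hgg, fun t ht ho => ?_⟩, rfl, ⟨z, ?_, hF, fun hb => ?_⟩, fun h ho =>
    hgs t₀ (by omega) ho⟩
  · obtain ⟨k, z', k1, k2, k3, k4⟩ := hgs t (by omega) ho
    refine ⟨k, z', k1, k2, k3, k4.imp_right ?_⟩
    rintro ⟨l1, l2, x', l3, l4, l5, l6, l7, -⟩
    exact ⟨l1, l2, x', l3, l4, l5, l6, l7, fun h => by omega⟩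
  · have := (hgg i).link hz (z' := z)
    have hgi : g i = f j := by simp [hg]
    rw [hgi] at this
    exact this hl hzc
  · have hgi : g i = f j := by simp [hg]
    show Λ.EqF z (g i)
    rw [hgi]
    refine (hl.2.2 ?_).symm
    rw [(hfg j).2.2.1 Λ.L (by omega), hij Λ.L (by omega)]
    exact hb

/-- What it takes for `model Λ prof T` to be as intended. -/
structure Closed (Λ : Shape) (prof : Fin n → ℕ) (T : Set ℕ) : Prop where
  cons : ∀ x ∈ T, Λ.Cons x
  reach : ∀ x ∈ T, ∀ t < Λ.L + 1, Λ.Obliged x t →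
    ∃ k, x ∈ (Λ.reach (List.ofFn prof) T t)^[k] ∅

theorem exists_covers_of_mem_iterate {l : List ℕ} {t₀ k x : ℕ} (h : x ∈ (Λ.reach l T t₀)^[k] ∅) :
    ∃ m, k = m + 1 ∧ x ∈ T ∧ Λ.Obliged x t₀ ∧ Λ.Covers T ((Λ.reach l T t₀)^[m] ∅) t₀ l x := by
  cases k with
  | zero => exact h.elim
  | succ k =>
    rw [Function.iterate_succ_apply', mem_reach] at h
    exact ⟨k, rfl, h.2⟩

/-- An agent that meets an obligation at a world relates the world to one where the body of the
modal subformula is false. -/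
theorem exists_rel_of_serve (hT : Closed Λ prof T) {w : Λ.World prof T} {X : Set ℕ}
    {t₀ t : ℕ} (ht : t < Λ.L) {i : Fin n} (hs : Λ.Serve T X t₀ w.1.1 (w.1.2 i) t) :
    (prof i).testBit t ∧ ∃ x' ∈ T, ¬ Λ.Body x' t ∧
      (t = t₀ → Λ.kind t = 5 → ¬ S x' (t + 1) ∨ x' ∈ X) ∧
      ∀ t₁ k, x' ∈ (Λ.reach (List.ofFn prof) T t₁)^[k + 1] ∅ →
        ∃ w' : Λ.World prof T, w'.1.1 = x' ∧ (Λ.model prof T).rel i w w' ∧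
          (t₁ < Λ.L → ∃ j, Λ.Serve T ((Λ.reach (List.ofFn prof) T t₁)^[k] ∅) t₁ x' (w'.1.2 j)
            t₁) := by
  obtain ⟨z, hz, hl, hzc, hh⟩ := hs
  rcases hh with ⟨rfl, -⟩ | ⟨-, hP, x', hx', hxT, eP, eF, hb, hprog⟩
  · omega
  have hzg := (w.2.2.1 i).link hz hl hzc
  have hzP := hzg.2.2.1
  refine ⟨(hzP t (by omega)).1 hP, x', hxT, hb, hprog, fun t₁ k hk => ?_⟩
  obtain ⟨m, hm, -, ho, hc⟩ := exists_covers_of_mem_iterate hk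
  obtain rfl : k = m := by omega
  obtain ⟨w', rfl, ⟨z', k1, k2, k3⟩, k4⟩ := exists_world (hT.cons x' hxT) hc (i := i)
    fun t ht => (eP t ht).symm.trans (hzP t ht)
  refine ⟨w', rfl, ⟨z, z', hzg, k1, eF.trans k2, fun hb => ⟨(hl.2.2 ?_).symm, k3 hb⟩⟩,
    fun h => k4 h ho⟩
  exact ((w.2.2.1 i).2.2.1 Λ.L (by omega)).2 hb

theorem exists_rel (hT : Closed Λ prof T) {w : Λ.World prof T} {t : ℕ} (ht : t < Λ.L)
    (h3 : 3 ≤ Λ.kind t) (hS : ¬ S w.1.1 t) :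
    ∃ i, (prof i).testBit t ∧ ∃ w', (Λ.model prof T).rel i w w' ∧ ¬ Λ.Body w'.1.1 t := by
  obtain ⟨i, hi⟩ := w.2.2.2 t ht (.inr ⟨ht, h3, hS⟩)
  obtain ⟨h1, x', hx', hb, -, h⟩ := exists_rel_of_serve hT ht hi
  obtain ⟨k, hk⟩ := hT.reach x' hx' Λ.L (by omega) (.inl rfl)
  obtain ⟨m, rfl, -⟩ := exists_covers_of_mem_iterate hk
  obtain ⟨w', rfl, hr, -⟩ := h _ _ hk
  exact ⟨i, h1, w', hr, hb⟩

/-- False formulas `C_G ψ` are refuted in the model after finitely many steps. -/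
theorem exists_notMem_everyone (hT : Closed Λ prof T) {t : ℕ} (ht : t < Λ.L)
    (h5 : Λ.kind t = 5) {G : Set (Fin n)} (hG : ∀ j, (prof j).testBit t ↔ j ∈ G)
    {w : Λ.World prof T} (hS : ¬ S w.1.1 t) :
    ∃ k, 1 ≤ k ∧ w ∉ ((Λ.model prof T).everyone G)^[k]
      {w : Λ.World prof T | S w.1.1 (t + 1)} := by
  have step : ∀ {i : Fin n} {w w' : Λ.World prof T} {k : ℕ}, (prof i).testBit t →
      (Λ.model prof T).rel i w w' →
      w' ∉ ((Λ.model prof T).everyone G)^[k] {w : Λ.World prof T | S w.1.1 (t + 1)} →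
      w ∉ ((Λ.model prof T).everyone G)^[k + 1] {w : Λ.World prof T | S w.1.1 (t + 1)} := by
    intro i w w' k hi hr hw hw'
    rw [Function.iterate_succ_apply'] at hw'
    exact hw (hw' i ((hG i).1 hi) w' hr)
  have key : ∀ k, ∀ w : Λ.World prof T,
      (∃ j, Λ.Serve T ((Λ.reach (List.ofFn prof) T t)^[k] ∅) t w.1.1 (w.1.2 j) t) →
      ∃ k, 1 ≤ k ∧ w ∉ ((Λ.model prof T).everyone G)^[k]
        {w : Λ.World prof T | S w.1.1 (t + 1)} := by
    intro k
    induction k with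
    | zero =>
      rintro w ⟨j, hj⟩
      obtain ⟨h1, x', hx', -, hp, h⟩ := exists_rel_of_serve hT ht hj
      obtain ⟨m, hm⟩ := hT.reach x' hx' Λ.L (by omega) (.inl rfl)
      obtain ⟨m, rfl, -⟩ := exists_covers_of_mem_iterate hm
      obtain ⟨w', rfl, hr, -⟩ := h _ _ hm
      exact ⟨1, le_rfl, step h1 hr ((hp rfl h5).resolve_right id)⟩
    | succ k ih =>
      rintro w ⟨j, hj⟩
      obtain ⟨h1, x', hx', -, hp, h⟩ := exists_rel_of_serve hT ht hj
      rcases hp rfl h5 with hp | hp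
      · obtain ⟨m, hm⟩ := hT.reach x' hx' Λ.L (by omega) (.inl rfl)
        obtain ⟨m, rfl, -⟩ := exists_covers_of_mem_iterate hm
        obtain ⟨w', rfl, hr, -⟩ := h _ _ hm
        exact ⟨1, le_rfl, step h1 hr hp⟩
      · obtain ⟨w', rfl, hr, hs⟩ := h _ _ hp
        obtain ⟨m, hm, hw⟩ := ih w' (hs ht)
        exact ⟨m + 1, by omega, step h1 hr hw⟩
  obtain ⟨i, hi⟩ := w.2.2.2 t ht (.inr ⟨ht, by omega, hS⟩)
  obtain ⟨h1, x', hx', hb, -, h⟩ := exists_rel_of_serve hT ht hi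
  by_cases h6 : S x' (t + 1)
  · have hS' : ¬ S x' t := fun hS' => hb ⟨h6, fun _ => hS'⟩
    obtain ⟨m, hm⟩ := hT.reach x' hx' t (by omega) (.inr ⟨ht, by omega, hS'⟩)
    obtain ⟨m, rfl, -⟩ := exists_covers_of_mem_iterate hm
    obtain ⟨w', rfl, hr, hs⟩ := h _ _ hm
    obtain ⟨k, hk, hw⟩ := key m w' (hs ht)
    exact ⟨k + 1, by omega, step h1 hr hw⟩
  · obtain ⟨m, hm⟩ := hT.reach x' hx' Λ.L (by omega) (.inl rfl)
    obtain ⟨m, rfl, -⟩ := exists_covers_of_mem_iterate hm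
    obtain ⟨w', rfl, hr, -⟩ := h _ _ hm
    exact ⟨1, le_rfl, step h1 hr h6⟩

/-- In the model, the type of a world tells which subformulas are true there. -/
theorem truth_model (hd : Λ.Describes 𝒢 prof A₁) (hT : Closed Λ prof T) (ψ : Fml (Fin n) 𝒢) {t : ℕ}
    (h : Λ.At prof ψ t) (w : Λ.World prof T) : w ∈ (Λ.model prof T).truth ψ ↔ S w.1.1 t := by
  have hw := w.2.1
  induction ψ generalizing t w with
  | prop p =>
    obtain ⟨h1, h2, h3⟩ := h
    refine ⟨fun ⟨u, k1, k2, k3, k4⟩ => ?_, fun hS => ⟨t, h1, h2, h3, hS⟩⟩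
    exact ((hw t h1).1 h2 u k1 k2 (k3.trans h3.symm)).2 k4
  | neg φ ih =>
    obtain ⟨h1, h2, h3⟩ := h
    exact (not_congr (ih h3 w hw)).trans ((hw t h1).2.1 h2).symm
  | conj φ ψ ih ih' =>
    obtain ⟨h1, h2, h3, h4⟩ := h
    have h5 := (hw t h1).2.2.1 h2
    rw [hd.stop_eq φ _ h3] at h5
    exact (and_congr (ih h3 w hw) (ih' h4 w hw)).trans h5.symm
  | know i φ ih =>
    obtain ⟨h1, h2, h3, h4⟩ := h
    constructor
    · intro hk
      by_contra hS
      obtain ⟨j, hj, w', hr, hb⟩ := exists_rel hT h1 (by omega) hS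
      obtain rfl := (h3 j).1 hj
      exact hb ⟨(ih h4 w' w'.2.1).1 (hk w' hr), fun h => by omega⟩
    · intro hS w' hr
      exact (ih h4 w' w'.2.1).2 (body_of_rel hd h1 (by omega) ((h3 i).2 rfl) hr hS).1
  | every G φ ih =>
    obtain ⟨h1, h2, h3, h4⟩ := h
    constructor
    · intro hk
      by_contra hS
      obtain ⟨j, hj, w', hr, hb⟩ := exists_rel hT h1 (by omega) hS
      exact hb ⟨(ih h4 w' w'.2.1).1 (hk j ((h3 j).1 hj) w' hr), fun h => by omega⟩
    · intro hS i hi w' hr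
      exact (ih h4 w' w'.2.1).2 (body_of_rel hd h1 (by omega) ((h3 i).2 hi) hr hS).1
  | common G φ ih =>
    obtain ⟨h1, h2, h3, h4⟩ := h
    have e : (Λ.model prof T).truth φ = {w : Λ.World prof T | S w.1.1 (t + 1)} :=
      Set.ext fun w => ih h4 w w.2.1
    constructor
    · intro hk
      by_contra hS
      obtain ⟨k, hk1, hw'⟩ := exists_notMem_everyone hT h1 h2 h3 hS
      have hk' := hk k hk1
      rw [e] at hk'
      exact hw' hk'
    · intro hS k hk1
      obtain ⟨k, rfl⟩ := Nat.exists_eq_add_of_le' hk1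
      clear hk1
      induction k generalizing w with
      | zero =>
        intro i hi w' hr
        exact (ih h4 w' w'.2.1).2 (body_of_rel hd h1 (by omega) ((h3 i).2 hi) hr hS).1
      | succ k ihk =>
        rw [Function.iterate_succ_apply']
        intro i hi w' hr
        have hb := body_of_rel hd h1 (by omega) ((h3 i).2 hi) hr hS
        exact ihk w' w'.2.1 (hb.2 h2)

end Model

theorem closed_survivors (hd : Λ.Describes 𝒢 prof A₁) :
    Closed Λ prof (Λ.survivors (keep (Λ.L + 1) (List.ofFn prof))) := by
  refine ⟨fun x hx => (survivors_subset _ hx).2, fun x hx t ht ho => ⟨Λ.N, ?_⟩⟩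
  have h := survivors_reach hx ht ho
  suffices ∀ X, Λ.reach (keep (Λ.L + 1) (List.ofFn prof))
      (Λ.survivors (keep (Λ.L + 1) (List.ofFn prof))) t X =
      Λ.reach (List.ofFn prof) (Λ.survivors (keep (Λ.L + 1) (List.ofFn prof))) t X by
    rwa [funext this] at h
  intro X
  ext y
  rw [mem_reach, mem_reach]
  refine and_congr_right fun _ => and_congr_right fun hy => and_congr_right fun _ => ?_
  exact covers_keep (survivors_subset _ hy).2 hd.modal_lt

theorem sat_of_mem_survivors (hd : Λ.Describes 𝒢 prof A₁) {φ : Fml (Fin n) 𝒢}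
    (hφ : Λ.At prof φ 0) {x : ℕ} (hx : x ∈ Λ.survivors (keep (Λ.L + 1) (List.ofFn prof)))
    (hS : S x 0) : φ.SatMixedRST A₁ A₂ := by
  have hT := closed_survivors hd
  obtain ⟨k, hk⟩ := hT.reach x hx Λ.L (by omega) (.inl rfl)
  obtain ⟨m, rfl, -, -, hc⟩ := exists_covers_of_mem_iterate hk
  have hc' := hc
  obtain ⟨Z, h1, h2, h3⟩ := hc'
  obtain ⟨p, hp, z, hz, hl, hzc, hh⟩ := h3 Λ.L (by omega) (.inl rfl)
  obtain ⟨-, hP, -⟩ : _ ∧ Λ.EqP x z ∧ Λ.EqF x z := hh.resolve_right fun h => h.1.ne rfl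
  have hpl : p.2 ∈ List.ofFn prof := h1.mem_iff.1 (List.mem_map_of_mem hp)
  obtain ⟨i, hi⟩ := (List.mem_ofFn' _ _).1 hpl
  obtain ⟨w, rfl, -⟩ := exists_world (hT.cons x hx) hc (i := i) fun t ht => by
    rw [hi]
    exact (hP t ht).trans ((hl.2.1 t ht).symm.trans ((h2 p hp).2.2.1 t ht))
  exact ⟨_, model_isMixedRST hd _, w, (truth_model hd hT φ hφ w).2 hS⟩

/-! ### Satisfiable formulas have survivors -/

section Complete

variable {M : Kripke (Fin n)}

variable (Λ 𝒢 prof M) in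
/-- Subformula `t` is true at `w`. -/
def Tr (w : M.State) (t : ℕ) : Prop := ∃ ψ : Fml (Fin n) 𝒢, Λ.At prof ψ t ∧ w ∈ M.truth ψ

variable (Λ 𝒢 prof M) in
/-- The body of the modal subformula `t` is true at `w`. -/
def TrBody (w : M.State) (t : ℕ) : Prop :=
  Λ.Tr 𝒢 prof M w (t + 1) ∧ (Λ.kind t = 5 → Λ.Tr 𝒢 prof M w t)

variable (Λ 𝒢 prof M) in
/-- `x` describes the world `w` and its class for agent `i`; if the relation of `i` is not
transitive, the class is that of the pair of `w` and `v`. -/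
def Rep (A₁ : Set (Fin n)) (i : Fin n) (w v : M.State) (x : ℕ) : Prop :=
  x < Λ.N ∧ (∀ t < Λ.L, S x t ↔ Λ.Tr 𝒢 prof M w t) ∧
  (∀ t < Λ.L, Λ.F x t ↔ 3 ≤ Λ.kind t ∧ (prof i).testBit t ∧
    ((i ∈ A₁ ∧ ∀ u, M.rel i w u → Λ.TrBody 𝒢 prof M u t) ∨
      (i ∉ A₁ ∧ (Λ.Tr 𝒢 prof M w t ∨ Λ.Tr 𝒢 prof M v t)))) ∧
  (∀ t < Λ.L + 1, Λ.P x t ↔ (prof i).testBit t)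

theorem At.tr_iff {ψ : Fml (Fin n) 𝒢} {t : ℕ} (h : Λ.At prof ψ t) (w : M.State) :
    Λ.Tr 𝒢 prof M w t ↔ w ∈ M.truth ψ := by
  constructor
  · rintro ⟨χ, h1, h2⟩
    rwa [h.unique h1]
  · exact fun hw => ⟨ψ, h, hw⟩

/-- Each world and each class of it has a code. -/
theorem exists_rep (i : Fin n) (w v : M.State) : ∃ x, Λ.Rep 𝒢 prof M A₁ i w v x := by
  obtain ⟨x, hx, h1, h2, h3, -⟩ := Λ.exists_code (Λ.Tr 𝒢 prof M w)
    (fun t => 3 ≤ Λ.kind t ∧ (prof i).testBit t ∧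
      ((i ∈ A₁ ∧ ∀ u, M.rel i w u → Λ.TrBody 𝒢 prof M u t) ∨
        (i ∉ A₁ ∧ (Λ.Tr 𝒢 prof M w t ∨ Λ.Tr 𝒢 prof M v t))))
    (fun t => (prof i).testBit t) fun _ => True
  exact ⟨x, hx, h1, h2, h3⟩

variable (hd : Λ.Describes 𝒢 prof A₁) (hA : A₁ ∪ A₂ = Set.univ) (hM : M.IsMixedRST A₁ A₂)

include hA hM in
theorem rel_refl (i : Fin n) (w : M.State) : M.rel i w w := by
  rcases (hA ▸ Set.mem_univ i : i ∈ A₁ ∪ A₂) with h | h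
  · exact hM.refl₁ i h w
  · exact hM.refl₂ i h w

include hA hM in
theorem rel_symm {i : Fin n} {w v : M.State} (h : M.rel i w v) : M.rel i v w := by
  rcases (hA ▸ Set.mem_univ i : i ∈ A₁ ∪ A₂) with h' | h'
  · exact hM.symm₁ i h' w v h
  · exact hM.symm₂ i h' w v h

theorem trBody_of_rel {i : Fin n} {w v : M.State} {t : ℕ} (h3 : 3 ≤ Λ.kind t)
    (hi : (prof i).testBit t) (h : M.rel i w v) (hw : Λ.Tr 𝒢 prof M w t) :
    Λ.TrBody 𝒢 prof M v t := by
  obtain ⟨ψ, hψ, hw⟩ := hw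
  cases ψ with
  | prop | neg | conj => have := hψ.2.1; omega
  | know j φ =>
    obtain rfl := (hψ.2.2.1 i).1 hi
    exact ⟨⟨φ, hψ.2.2.2, hw v h⟩, fun h5 => by have := hψ.2.1; omega⟩
  | every G φ =>
    exact ⟨⟨φ, hψ.2.2.2, hw i ((hψ.2.2.1 i).1 hi) v h⟩, fun h5 => by have := hψ.2.1; omega⟩
  | common G φ =>
    have hi := (hψ.2.2.1 i).1 hi
    refine ⟨⟨φ, hψ.2.2.2, hw 1 le_rfl i hi v h⟩, fun _ => ⟨_, hψ, fun k hk => ?_⟩⟩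
    have := hw (k + 1) (by omega)
    rw [Function.iterate_succ_apply'] at this
    exact this i hi v h

include hd in
/-- A false modal formula is refuted by the body at some neighbour; for `C_G` this is the fixed
point law `C_G φ ↔ E_G (φ ∧ C_G φ)`. -/
theorem exists_rel_of_not_tr {w : M.State} {t : ℕ} (ht : t < Λ.L) (h3 : 3 ≤ Λ.kind t)
    (hw : ¬ Λ.Tr 𝒢 prof M w t) :
    ∃ i, (prof i).testBit t ∧ ∃ v, M.rel i w v ∧ ¬ Λ.TrBody 𝒢 prof M v t := by
  obtain ⟨ψ, hψ⟩ := hd.exists_at t ht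
  rw [hψ.tr_iff] at hw
  cases ψ with
  | prop | neg | conj => have := hψ.2.1; omega
  | know j φ =>
    obtain ⟨v, hv⟩ := not_forall.1 hw
    obtain ⟨hr, hv⟩ := Classical.not_imp.1 hv
    exact ⟨j, (hψ.2.2.1 j).2 rfl, v, hr, fun hb => hv ((hψ.2.2.2.tr_iff v).1 hb.1)⟩
  | every G φ =>
    by_contra! hc
    exact hw fun i hi v hr =>
      (hψ.2.2.2.tr_iff v).1 (hc i ((hψ.2.2.1 i).2 hi) v hr).1
  | common G φ =>
    by_contra! hc
    refine hw fun k hk => ?_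
    obtain ⟨k, rfl⟩ := Nat.exists_eq_add_of_le' hk
    rw [Function.iterate_succ_apply']
    intro i hi v hr
    obtain ⟨h1, h2⟩ := hc i ((hψ.2.2.1 i).2 hi) v hr
    cases k with
    | zero => exact (hψ.2.2.2.tr_iff v).1 h1
    | succ k => exact (hψ.tr_iff v).1 (h2 hψ.2.1) (k + 1) (by omega)

include hd in
theorem exists_agent {t : ℕ} (ht : t < Λ.L) (h3 : 3 ≤ Λ.kind t) : ∃ i, (prof i).testBit t := by
  obtain ⟨ψ, hψ⟩ := hd.exists_at t ht
  cases ψ with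
  | prop | neg | conj => have := hψ.2.1; omega
  | know j φ => exact ⟨j, (hψ.2.2.1 j).2 rfl⟩
  | every G φ | common G φ =>
    obtain ⟨i, hi⟩ := hd.nonempty G.1 G.2
    exact ⟨i, (hψ.2.2.1 i).2 hi⟩

theorem Rep.body_iff {i : Fin n} {w v : M.State} {x t : ℕ} (h : Λ.Rep 𝒢 prof M A₁ i w v x)
    (ht : t + 1 < Λ.L) : Λ.Body x t ↔ Λ.TrBody 𝒢 prof M w t := by
  rw [Body, TrBody, h.2.1 _ ht, h.2.1 t (by omega)]

include hd hA hM in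
theorem Rep.cons {i : Fin n} {w v : M.State} {x : ℕ} (h : Λ.Rep 𝒢 prof M A₁ i w v x) :
    Λ.Cons x := by
  intro t ht
  obtain ⟨ψ, hψ⟩ := hd.exists_at t ht
  refine ⟨fun h0 u hu h0' hi => ?_, fun h1 => ?_, fun h2 => ?_, fun h3 hS => ?_⟩
  · rw [h.2.1 t ht, h.2.1 u hu]
    cases ψ with
    | neg | conj | know | every | common => have := hψ.2.1; omega
    | prop p =>
      have h1 : Λ.At prof (.prop p : Fml (Fin n) 𝒢) u := ⟨hu, h0', hi.trans hψ.2.2⟩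
      rw [hψ.tr_iff, h1.tr_iff]
  · cases ψ with
    | prop | conj | know | every | common => have := hψ.2.1; omega
    | neg φ =>
      rw [h.2.1 t ht, h.2.1 _ hψ.2.2.lt, hψ.tr_iff, hψ.2.2.tr_iff]
      rfl
  · cases ψ with
    | prop | neg | know | every | common => have := hψ.2.1; omega
    | conj φ ψ =>
      rw [hd.stop_eq _ _ hψ.2.2.1, h.2.1 t ht, h.2.1 _ hψ.2.2.1.lt, h.2.1 _ hψ.2.2.2.lt,
        hψ.tr_iff, hψ.2.2.1.tr_iff, hψ.2.2.2.tr_iff]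
      rfl
  · obtain ⟨j, hj⟩ := exists_agent hd ht h3
    rw [h.body_iff (hd.modal_lt t ht h3)]
    exact trBody_of_rel h3 hj (rel_refl hA hM j w) ((h.2.1 t ht).1 hS)

include hd hA hM in
theorem Rep.comp {i : Fin n} {w v : M.State} {x : ℕ} (h : Λ.Rep 𝒢 prof M A₁ i w v x)
    (hr : M.rel i w v) : Λ.Comp x := by
  intro t ht h3 hP
  have hi := (h.2.2.2 t (by omega)).1 hP
  rw [h.2.2.1 t ht, h.2.1 t ht, h.body_iff (hd.modal_lt t ht h3)]
  refine ⟨fun hw => ⟨h3, hi, ?_⟩, ?_⟩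
  · by_cases hiA : i ∈ A₁
    · exact .inl ⟨hiA, fun u hu => trBody_of_rel h3 hi hu hw⟩
    · exact .inr ⟨hiA, .inl hw⟩
  · rintro ⟨-, -, ⟨-, h1⟩ | ⟨-, h1 | h1⟩⟩
    · exact h1 w (rel_refl hA hM i w)
    · exact trBody_of_rel h3 hi (rel_refl hA hM i w) h1
    · exact trBody_of_rel h3 hi (rel_symm hA hM hr) h1

include hd in
theorem Rep.link {i : Fin n} {w v v' : M.State} {x x' : ℕ} (h : Λ.Rep 𝒢 prof M A₁ i w v x)
    (h' : Λ.Rep 𝒢 prof M A₁ i w v' x') : Λ.Link x x' := by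
  refine ⟨fun t ht => (h.2.1 t ht).trans (h'.2.1 t ht).symm,
    fun t ht => (h.2.2.2 t ht).trans (h'.2.2.2 t ht).symm, fun hL t ht => ?_⟩
  have hi := (hd.trans_iff i).1 ((h.2.2.2 Λ.L (by omega)).1 hL)
  rw [h.2.2.1 t ht, h'.2.2.1 t ht]
  simp [hi]

include hA hM in
theorem Rep.eqF {i : Fin n} {w v : M.State} {x x' : ℕ} (h : Λ.Rep 𝒢 prof M A₁ i w v x)
    (h' : Λ.Rep 𝒢 prof M A₁ i v w x') (hr : M.rel i w v) : Λ.EqF x x' := by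
  intro t ht
  rw [h.2.2.1 t ht, h'.2.2.1 t ht]
  refine and_congr_right fun _ => and_congr_right fun _ => or_congr ?_ ?_
  · refine and_congr_right fun hi => ⟨fun k u hu => k u ?_, fun k u hu => k u ?_⟩
    · exact hM.trans₁ i hi w v u hr hu
    · exact hM.trans₁ i hi v w u (rel_symm hA hM hr) hu
  · exact and_congr_right fun _ => or_comm

theorem Rep.eqP {i : Fin n} {w v w' v' : M.State} {x x' : ℕ} (h : Λ.Rep 𝒢 prof M A₁ i w v x)
    (h' : Λ.Rep 𝒢 prof M A₁ i w' v' x') : Λ.EqP x x' :=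
  fun t ht => (h.2.2.2 t ht).trans (h'.2.2.2 t ht).symm

variable (Λ 𝒢 prof M) in
/-- The codes that describe worlds and classes of the model `M`. -/
def Reps (A₁ : Set (Fin n)) : Set ℕ :=
  {x | ∃ i w v, M.rel i w v ∧ Λ.Rep 𝒢 prof M A₁ i w v x}

include hd hA hM in
/-- Worlds of a model meet their obligations. -/
theorem Rep.covers {T X : Set ℕ} (hT : Λ.Reps 𝒢 prof M A₁ ⊆ T) {t₀ x : ℕ} {i : Fin n}
    {w v : M.State} (hr : M.rel i w v) (h : Λ.Rep 𝒢 prof M A₁ i w v x)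
    (hX : t₀ < Λ.L → Λ.kind t₀ = 5 → ¬ Λ.Tr 𝒢 prof M w t₀ → ∃ j, (prof j).testBit t₀ ∧
      ∃ u, M.rel j w u ∧ ¬ Λ.TrBody 𝒢 prof M u t₀ ∧
        (¬ Λ.Tr 𝒢 prof M u (t₀ + 1) ∨ ∀ x', Λ.Rep 𝒢 prof M A₁ j u w x' → x' ∈ X)) :
    Λ.Covers T X t₀ (List.ofFn prof) x := by
  choose g hg using fun j => exists_rep (Λ := Λ) (𝒢 := 𝒢) (prof := prof) (A₁ := A₁) (M := M) j w w
  have refl := rel_refl hA hM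
  refine ⟨List.ofFn fun j => (g j, prof j), .of_eq (by rw [List.map_ofFn]; rfl), ?_,
    fun t ht ho => ?_⟩
  · intro p hp
    obtain ⟨j, rfl⟩ := (List.mem_ofFn' _ _).1 hp
    exact ⟨(hg j).1, fun t ht => (h.2.1 t ht).trans ((hg j).2.1 t ht).symm, (hg j).2.2.2,
      (hg j).comp hd hA hM (refl j w)⟩
  have mem : ∀ j, (g j, prof j) ∈ List.ofFn fun j => (g j, prof j) := fun j =>
    (List.mem_ofFn' _ _).2 ⟨j, rfl⟩
  rcases ho with rfl | ⟨ht, h3, hS⟩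
  · exact ⟨_, mem i, x, h.1, (hg i).link hd h, h.comp hd hA hM hr,
      .inl ⟨rfl, fun _ _ => .rfl, fun _ _ => .rfl⟩⟩
  rw [h.2.1 t ht] at hS
  obtain ⟨j, hj, u, hru, hb, hprog⟩ : ∃ j, (prof j).testBit t ∧
      ∃ u, M.rel j w u ∧ ¬ Λ.TrBody 𝒢 prof M u t ∧ (t = t₀ → Λ.kind t = 5 →
        ¬ Λ.Tr 𝒢 prof M u (t + 1) ∨ ∀ x', Λ.Rep 𝒢 prof M A₁ j u w x' → x' ∈ X) := by
    by_cases hc : t = t₀ ∧ Λ.kind t = 5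
    · obtain ⟨rfl, h5⟩ := hc
      obtain ⟨j, h1, u, h2, h3, h4⟩ := hX ht h5 hS
      exact ⟨j, h1, u, h2, h3, fun _ _ => h4⟩
    · obtain ⟨j, h1, u, h2, h3⟩ := exists_rel_of_not_tr hd ht h3 hS
      exact ⟨j, h1, u, h2, h3, fun h4 h5 => (hc ⟨h4, h5⟩).elim⟩
  obtain ⟨z, hz⟩ := exists_rep (Λ := Λ) (𝒢 := 𝒢) (prof := prof) (A₁ := A₁) j w u
  obtain ⟨x', hx'⟩ := exists_rep (Λ := Λ) (𝒢 := 𝒢) (prof := prof) (A₁ := A₁) j u w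
  have hlt := hd.modal_lt t ht h3
  refine ⟨_, mem j, z, hz.1, (hg j).link hd hz, hz.comp hd hA hM hru, .inr ⟨ht, ?_, x', hx'.1,
    hT ⟨j, u, w, rel_symm hA hM hru, hx'⟩, hz.eqP hx', hz.eqF hA hM hx' hru, ?_, fun e h5 => ?_⟩⟩
  · exact (hz.2.2.2 t (by omega)).2 hj
  · rwa [hx'.body_iff hlt]
  · rw [hx'.2.1 _ hlt]
    exact (hprog e h5).imp_right fun h => h x' hx'

include hd hA hM in
/-- Codes of worlds of `M` are never eliminated. -/
theorem Rep.mem_iterate {T : Set ℕ} (hT : Λ.Reps 𝒢 prof M A₁ ⊆ T) {t₀ x : ℕ} {i : Fin n}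
    {w v : M.State} (hr : M.rel i w v) (h : Λ.Rep 𝒢 prof M A₁ i w v x) (ho : Λ.Obliged x t₀) :
    x ∈ (Λ.reach (List.ofFn prof) T t₀)^[Λ.N] ∅ := by
  set X := (Λ.reach (List.ofFn prof) T t₀)^[Λ.N] ∅ with hXdef
  have fixed : Λ.reach (List.ofFn prof) T t₀ X = X := reach_fixed _ _ _
  have hTx : x ∈ T := hT ⟨i, w, v, hr, h⟩
  rw [← fixed, mem_reach]
  refine ⟨h.1, hTx, ho, ?_⟩
  rcases Classical.em (t₀ < Λ.L ∧ Λ.kind t₀ = 5) with ⟨ht, h5⟩ | hc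
  swap
  · exact h.covers hd hA hM hT hr fun h1 h2 => (hc ⟨h1, h2⟩).elim
  obtain ⟨ψ, hψ⟩ := hd.exists_at t₀ ht
  cases ψ with
  | prop | neg | conj | know | every => have := hψ.2.1; omega
  | common G φ =>
  -- by induction on the number of steps after which `φ` is refuted
  have key : ∀ k, ∀ (i : Fin n) (w v : M.State) (x : ℕ), M.rel i w v →
      Λ.Rep 𝒢 prof M A₁ i w v x → w ∉ (M.everyone G.1)^[k + 1] (M.truth φ) →
      Λ.Covers T X t₀ (List.ofFn prof) x := by
    intro k
    induction k with
    | zero =>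
      intro i w v x hr h hk
      refine h.covers hd hA hM hT hr fun _ _ _ => ?_
      by_contra! hc
      refine hk fun j hj u hu => ?_
      by_contra hu'
      rw [← hψ.2.2.2.tr_iff] at hu'
      exact hu' (hc j ((hψ.2.2.1 j).2 hj) u hu fun hb => hu' hb.1).1
    | succ k ih =>
      intro i w v x hr h hk
      refine h.covers hd hA hM hT hr fun _ _ _ => ?_
      rw [Function.iterate_succ_apply'] at hk
      obtain ⟨j, hj, u, hu, hk⟩ : ∃ j ∈ G.1, ∃ u, M.rel j w u ∧
          u ∉ (M.everyone G.1)^[k + 1] (M.truth φ) := by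
        by_contra! hc
        exact hk hc
      have hu' : ¬ Λ.Tr 𝒢 prof M u t₀ := fun hu' =>
        hk ((hψ.tr_iff u).1 hu' (k + 1) (by omega))
      refine ⟨j, (hψ.2.2.1 j).2 hj, u, hu, fun hb => hu' (hb.2 h5), .inr fun x' hx' => ?_⟩
      have hr' := rel_symm hA hM hu
      rw [← fixed, mem_reach]
      refine ⟨hx'.1, hT ⟨j, u, w, hr', hx'⟩, .inr ⟨ht, by omega, ?_⟩, ih j u w x' hr' hx' hk⟩
      rwa [hx'.2.1 t₀ ht]
  have hS : ¬ S x t₀ := (ho.resolve_left (by omega)).2.2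
  rw [h.2.1 t₀ ht, hψ.tr_iff] at hS
  obtain ⟨k, hk⟩ := not_forall.1 hS
  obtain ⟨hk1, hk⟩ := Classical.not_imp.1 hk
  obtain ⟨k, rfl⟩ := Nat.exists_eq_add_of_le' hk1
  exact key k i w v x hr h hk

end Complete

theorem exists_survivor_of_sat (hd : Λ.Describes 𝒢 prof A₁) (hA : A₁ ∪ A₂ = Set.univ) (hn : 0 < n)
    {φ : Fml (Fin n) 𝒢} (hφ : Λ.At prof φ 0) (h : φ.SatMixedRST A₁ A₂) :
    ∃ x ∈ Λ.survivors (keep (Λ.L + 1) (List.ofFn prof)), S x 0 := by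
  obtain ⟨M, hM, w, hw⟩ := h
  obtain ⟨x, hx⟩ := exists_rep (Λ := Λ) (𝒢 := 𝒢) (prof := prof) (A₁ := A₁) (⟨0, hn⟩ : Fin n) w w
  have hmem : x ∈ Λ.Reps 𝒢 prof M A₁ := ⟨_, w, w, rel_refl hA hM _ w, hx⟩
  refine ⟨x, ?_, (hx.2.1 0 hφ.lt).2 ((hφ.tr_iff w).2 hw)⟩
  refine subset_survivors (R := Λ.Reps 𝒢 prof M A₁) ?_ ?_ hmem
  · rintro y ⟨i, u, v, hr, hy⟩
    exact ⟨hy.1, hy.cons hd hA hM⟩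
  · intro T hT hT' y hy t ht ho
    suffices ∀ X, Λ.reach (keep (Λ.L + 1) (List.ofFn prof)) T t X =
        Λ.reach (List.ofFn prof) T t X by
      rw [funext this]
      obtain ⟨i, u, v, hr, hy⟩ := hy
      exact hy.mem_iterate hd hA hM hT hr ho
    intro X
    ext y
    rw [mem_reach, mem_reach]
    refine and_congr_right fun _ => and_congr_right fun hy => and_congr_right fun _ => ?_
    exact covers_keep (hT' hy).2 hd.modal_lt

/-- The elimination procedure is correct. -/
theorem sat_iff_exists_survivor (hd : Λ.Describes 𝒢 prof A₁) (hA : A₁ ∪ A₂ = Set.univ) (hn : 0 < n)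
    {φ : Fml (Fin n) 𝒢} (hφ : Λ.At prof φ 0) : φ.SatMixedRST A₁ A₂ ↔
      ∃ x ∈ Λ.survivors (keep (Λ.L + 1) (List.ofFn prof)), S x 0 :=
  ⟨exists_survivor_of_sat hd hA hn hφ, fun ⟨_, hx, hS⟩ => sat_of_mem_survivors hd hφ hx hS⟩

end Shape

/-! ### Formulas as expressions -/

namespace Expr

/-- An expression, read as a formula, is true if its value is not `0`. -/
def Holds (O : ℕ → ℕ → ℕ) (σ : Store) (ρ : List ℕ) (e : Expr) : Prop := e.eval O σ ρ ≠ 0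

/-! Connectives and comparisons of expressions, read as formulas. -/

protected def not (e : Expr) : Expr := ite e (lit 0) (lit 1)
protected def and (e f : Expr) : Expr := ite e f (lit 0)
protected def or (e f : Expr) : Expr := ite e (lit 1) f
def imp (e f : Expr) : Expr := ite e f (lit 1)
def iff (e f : Expr) : Expr := ite e f f.not
def all (c : ℕ) (e : Expr) : Expr := (sum c e.not).not
def le (e f : Expr) : Expr := (sub e f).not
def lt (e f : Expr) : Expr := sub f e
def eq (e f : Expr) : Expr := (le e f).and (le f e)

section

variable {O : ℕ → ℕ → ℕ} {σ : Store} {ρ : List ℕ} {e f : Expr} {c : ℕ}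

theorem eval_ite (e f g : Expr) :
    (ite e f g).eval O σ ρ = if e.eval O σ ρ ≠ 0 then f.eval O σ ρ else g.eval O σ ρ := rfl

theorem eval_not : e.not.eval O σ ρ = if e.eval O σ ρ = 0 then 1 else 0 := by
  rw [Expr.not, eval_ite]
  by_cases h : e.eval O σ ρ = 0 <;> simp [h, eval]

theorem eval_le : (le e f).eval O σ ρ = if e.eval O σ ρ ≤ f.eval O σ ρ then 1 else 0 := by
  rw [le, eval_not]
  simp [eval, Nat.sub_eq_zero_iff_le]

theorem eval_eq : (eq e f).eval O σ ρ = if e.eval O σ ρ = f.eval O σ ρ then 1 else 0 := by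
  rw [eq, Expr.and, eval_ite, eval_le, eval_le]
  simp only [eval]
  split_ifs <;> first | rfl | omega

theorem holds_not : e.not.Holds O σ ρ ↔ ¬ e.Holds O σ ρ := by
  rw [Holds, eval_not, Holds]; split <;> simp_all

theorem holds_and : (e.and f).Holds O σ ρ ↔ e.Holds O σ ρ ∧ f.Holds O σ ρ := by
  simp only [Holds, Expr.and, eval_ite]; split <;> simp_all [eval]

theorem holds_or : (e.or f).Holds O σ ρ ↔ e.Holds O σ ρ ∨ f.Holds O σ ρ := by
  simp only [Holds, Expr.or, eval_ite]; split <;> simp_all [eval]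

theorem holds_imp : (e.imp f).Holds O σ ρ ↔ (e.Holds O σ ρ → f.Holds O σ ρ) := by
  simp only [Holds, imp, eval_ite]; split <;> simp_all [eval]

theorem holds_iff : (e.iff f).Holds O σ ρ ↔ (e.Holds O σ ρ ↔ f.Holds O σ ρ) := by
  simp only [Holds, iff, eval_ite, eval_not]; split <;> simp_all

theorem holds_sum : (sum c e).Holds O σ ρ ↔ ∃ k < σ.reg c, e.Holds O σ (k :: ρ) := by
  simp [Holds, eval, Finset.sum_eq_zero_iff]

theorem holds_all : (all c e).Holds O σ ρ ↔ ∀ k < σ.reg c, e.Holds O σ (k :: ρ) := by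
  simp [all, holds_not, holds_sum]

theorem holds_le : (le e f).Holds O σ ρ ↔ e.eval O σ ρ ≤ f.eval O σ ρ := by
  rw [Holds, eval_le]; split <;> simp_all

theorem holds_lt : (lt e f).Holds O σ ρ ↔ e.eval O σ ρ < f.eval O σ ρ := by
  simp [Holds, lt, eval, Nat.sub_eq_zero_iff_le]

theorem holds_eq : (eq e f).Holds O σ ρ ↔ e.eval O σ ρ = f.eval O σ ρ := by
  rw [Holds, eval_eq]; split <;> simp_all

theorem holds_get {a : ℕ} : (get a e).Holds O σ ρ ↔ σ.arr a (e.eval O σ ρ) ≠ 0 := .rfl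

end

end Expr

/-- Registers and bound variables. Unlike general expressions, these are easily moved under a
binder. -/
inductive Atom : Type
  | reg (r : ℕ)
  | var (k : ℕ)

namespace Atom

/-- The atom as an expression. -/
def expr : Atom → Expr
  | reg r => .reg r
  | var k => .var k

/-- The atom, moved under a binder. -/
def up : Atom → Atom
  | reg r => reg r
  | var k => var (k + 1)

/-- The value of an atom, as for expressions. -/
def val (σ : Store) (ρ : List ℕ) : Atom → ℕ
  | reg r => σ.reg r
  | var k => ρ.getD k (σ.reg 0)

theorem eval_expr (O : ℕ → ℕ → ℕ) (σ : Store) (ρ : List ℕ) (x : Atom) :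
    x.expr.eval O σ ρ = x.val σ ρ := by cases x <;> rfl

theorem val_up (σ : Store) (ρ : List ℕ) (k : ℕ) (x : Atom) : x.up.val σ (k :: ρ) = x.val σ ρ := by
  cases x <;> rfl

theorem val_var_zero (σ : Store) (ρ : List ℕ) (k : ℕ) : (var 0).val σ (k :: ρ) = k := rfl

theorem val_reg (σ : Store) (ρ : List ℕ) (r : ℕ) : (reg r).val σ ρ = σ.reg r := rfl

end Atom

/-- What the elimination finds in the store: the shape of the formula, the profiles `l` of agents,
and a table of the bits of the codes. Registers `0`, `2`, `4`, `5` hold `L`, `L + 1`, `N` and the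
length of `l`; arrays `0`, `1`, `7`, `4` hold the kinds and indices of tokens, the ends of
subformulas, and `l`; bit `j` of `x` is at `BASE[x] + j` in array `6`, where `BASE` is array `5`. -/
structure Ready (Λ : Shape) (l : List ℕ) (σ : Store) : Prop where
  reg_zero : σ.reg 0 = Λ.L
  reg_two : σ.reg 2 = Λ.L + 1
  reg_four : σ.reg 4 = Λ.N
  reg_five : σ.reg 5 = l.length
  kind : σ.arr 0 = Λ.kind
  idx : σ.arr 1 = Λ.idx
  finish : σ.arr 7 = Λ.finish
  list : ∀ i (h : i < l.length), σ.arr 4 i = l[i]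
  lt : ∀ q ∈ l, q < Λ.N
  bit : ∀ x < Λ.N, ∀ j < 4 * Λ.L + 2, σ.arr 6 (σ.arr 5 x + j) ≠ 0 ↔ x.testBit j
  stop_lt : ∀ t < Λ.L, Λ.kind t = 2 → Λ.finish (t + 1) < 4 * Λ.L + 2

theorem Ready.congr {Λ : Shape} {l : List ℕ} {σ τ : Store} (h : Ready Λ l σ)
    (hr : ∀ r < 6, τ.reg r = σ.reg r) (ha : ∀ a < 8, τ.arr a = σ.arr a) : Ready Λ l τ where
  reg_zero := by rw [hr 0 (by omega), h.reg_zero]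
  reg_two := by rw [hr 2 (by omega), h.reg_two]
  reg_four := by rw [hr 4 (by omega), h.reg_four]
  reg_five := by rw [hr 5 (by omega), h.reg_five]
  kind := by rw [ha 0 (by omega), h.kind]
  idx := by rw [ha 1 (by omega), h.idx]
  finish := by rw [ha 7 (by omega), h.finish]
  list := by rw [ha 4 (by omega)]; exact h.list
  lt := h.lt
  bit := by rw [ha 6 (by omega), ha 5 (by omega)]; exact h.bit
  stop_lt := h.stop_lt

open MixedRST.Expr in
/-- Bit `e` of `x`, from the table. -/
def bitE (x : Atom) (e : Expr) : Expr := get 6 (add (get 5 x.expr) e)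

section Formulas

open MixedRST.Expr

/-! In the following, `fooE` expresses the predicate `Shape.Foo`, and `bitS`, …, `bitD` express
`Shape.S`, …, `Shape.D`. Array `9` holds the set `T`, array `10` the set `X`, array `11` the set of
codes covered by the agents considered so far, and register `7` the obligation `t₀`. The predicates
defined by means of a current code `x` expect it in register `10`. -/

def bitS (x : Atom) (e : Expr) : Expr := bitE x e
def bitF (x : Atom) (e : Expr) : Expr := bitE x (add (reg 0) e)
def bitP (x : Atom) (e : Expr) : Expr := bitE x (add (add (reg 0) (reg 0)) e)
def bitD (x : Atom) (e : Expr) : Expr :=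
  bitE x (add (add (add (add (reg 0) (reg 0)) (reg 0)) (lit 1)) e)

def eqSE (x y : Atom) : Expr := all 0 (iff (bitS x.up (var 0)) (bitS y.up (var 0)))
def eqFE (x y : Atom) : Expr := all 0 (iff (bitF x.up (var 0)) (bitF y.up (var 0)))
def eqPE (x y : Atom) : Expr := all 2 (iff (bitP x.up (var 0)) (bitP y.up (var 0)))

def bodyE (x t : Atom) : Expr :=
  (bitS x (add t.expr (lit 1))).and (imp (eq (get 0 t.expr) (lit 5)) (bitS x t.expr))

def consE (x : Atom) : Expr := all 0 <|
  (imp (eq (get 0 (var 0)) (lit 0)) (all 0 (imp (eq (get 0 (var 0)) (lit 0))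
    (imp (eq (get 1 (var 0)) (get 1 (var 1)))
      (iff (bitS x.up.up (var 1)) (bitS x.up.up (var 0))))))).and <|
  (imp (eq (get 0 (var 0)) (lit 1))
    (iff (bitS x.up (var 0)) (bitS x.up (add (var 0) (lit 1))).not)).and <|
  (imp (eq (get 0 (var 0)) (lit 2)) (iff (bitS x.up (var 0))
    ((bitS x.up (add (var 0) (lit 1))).and (bitS x.up (get 7 (add (var 0) (lit 1))))))).and <|
  imp (le (lit 3) (get 0 (var 0))) (imp (bitS x.up (var 0)) (bodyE x.up (.var 0)))

def compE (x : Atom) : Expr := all 0 <| imp (le (lit 3) (get 0 (var 0))) <|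
  imp (bitP x.up (var 0)) <| (imp (bitS x.up (var 0)) (bitF x.up (var 0))).and
    (imp (bitF x.up (var 0)) (bodyE x.up (.var 0)))

def linkE (z z' : Atom) : Expr :=
  (eqSE z z').and ((eqPE z z').and (imp (bitP z (reg 0)) (eqFE z z')))

def obligedE (x t : Atom) : Expr := (eq t.expr (reg 0)).or <|
  (lt t.expr (reg 0)).and ((le (lit 3) (get 0 t.expr)).and (bitS x t.expr).not)

def hitE (x z t : Atom) : Expr :=
  ((eq t.expr (reg 0)).and ((eqPE x z).and (eqFE x z))).or <|
  (lt t.expr (reg 0)).and <| (bitP z t.expr).and <| sum 4 <|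
    (get 9 (var 0)).and <| (eqPE z.up (.var 0)).and <| (eqFE z.up (.var 0)).and <|
    (bodyE (.var 0) t.up).not.and <|
    imp (eq t.up.expr (reg 7)) <| imp (eq (get 0 t.up.expr) (lit 5)) <|
    (bitS (.var 0) (add t.up.expr (lit 1))).not.or (get 10 (var 0))

def serveE (x z t : Atom) : Expr := sum 4 <|
  (linkE z.up (.var 0)).and <| (compE (.var 0)).and <| hitE x.up (.var 0) t.up

def startE : Expr := all 2 (bitD (.reg 10) (var 0)).not

/-- The code bound by variable `0` has the profile of the current agent of the list, entry `reg 6`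
of array `4`. -/
def profileE : Expr := all 2 <|
  iff (bitP (.var 1) (var 0)) (get 6 (add (get 5 (get 4 (reg 6))) (var 0)))

/-- The set `Shape.extend`, for the current profile of the list in array `4`. -/
def extendE : Expr := sum 4 <| (get 11 (var 0)).and <| (eqSE (.reg 10) (.var 0)).and <|
  (eqFE (.reg 10) (.var 0)).and <| (eqPE (.reg 10) (.var 0)).and <| sum 4 <|
  (eqSE (.reg 10) (.var 0)).and <| profileE.and <| (compE (.var 0)).and <|
  all 2 <| imp (bitD (.reg 10) (var 0)) <| (bitD (.var 2) (var 0)).or <|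
    serveE (.reg 10) (.var 1) (.var 0)

def reachE : Expr := (get 9 (reg 10)).and <| (obligedE (.reg 10) (.reg 7)).and <| sum 4 <|
  (get 11 (var 0)).and <| (eqSE (.reg 10) (.var 0)).and <| (eqFE (.reg 10) (.var 0)).and <|
  (eqPE (.reg 10) (.var 0)).and <|
  all 2 <| imp (obligedE (.reg 10) (.var 0)) (bitD (.var 1) (var 0))

def sieveE : Expr :=
  (get 9 (reg 10)).and (imp (obligedE (.reg 10) (.reg 7)) (get 10 (reg 10)))

section Spec

variable {O : ℕ → ℕ → ℕ} {Λ : Shape} {l : List ℕ} {σ : Store} {ρ : List ℕ}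

theorem eval_reg (r : ℕ) : (reg r).eval O σ ρ = σ.reg r := rfl
theorem eval_var_zero (k : ℕ) : (var 0).eval O σ (k :: ρ) = k := rfl
theorem eval_var_one (j k : ℕ) : (var 1).eval O σ (j :: k :: ρ) = k := rfl
theorem eval_get (a : ℕ) (e : Expr) : (get a e).eval O σ ρ = σ.arr a (e.eval O σ ρ) := rfl
theorem eval_add (e f : Expr) : (add e f).eval O σ ρ = e.eval O σ ρ + f.eval O σ ρ := rfl
theorem eval_lit (k : ℕ) : (lit k).eval O σ ρ = k := rfl

variable (h : Ready Λ l σ)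

include h

theorem holds_bitE {x : Atom} {e : Expr} (hx : x.val σ ρ < Λ.N)
    (he : e.eval O σ ρ < 4 * Λ.L + 2) :
    (bitE x e).Holds O σ ρ ↔ (x.val σ ρ).testBit (e.eval O σ ρ) := by
  rw [bitE, holds_get, eval_add, eval_get, Atom.eval_expr, h.bit _ hx _ he]

theorem holds_bitS {x : Atom} {e : Expr} (hx : x.val σ ρ < Λ.N)
    (he : e.eval O σ ρ < 4 * Λ.L + 2) :
    (bitS x e).Holds O σ ρ ↔ Shape.S (x.val σ ρ) (e.eval O σ ρ) :=
  holds_bitE h hx he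

theorem holds_bitF {x : Atom} {e : Expr} (hx : x.val σ ρ < Λ.N) (he : e.eval O σ ρ < Λ.L) :
    (bitF x e).Holds O σ ρ ↔ Λ.F (x.val σ ρ) (e.eval O σ ρ) := by
  have e1 : (add (reg 0) e).eval O σ ρ = Λ.L + e.eval O σ ρ := by
    rw [eval_add, eval_reg, h.reg_zero]
  rw [bitF, holds_bitE h hx (by rw [e1]; omega), e1]
  rfl

theorem holds_bitP {x : Atom} {e : Expr} (hx : x.val σ ρ < Λ.N) (he : e.eval O σ ρ < Λ.L + 1) :
    (bitP x e).Holds O σ ρ ↔ Λ.P (x.val σ ρ) (e.eval O σ ρ) := by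
  have e1 : (add (add (reg 0) (reg 0)) e).eval O σ ρ = Λ.L + Λ.L + e.eval O σ ρ := by
    rw [eval_add, eval_add, eval_reg, h.reg_zero]
  rw [bitP, holds_bitE h hx (by rw [e1]; omega), e1]
  rfl

theorem holds_bitD {x : Atom} {e : Expr} (hx : x.val σ ρ < Λ.N) (he : e.eval O σ ρ < Λ.L + 1) :
    (bitD x e).Holds O σ ρ ↔ Λ.D (x.val σ ρ) (e.eval O σ ρ) := by
  have e1 : (add (add (add (add (reg 0) (reg 0)) (reg 0)) (lit 1)) e).eval O σ ρ =
      Λ.L + Λ.L + Λ.L + 1 + e.eval O σ ρ := by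
    simp only [eval_add, eval_reg, eval_lit, h.reg_zero]
  rw [bitD, holds_bitE h hx (by rw [e1]; omega), e1]
  rfl

theorem holds_eqSE {x y : Atom} (hx : x.val σ ρ < Λ.N) (hy : y.val σ ρ < Λ.N) :
    (eqSE x y).Holds O σ ρ ↔ Λ.EqS (x.val σ ρ) (y.val σ ρ) := by
  rw [eqSE, holds_all, h.reg_zero]
  refine forall₂_congr fun t ht => ?_
  have ht' : (var 0).eval O σ (t :: ρ) < 4 * Λ.L + 2 := by rw [eval_var_zero]; omega
  rw [holds_iff, holds_bitS h (by rwa [Atom.val_up]) ht', holds_bitS h (by rwa [Atom.val_up]) ht',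
    Atom.val_up, Atom.val_up, eval_var_zero]

theorem holds_eqFE {x y : Atom} (hx : x.val σ ρ < Λ.N) (hy : y.val σ ρ < Λ.N) :
    (eqFE x y).Holds O σ ρ ↔ Λ.EqF (x.val σ ρ) (y.val σ ρ) := by
  rw [eqFE, holds_all, h.reg_zero]
  refine forall₂_congr fun t ht => ?_
  have ht' : (var 0).eval O σ (t :: ρ) < Λ.L := by rwa [eval_var_zero]
  rw [holds_iff, holds_bitF h (by rwa [Atom.val_up]) ht', holds_bitF h (by rwa [Atom.val_up]) ht',
    Atom.val_up, Atom.val_up, eval_var_zero]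

theorem holds_eqPE {x y : Atom} (hx : x.val σ ρ < Λ.N) (hy : y.val σ ρ < Λ.N) :
    (eqPE x y).Holds O σ ρ ↔ Λ.EqP (x.val σ ρ) (y.val σ ρ) := by
  rw [eqPE, holds_all, h.reg_two]
  refine forall₂_congr fun t ht => ?_
  have ht' : (var 0).eval O σ (t :: ρ) < Λ.L + 1 := by rwa [eval_var_zero]
  rw [holds_iff, holds_bitP h (by rwa [Atom.val_up]) ht', holds_bitP h (by rwa [Atom.val_up]) ht',
    Atom.val_up, Atom.val_up, eval_var_zero]

theorem holds_bodyE {x t : Atom} (hx : x.val σ ρ < Λ.N) (ht : t.val σ ρ < Λ.L) :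
    (bodyE x t).Holds O σ ρ ↔ Λ.Body (x.val σ ρ) (t.val σ ρ) := by
  have e1 : (add t.expr (lit 1)).eval O σ ρ = t.val σ ρ + 1 := by
    rw [eval_add, Atom.eval_expr, eval_lit]
  rw [bodyE, holds_and, holds_imp, holds_eq, eval_get, h.kind, eval_lit, Atom.eval_expr,
    holds_bitS h hx (by rw [e1]; omega), holds_bitS h hx (by rw [Atom.eval_expr]; omega), e1,
    Atom.eval_expr]
  rfl

theorem holds_consE {x : Atom} (hx : x.val σ ρ < Λ.N) :
    (consE x).Holds O σ ρ ↔ Λ.Cons (x.val σ ρ) := by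
  rw [consE, holds_all, h.reg_zero]
  refine forall₂_congr fun t ht => ?_
  have hxu : x.up.val σ (t :: ρ) < Λ.N := by rwa [Atom.val_up]
  have e0 : (var 0).eval O σ (t :: ρ) = t := rfl
  have e1 : (add (var 0) (lit 1)).eval O σ (t :: ρ) = t + 1 := rfl
  have e2 : (get 7 (add (var 0) (lit 1))).eval O σ (t :: ρ) = Λ.finish (t + 1) := by
    rw [eval_get, e1, h.finish]
  simp only [holds_and]
  refine and_congr ?_ (and_congr ?_ (and_congr ?_ ?_))
  · rw [holds_imp, holds_eq, eval_get, e0, h.kind, eval_lit, holds_all, h.reg_zero]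
    refine imp_congr_right fun _ => forall₂_congr fun u hu => ?_
    have hxuu : x.up.up.val σ (u :: t :: ρ) < Λ.N := by rwa [Atom.val_up]
    rw [holds_imp, holds_eq, eval_get, eval_var_zero, h.kind, eval_lit, holds_imp, holds_eq,
      eval_get, eval_get, h.idx, eval_var_zero, eval_var_one, holds_iff,
      holds_bitS h hxuu (by rw [eval_var_one]; omega),
      holds_bitS h hxuu (by rw [eval_var_zero]; omega), eval_var_zero, eval_var_one,
      Atom.val_up, Atom.val_up]
  · rw [holds_imp, holds_eq, eval_get, e0, h.kind, eval_lit, holds_iff, holds_not,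
      holds_bitS h hxu (by rw [e0]; omega), holds_bitS h hxu (by rw [e1]; omega), e0, e1,
      Atom.val_up]
  · rw [holds_imp, holds_eq, eval_get, e0, h.kind, eval_lit]
    refine imp_congr_right fun h2 => ?_
    rw [holds_iff, holds_and,
      holds_bitS h hxu (by rw [e0]; omega), holds_bitS h hxu (by rw [e1]; omega),
      holds_bitS h hxu (by rw [e2]; exact h.stop_lt t ht h2), e0, e1, e2, Atom.val_up]
  · rw [holds_imp, holds_le, eval_get, e0, h.kind, eval_lit, holds_imp,
      holds_bitS h hxu (by rw [e0]; omega), holds_bodyE h hxu (by exact ht), e0, Atom.val_up,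
      Atom.val_var_zero]

theorem holds_compE {x : Atom} (hx : x.val σ ρ < Λ.N) :
    (compE x).Holds O σ ρ ↔ Λ.Comp (x.val σ ρ) := by
  rw [compE, holds_all, h.reg_zero]
  refine forall₂_congr fun t ht => ?_
  have hxu : x.up.val σ (t :: ρ) < Λ.N := by rwa [Atom.val_up]
  have e0 : (var 0).eval O σ (t :: ρ) = t := rfl
  rw [holds_imp, holds_imp, holds_and, holds_imp, holds_imp, holds_le, eval_get, e0, h.kind,
    eval_lit, holds_bitP h hxu (by rw [e0]; omega), holds_bitS h hxu (by rw [e0]; omega),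
    holds_bitF h hxu (by rw [e0]; omega), holds_bodyE h hxu (by exact ht), e0, Atom.val_up,
    Atom.val_var_zero]

theorem holds_linkE {x y : Atom} (hx : x.val σ ρ < Λ.N) (hy : y.val σ ρ < Λ.N) :
    (linkE x y).Holds O σ ρ ↔ Λ.Link (x.val σ ρ) (y.val σ ρ) := by
  have e0 : (reg 0).eval O σ ρ = Λ.L := h.reg_zero
  rw [linkE, holds_and, holds_and, holds_imp, holds_eqSE h hx hy, holds_eqPE h hx hy,
    holds_eqFE h hx hy, holds_bitP h hx (by rw [e0]; omega), e0]
  rfl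

theorem holds_obligedE {x t : Atom} (hx : x.val σ ρ < Λ.N) (ht : t.val σ ρ < Λ.L + 1) :
    (obligedE x t).Holds O σ ρ ↔ Λ.Obliged (x.val σ ρ) (t.val σ ρ) := by
  rw [obligedE, holds_or, holds_and, holds_and, holds_not, holds_eq, holds_lt, holds_le, eval_reg,
    h.reg_zero, eval_get, h.kind, eval_lit, Atom.eval_expr,
    holds_bitS h hx (by rw [Atom.eval_expr]; omega), Atom.eval_expr]
  rfl

variable {T X : Set ℕ} {t₀ : ℕ} (hT : ∀ x < Λ.N, σ.arr 9 x ≠ 0 ↔ x ∈ T)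
  (hX : ∀ x < Λ.N, σ.arr 10 x ≠ 0 ↔ x ∈ X) (h7 : σ.reg 7 = t₀)

include hT hX h7

theorem holds_hitE {x z t : Atom} (hx : x.val σ ρ < Λ.N) (hz : z.val σ ρ < Λ.N)
    (ht : t.val σ ρ < Λ.L + 1) :
    (hitE x z t).Holds O σ ρ ↔ Λ.Hit T X t₀ (x.val σ ρ) (z.val σ ρ) (t.val σ ρ) := by
  rw [hitE, holds_or, holds_and, holds_and, holds_eqPE h hx hz, holds_eqFE h hx hz, holds_eq,
    eval_reg, h.reg_zero, Atom.eval_expr, holds_and, holds_lt, eval_reg, h.reg_zero,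
    Atom.eval_expr, holds_and, holds_bitP h hz (by rwa [Atom.eval_expr]), Atom.eval_expr,
    holds_sum, h.reg_four]
  refine or_congr_right (and_congr_right fun ht' => and_congr_right fun _ =>
    exists_congr fun y => and_congr_right fun hy => ?_)
  have hzu : z.up.val σ (y :: ρ) < Λ.N := by rwa [Atom.val_up]
  have htu : t.up.val σ (y :: ρ) < Λ.L := by rwa [Atom.val_up]
  have hyu : (Atom.var 0).val σ (y :: ρ) < Λ.N := hy
  have e1 : (add t.up.expr (lit 1)).eval O σ (y :: ρ) = t.val σ ρ + 1 := by
    rw [eval_add, Atom.eval_expr, eval_lit, Atom.val_up]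
  rw [holds_and, holds_and, holds_and, holds_and, holds_not, holds_imp, holds_imp, holds_or,
    holds_not, holds_get, eval_var_zero, hT y hy, holds_get, eval_var_zero, hX y hy,
    holds_eqPE h hzu hyu, holds_eqFE h hzu hyu, holds_bodyE h hyu htu, holds_eq, holds_eq,
    eval_get, h.kind, eval_lit, eval_reg, h7, Atom.eval_expr,
    holds_bitS h hyu (by rw [e1]; omega), e1, Atom.val_up, Atom.val_up, Atom.val_var_zero]

theorem holds_serveE {x z t : Atom} (hx : x.val σ ρ < Λ.N) (hz : z.val σ ρ < Λ.N)
    (ht : t.val σ ρ < Λ.L + 1) :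
    (serveE x z t).Holds O σ ρ ↔ Λ.Serve T X t₀ (x.val σ ρ) (z.val σ ρ) (t.val σ ρ) := by
  rw [serveE, holds_sum, h.reg_four]
  refine exists_congr fun y => and_congr_right fun hy => ?_
  have hxu : x.up.val σ (y :: ρ) < Λ.N := by rwa [Atom.val_up]
  have hzu : z.up.val σ (y :: ρ) < Λ.N := by rwa [Atom.val_up]
  have htu : t.up.val σ (y :: ρ) < Λ.L + 1 := by rwa [Atom.val_up]
  have hyu : (Atom.var 0).val σ (y :: ρ) < Λ.N := hy
  rw [holds_and, holds_and, holds_linkE h hzu hyu, holds_compE h hyu,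
    holds_hitE h hT hX h7 hxu hyu htu, Atom.val_up, Atom.val_up, Atom.val_up, Atom.val_var_zero]

theorem holds_extendE {i : ℕ} (hi : i < l.length) (h6 : σ.reg 6 = i) (h10 : σ.reg 10 < Λ.N)
    {Y : Set ℕ} (hY : ∀ x < Λ.N, σ.arr 11 x ≠ 0 ↔ x ∈ Y) :
    extendE.Holds O σ [] ↔ σ.reg 10 ∈ Λ.extend T X t₀ l[i] Y := by
  rw [extendE, holds_sum, h.reg_four]
  refine exists_congr fun y => and_congr_right fun hy => ?_
  have hx1 : (Atom.reg 10).val σ [y] < Λ.N := h10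
  have hy1 : (Atom.var 0).val σ [y] < Λ.N := hy
  rw [holds_and, holds_and, holds_and, holds_and, holds_get, eval_var_zero, hY y hy,
    holds_eqSE h hx1 hy1, holds_eqFE h hx1 hy1, holds_eqPE h hx1 hy1, holds_sum, h.reg_four,
    Atom.val_var_zero, Atom.val_reg]
  refine and_congr_right fun _ => and_congr_right fun _ => and_congr_right fun _ =>
    and_congr_right fun _ => exists_congr fun z => and_congr_right fun hz => ?_
  have hx2 : (Atom.reg 10).val σ [z, y] < Λ.N := h10
  have hz2 : (Atom.var 0).val σ [z, y] < Λ.N := hz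
  rw [holds_and, holds_and, holds_and, holds_eqSE h hx2 hz2, holds_compE h hz2, holds_all,
    h.reg_two, Atom.val_var_zero, Atom.val_reg, profileE, holds_all, h.reg_two]
  refine and_congr_right fun _ => and_congr ?_ (and_congr_right fun _ => ?_)
  · refine forall₂_congr fun t ht => ?_
    have hz3 : (Atom.var 1).val σ [t, z, y] < Λ.N := hz
    rw [holds_iff, holds_bitP h hz3 (by exact ht), eval_var_zero, holds_get, eval_add,
      eval_get, eval_get,
      eval_reg, h6, h.list i hi, eval_var_zero,
      h.bit _ (h.lt _ (List.getElem_mem hi)) _ (by omega)]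
    rfl
  · refine forall₂_congr fun t ht => ?_
    have hx3 : (Atom.reg 10).val σ [t, z, y] < Λ.N := h10
    have hy3 : (Atom.var 2).val σ [t, z, y] < Λ.N := hy
    have hz3 : (Atom.var 1).val σ [t, z, y] < Λ.N := hz
    rw [holds_imp, holds_or, holds_bitD h hx3 (by exact ht), holds_bitD h hy3 (by exact ht),
      holds_serveE h hT hX h7 hx3 hz3 (by exact ht), eval_var_zero, Atom.val_var_zero, Atom.val_reg]
    rfl

omit hX in
theorem holds_reachE (h10 : σ.reg 10 < Λ.N) (ht₀ : t₀ < Λ.L + 1)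
    (hY : ∀ x < Λ.N, σ.arr 11 x ≠ 0 ↔ x ∈ Λ.cover T X t₀ l) :
    reachE.Holds O σ [] ↔ σ.reg 10 ∈ Λ.reach l T t₀ X := by
  have hx0 : (Atom.reg 10).val σ [] < Λ.N := h10
  rw [reachE, holds_and, holds_and, holds_get, eval_reg, hT _ h10,
    holds_obligedE h hx0 (by rw [Atom.val_reg, h7]; exact ht₀), holds_sum, h.reg_four,
    Atom.val_reg, Atom.val_reg, h7, Shape.reach, Set.mem_ofPred_eq, and_iff_right h10]
  refine and_congr_right fun _ => and_congr_right fun _ => exists_congr fun y =>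
    and_congr_right fun hy => ?_
  have hx1 : (Atom.reg 10).val σ [y] < Λ.N := h10
  have hy1 : (Atom.var 0).val σ [y] < Λ.N := hy
  rw [holds_and, holds_and, holds_and, holds_and, holds_get, eval_var_zero, hY y hy,
    holds_eqSE h hx1 hy1, holds_eqFE h hx1 hy1, holds_eqPE h hx1 hy1, holds_all, h.reg_two,
    Atom.val_var_zero, Atom.val_reg]
  refine and_congr_right fun _ => and_congr_right fun _ => and_congr_right fun _ =>
    and_congr_right fun _ => forall₂_congr fun t ht => ?_
  have hx2 : (Atom.reg 10).val σ [t, y] < Λ.N := h10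
  have hy2 : (Atom.var 1).val σ [t, y] < Λ.N := hy
  rw [holds_imp, holds_obligedE h hx2 (by exact ht), holds_bitD h hy2 (by exact ht), eval_var_zero,
    Atom.val_var_zero, Atom.val_reg]
  rfl

omit hX in
theorem holds_sieveE (h10 : σ.reg 10 < Λ.N) (ht₀ : t₀ < Λ.L + 1)
    (hX : ∀ x < Λ.N, σ.arr 10 x ≠ 0 ↔ x ∈ (Λ.reach l T t₀)^[Λ.N] ∅) :
    sieveE.Holds O σ [] ↔ σ.reg 10 ∈ Λ.sieve l T t₀ := by
  have hx0 : (Atom.reg 10).val σ [] < Λ.N := h10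
  rw [sieveE, holds_and, holds_imp, holds_get, holds_get, eval_reg, hT _ h10, hX _ h10,
    holds_obligedE h hx0 (by rw [Atom.val_reg, h7]; exact ht₀), Atom.val_reg, Atom.val_reg, h7]
  rfl

end Spec

end Formulas

/-! ### The elimination as a command -/

section Elimination

open MixedRST.Expr Cmd

/-- For all codes `x` (in register `10`) at once, set entry `x` of array `a` to `e`. The values are
collected in array `8` first, as `e` may depend on array `a`. -/
def tab (a : ℕ) (e : Expr) : Cmd :=
  .seq (.loop 10 4 (.put 8 (.reg 10) e)) (.loop 10 4 (.put a (.reg 10) (.get 8 (.reg 10))))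

/-- Replaces the set in array `10` by its image under `Shape.reach`. -/
def reachC : Cmd := .seq (tab 11 startE) (.seq (.loop 6 5 (tab 11 extendE)) (tab 10 reachE))

/-- Replaces the set in array `9` by its image under `Shape.sieve`. -/
def sieveC : Cmd := .seq (tab 10 (.lit 0)) (.seq (.loop 9 4 reachC) (tab 9 sieveE))

/-- The elimination procedure: in the end, array `9` holds the set of survivors. -/
def eliminate : Cmd := .seq (tab 9 (consE (.reg 10))) (.loop 8 4 (.loop 7 2 sieveC))

variable {O : ℕ → ℕ → ℕ} {Λ : Shape} {l : List ℕ} {σ : Store}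

theorem run_tab {a : ℕ} (ha : 9 ≤ a) {e : Expr} {Y : Set ℕ} (h : Ready Λ l σ)
    (he : ∀ τ, Ready Λ l τ → (∀ r ≠ 10, τ.reg r = σ.reg r) → (∀ b ≠ 8, τ.arr b = σ.arr b) →
      τ.reg 10 < Λ.N → (e.Holds O τ [] ↔ τ.reg 10 ∈ Y)) :
    Ready Λ l ((tab a e).run O σ) ∧ (∀ r ≠ 10, ((tab a e).run O σ).reg r = σ.reg r) ∧
      (∀ b ≠ 8, b ≠ a → ((tab a e).run O σ).arr b = σ.arr b) ∧
      ∀ x < Λ.N, ((tab a e).run O σ).arr a x ≠ 0 ↔ x ∈ Y := by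
  have ready : ∀ τ : Store, (∀ r ≠ 10, τ.reg r = σ.reg r) →
      (∀ b ≠ 8, b ≠ a → τ.arr b = σ.arr b) → Ready Λ l τ := fun τ h1 h2 =>
    h.congr (fun r hr => h1 r (by omega)) fun b hb => h2 b (by omega) (by omega)
  set σ₁ := (Cmd.loop 10 4 (.put 8 (.reg 10) e)).run O σ with hσ₁
  have h1 : (∀ r ≠ 10, σ₁.reg r = σ.reg r) ∧ (∀ b ≠ 8, σ₁.arr b = σ.arr b) ∧
      ∀ x < σ.reg 4, σ₁.arr 8 x ≠ 0 ↔ x ∈ Y := by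
    refine run_loop O (i := 10) (n := 4) (c := .put 8 (.reg 10) e) (by simp [targets]) (σ := σ)
      (fun k τ => (∀ r ≠ 10, τ.reg r = σ.reg r) ∧ (∀ b ≠ 8, τ.arr b = σ.arr b) ∧
      ∀ x < k, τ.arr 8 x ≠ 0 ↔ x ∈ Y) ⟨fun r hr => Store.setReg_reg_of_ne _ _ hr, fun _ _ => rfl,
        fun x hx => by omega⟩ ?_
    rintro k hk τ ⟨k1, k2, k3⟩ hτ
    refine ⟨fun r hr => ?_, fun b hb => ?_, fun x hx => ?_⟩
    · rw [Store.setReg_reg_of_ne _ _ hr, ← k1 r hr]; rfl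
    · rw [Store.setReg_arr, run, Store.setArr_arr_of_ne _ _ _ hb, k2 b hb]
    · rw [Store.setReg_arr, run, Store.setArr_arr, eval_reg, hτ]
      by_cases hxk : x = k
      · subst hxk
        have := he τ (ready τ k1 fun b hb _ => k2 b hb) k1 k2 (by rw [hτ, ← h.reg_four]; exact hk)
        rw [hτ] at this
        simpa [Holds] using this
      · simp only [hxk, and_false, if_false]
        exact k3 x (by omega)
  rw [h.reg_four] at h1
  obtain ⟨k1, k2, k3⟩ := h1
  have h2 : (∀ r ≠ 10, ((tab a e).run O σ).reg r = σ.reg r) ∧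
      (∀ b ≠ 8, b ≠ a → ((tab a e).run O σ).arr b = σ.arr b) ∧
      ((tab a e).run O σ).arr 8 = σ₁.arr 8 ∧
      ∀ x < σ₁.reg 4, ((tab a e).run O σ).arr a x = σ₁.arr 8 x := by
    refine run_loop O (i := 10) (n := 4) (c := .put a (.reg 10) (.get 8 (.reg 10)))
      (by simp [targets]) (σ := σ₁)
      (fun k τ => (∀ r ≠ 10, τ.reg r = σ.reg r) ∧ (∀ b ≠ 8, b ≠ a → τ.arr b = σ.arr b) ∧
      τ.arr 8 = σ₁.arr 8 ∧ ∀ x < k, τ.arr a x = σ₁.arr 8 x)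
      ⟨fun r hr => by rw [Store.setReg_reg_of_ne _ _ hr, k1 r hr], fun b hb _ => k2 b hb, rfl,
        fun x hx => by omega⟩ ?_
    rintro k hk τ ⟨l1, l2, l3, l4⟩ hτ
    refine ⟨fun r hr => ?_, fun b hb hb' => ?_, ?_, fun x hx => ?_⟩
    · rw [Store.setReg_reg_of_ne _ _ hr, ← l1 r hr]; rfl
    · rw [Store.setReg_arr, run, Store.setArr_arr_of_ne _ _ _ hb', l2 b hb hb']
    · rw [Store.setReg_arr, run, Store.setArr_arr_of_ne _ _ _ (by omega), l3]
    · rw [Store.setReg_arr, run, Store.setArr_arr, eval_get, eval_reg, hτ, l3]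
      by_cases hxk : x = k
      · simp [hxk]
      · simp only [hxk, and_false, if_false]
        exact l4 x (by omega)
  rw [k1 4 (by omega), h.reg_four] at h2
  exact ⟨ready _ h2.1 h2.2.1, h2.1, h2.2.1, fun x hx => by rw [h2.2.2.2 x hx, k3 x hx]⟩

/-- The state of the elimination: array `9` holds `T`, array `10` holds `X`, and register `7` holds
the current obligation `t₀`. -/
structure Stage (Λ : Shape) (l : List ℕ) (T X : Set ℕ) (t₀ : ℕ) (σ : Store) : Prop where
  ready : Ready Λ l σ
  arr_nine : ∀ x < Λ.N, σ.arr 9 x ≠ 0 ↔ x ∈ T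
  arr_ten : ∀ x < Λ.N, σ.arr 10 x ≠ 0 ↔ x ∈ X
  reg_seven : σ.reg 7 = t₀

variable {T X : Set ℕ} {t₀ : ℕ}

theorem Stage.setReg (h : Stage Λ l T X t₀ σ) {r : ℕ} (hr : 6 ≤ r) (hr' : r ≠ 7) (v : ℕ) :
    Stage Λ l T X t₀ (σ.setReg r v) where
  ready := h.ready.congr (fun s hs => Store.setReg_reg_of_ne _ _ (by omega)) fun _ _ => rfl
  arr_nine := h.arr_nine
  arr_ten := h.arr_ten
  reg_seven := by rw [Store.setReg_reg_of_ne _ _ hr'.symm, h.reg_seven]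

theorem run_reachC (h : Stage Λ l T X t₀ σ) (ht₀ : t₀ < Λ.L + 1) :
    Stage Λ l T (Λ.reach l T t₀ X) t₀ (reachC.run O σ) ∧ (reachC.run O σ).reg 9 = σ.reg 9 := by
  obtain ⟨a1, a2, a3, a4⟩ := run_tab (O := O) (a := 11) (by omega) (e := startE) (Y := Λ.start)
    h.ready fun τ hτ _ _ hx => by
      rw [startE, holds_all, hτ.reg_two]
      refine forall₂_congr fun t ht => ?_
      rw [holds_not, holds_bitD hτ (by exact hx) (by exact ht)]
      rfl
  set σ₁ := (tab 11 startE).run O σ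
  have s1 : Stage Λ l T X t₀ σ₁ := ⟨a1, by rw [a3 9 (by omega) (by omega)]; exact h.arr_nine,
    by rw [a3 10 (by omega) (by omega)]; exact h.arr_ten, by rw [a2 7 (by omega), h.reg_seven]⟩
  set σ₂ := (Cmd.loop 6 5 (tab 11 extendE)).run O σ₁ with hσ₂
  have s2 : Stage Λ l T X t₀ σ₂ ∧ σ₂.reg 9 = σ₁.reg 9 ∧
      ∀ x < Λ.N, σ₂.arr 11 x ≠ 0 ↔ x ∈ Λ.cover T X t₀ (l.take (σ₁.reg 5)) := by
    refine run_loop O (i := 6) (n := 5) (c := tab 11 extendE) (by simp [targets, tab]) (σ := σ₁)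
      (fun k τ => Stage Λ l T X t₀ τ ∧ τ.reg 9 = σ₁.reg 9 ∧
        ∀ x < Λ.N, τ.arr 11 x ≠ 0 ↔ x ∈ Λ.cover T X t₀ (l.take k))
      ⟨s1.setReg le_rfl (by omega) _, rfl, a4⟩ ?_
    rintro k hk τ ⟨t1, t2, t3⟩ h6
    rw [s1.ready.reg_five] at hk
    obtain ⟨b1, b2, b3, b4⟩ := run_tab (O := O) (a := 11) (by omega) (e := extendE)
      (Y := Λ.extend T X t₀ l[k] (Λ.cover T X t₀ (l.take k))) t1.ready fun υ hυ u1 u2 hx =>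
        holds_extendE hυ (by rw [u2 9 (by omega)]; exact t1.arr_nine)
          (by rw [u2 10 (by omega)]; exact t1.arr_ten) ((u1 7 (by omega)).trans t1.reg_seven) hk
          ((u1 6 (by omega)).trans h6) hx (by rw [u2 11 (by omega)]; exact t3)
    refine ⟨Stage.setReg ⟨b1, by rw [b3 9 (by omega) (by omega)]; exact t1.arr_nine,
      by rw [b3 10 (by omega) (by omega)]; exact t1.arr_ten,
      by rw [b2 7 (by omega), t1.reg_seven]⟩ le_rfl (by omega) _, ?_, ?_⟩
    · rw [Store.setReg_reg_of_ne _ _ (by omega), b2 9 (by omega), t2]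
    · rw [List.take_succ_eq_append_getElem hk, Shape.cover, List.foldl_append]
      exact b4
  obtain ⟨s2, s3, s4⟩ := s2
  rw [s1.ready.reg_five, List.take_length] at s4
  obtain ⟨c1, c2, c3, c4⟩ := run_tab (O := O) (a := 10) (by omega) (e := reachE)
    (Y := Λ.reach l T t₀ X) s2.ready fun υ hυ u1 u2 hx =>
      holds_reachE hυ (by rw [u2 9 (by omega)]; exact s2.arr_nine)
        ((u1 7 (by omega)).trans s2.reg_seven) hx ht₀ (by rw [u2 11 (by omega)]; exact s4)
  refine ⟨⟨c1, ?_, c4, ?_⟩, ?_⟩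
  · rw [show reachC.run O σ = (tab 10 reachE).run O σ₂ from rfl, c3 9 (by omega) (by omega)]
    exact s2.arr_nine
  · exact (c2 7 (by omega)).trans s2.reg_seven
  · exact (c2 9 (by omega)).trans (s3.trans (a2 9 (by omega)))

theorem run_sieveC (h : Stage Λ l T X t₀ σ) (ht₀ : t₀ < Λ.L + 1) :
    ∃ X', Stage Λ l (Λ.sieve l T t₀) X' t₀ (sieveC.run O σ) := by
  obtain ⟨a1, a2, a3, a4⟩ := run_tab (O := O) (a := 10) (by omega) (e := .lit 0) (Y := ∅)
    h.ready fun τ _ _ _ _ => by simp [Holds, eval]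
  set σ₁ := (tab 10 (.lit 0)).run O σ
  have s1 : Stage Λ l T ∅ t₀ σ₁ := ⟨a1, by rw [a3 9 (by omega) (by omega)]; exact h.arr_nine,
    a4, by rw [a2 7 (by omega), h.reg_seven]⟩
  have s2 := run_loop O (i := 9) (n := 4) (c := reachC) (by decide) (σ := σ₁)
    (fun k τ => Stage Λ l T ((Λ.reach l T t₀)^[k] ∅) t₀ τ) (s1.setReg (by omega) (by omega) _)
    fun k hk τ hτ _ => by
      rw [Function.iterate_succ_apply']
      exact (run_reachC hτ ht₀).1.setReg (by omega) (by omega) _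
  set σ₂ := (Cmd.loop 9 4 reachC).run O σ₁
  rw [a1.reg_four] at s2
  obtain ⟨c1, c2, c3, c4⟩ := run_tab (O := O) (a := 9) (by omega) (e := sieveE)
    (Y := Λ.sieve l T t₀) s2.ready fun υ hυ u1 u2 hx =>
      holds_sieveE hυ (by rw [u2 9 (by omega)]; exact s2.arr_nine)
        ((u1 7 (by omega)).trans s2.reg_seven) hx ht₀ (by rw [u2 10 (by omega)]; exact s2.arr_ten)
  refine ⟨(Λ.reach l T t₀)^[Λ.N] ∅, c1, c4, ?_, (c2 7 (by omega)).trans s2.reg_seven⟩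
  rw [show sieveC.run O σ = (tab 9 sieveE).run O σ₂ from rfl, c3 10 (by omega) (by omega)]
  exact s2.arr_ten

theorem run_eliminate (h : Ready Λ l σ) : Ready Λ l (eliminate.run O σ) ∧
    ∀ x < Λ.N, (eliminate.run O σ).arr 9 x ≠ 0 ↔ x ∈ Λ.survivors l := by
  obtain ⟨a1, a2, a3, a4⟩ := run_tab (O := O) (a := 9) (by omega) (e := consE (.reg 10))
    (Y := {x | x < Λ.N ∧ Λ.Cons x}) h fun τ hτ _ _ hx => by
      rw [holds_consE hτ (by exact hx)]
      exact (and_iff_right hx).symm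
  have s := run_loop O (i := 8) (n := 4) (c := .loop 7 2 sieveC) (by decide)
    (σ := (tab 9 (consE (.reg 10))).run O σ)
    (fun k τ => Ready Λ l τ ∧ ∀ x < Λ.N, τ.arr 9 x ≠ 0 ↔
      x ∈ (Λ.round l)^[k] {x | x < Λ.N ∧ Λ.Cons x})
    ⟨a1.congr (fun r hr => Store.setReg_reg_of_ne _ _ (by omega)) fun _ _ => rfl, a4⟩ ?_
  · rw [a1.reg_four] at s
    exact s
  rintro k - τ ⟨t1, t2⟩ -
  set T := (Λ.round l)^[k] {x | x < Λ.N ∧ Λ.Cons x}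
  have s := run_loop O (i := 7) (n := 2) (c := sieveC) (by decide) (σ := τ)
    (fun k υ => ∃ X, Stage Λ l ((List.range k).foldl (Λ.sieve l) T) X k υ)
    ⟨{x | τ.arr 10 x ≠ 0}, t1.congr (fun r hr => Store.setReg_reg_of_ne _ _ (by omega))
      fun _ _ => rfl, t2, fun _ _ => .rfl, by simp⟩ ?_
  · rw [t1.reg_two] at s
    obtain ⟨X, s⟩ := s
    rw [Function.iterate_succ_apply']
    exact ⟨s.ready.congr (fun r hr => Store.setReg_reg_of_ne _ _ (by omega)) fun _ _ => rfl,
      s.arr_nine⟩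
  rintro j hj υ ⟨X, hυ⟩ -
  rw [t1.reg_two] at hj
  obtain ⟨X', hs⟩ := run_sieveC (O := O) hυ hj
  refine ⟨X', hs.ready.congr (fun r hr => Store.setReg_reg_of_ne _ _ (by omega)) fun _ _ => rfl,
    ?_, hs.arr_ten, by simp⟩
  rw [List.range_succ, List.foldl_append]
  exact hs.arr_nine

end Elimination

open MixedRST.Expr Cmd

/-! ### Preparing the elimination -/

theorem Shape.At.of_eq {Λ Λ' : Shape} {n : ℕ} {𝒢 : Set (Set (Fin n))} {prof : Fin n → ℕ}
    (hL : Λ.L = Λ'.L) (hk : Λ.kind = Λ'.kind) (hi : Λ.idx = Λ'.idx) {ψ : Fml (Fin n) 𝒢} {t : ℕ}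
    (h : Λ.At prof ψ t) : Λ'.At prof ψ t := by
  induction ψ generalizing t with
  | prop p => exact ⟨hL ▸ h.1, hk ▸ h.2.1, hi ▸ h.2.2⟩
  | neg φ ih => exact ⟨hL ▸ h.1, hk ▸ h.2.1, ih h.2.2⟩
  | conj φ ψ ih ih' => exact ⟨hL ▸ h.1, hk ▸ h.2.1, ih h.2.2.1, ih' h.2.2.2⟩
  | know i φ ih | every G φ ih | common G φ ih =>
    exact ⟨hL ▸ h.1, hk ▸ h.2.1, h.2.2.1, ih h.2.2.2⟩

/-- Sizes into registers: `L + 1` into `2`, the number `4 * L + 2` of bits of codes into `3`, and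
`1` into `4`. -/
def sizesC : Cmd := .seq (.set 2 (.add (.reg 0) (.lit 1))) <|
  .seq (.set 3 (.add (.add (.add (.add (.reg 0) (.reg 0)) (.reg 0)) (.reg 0)) (.lit 2))) <|
  .set 4 (.lit 1)

/-- The number `N` of codes into register `4`, by repeated doubling. -/
def powerC : Cmd := .loop 6 3 (.set 4 (.add (.reg 4) (.reg 4)))

/-- Half of register `12`, rounded down: the number of `k` with `2 * k + 2 ≤ reg 12`. -/
def halfE : Expr := .sum 4 (.le (.add (.add (.var 0) (.var 0)) (.lit 2)) (.reg 12))

/-- The binary digits of register `12`, the lowest one first, into array `6` from position `reg 11`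
on. -/
def bitsRowC : Cmd := .loop 14 3 <| .seq (.set 15 halfE) <|
  .seq (.put 6 (.reg 11) (.sub (.sub (.reg 12) (.reg 15)) (.reg 15))) <|
  .seq (.set 12 (.reg 15)) (.set 11 (.add (.reg 11) (.lit 1)))

/-- The table of the bits of codes: entry `x` of array `5` tells where in array `6` the bits of `x`
begin. -/
def bitsC : Cmd := .seq (.set 11 (.lit 0)) <| .loop 10 4 <|
  .seq (.put 5 (.reg 10) (.reg 11)) <| .seq (.set 12 (.reg 10)) bitsRowC

/-- The ends of subformulas into array `7`, from right to left. -/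
def stopsC : Cmd := .loop 6 0 <| .seq (.set 14 (.sub (.sub (.reg 0) (.lit 1)) (.reg 6))) <|
  .put 7 (.reg 14) <| .ite (.get 0 (.reg 14))
    (.ite (.eq (.get 0 (.reg 14)) (.lit 2)) (.get 7 (.get 7 (.add (.reg 14) (.lit 1))))
      (.get 7 (.add (.reg 14) (.lit 1))))
    (.add (.reg 14) (.lit 1))

/-- The number of occurrences of register `13` in the list of profiles kept so far. -/
def countE : Expr := .sum 4 <| .and (.lt (.var 0) (.reg 5)) (.eq (.get 4 (.var 0)) (.reg 13))

/-- Appends the profile of agent `reg 6` to the list in array `4`, unless the list has `L + 1`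
occurrences of it. -/
def keepBodyC : Cmd := .seq (.set 13 (.get 3 (.reg 6))) <| .cond (.lt countE (.reg 2)) <|
  .seq (.put 4 (.reg 5) (.reg 13)) (.set 5 (.add (.reg 5) (.lit 1)))

/-- From the list of the profiles of all agents in array `3`, at most `L + 1` occurrences of each
profile into array `4`. -/
def keepC : Cmd := .seq (.set 5 (.lit 0)) (.loop 6 1 keepBodyC)

/-- The answer: is there a survivor at which the whole formula is true? -/
def answerC : Cmd := .set 0 <|
  .ite (.sum 4 (.and (.get 9 (.var 0)) (bitS (.var 0) (.lit 0)))) (.lit 1) (.lit 0)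

section

variable {O : ℕ → ℕ → ℕ} {σ : Store}

theorem run_sizesC : (sizesC.run O σ).reg 2 = σ.reg 0 + 1 ∧
    (sizesC.run O σ).reg 3 = 4 * σ.reg 0 + 2 ∧ (sizesC.run O σ).reg 4 = 1 ∧
    (sizesC.run O σ).arr = σ.arr := by
  refine ⟨?_, ?_, ?_, rfl⟩ <;> simp [sizesC, run, eval, Store.setReg_reg]
  omega

theorem run_powerC (h4 : σ.reg 4 = 1) : (powerC.run O σ).reg 4 = 2 ^ σ.reg 3 ∧
    (powerC.run O σ).arr = σ.arr := by
  refine run_loop O (i := 6) (n := 3) (c := .set 4 (.add (.reg 4) (.reg 4))) (by decide)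
    (fun k τ => τ.reg 4 = 2 ^ k ∧ τ.arr = σ.arr)
    ⟨by rw [Store.setReg_reg_of_ne _ _ (by omega), h4, pow_zero], rfl⟩ ?_
  rintro k - τ ⟨h1, h2⟩ -
  refine ⟨?_, h2⟩
  rw [Store.setReg_reg_of_ne _ _ (by omega), run, Store.setReg_reg_self, eval, eval, h1, pow_succ]
  omega

theorem eval_halfE (h : σ.reg 12 ≤ σ.reg 4) : halfE.eval O σ [] = σ.reg 12 / 2 := by
  have e : ∀ k, (Expr.le (.add (.add (.var 0) (.var 0)) (.lit 2)) (.reg 12)).eval O σ [k] =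
      if k + k + 2 ≤ σ.reg 12 then 1 else 0 := fun k => by rw [eval_le]; rfl
  rw [halfE, eval]
  simp only [e]
  rw [← Finset.sum_filter, Finset.sum_const, smul_eq_mul, mul_one]
  have : (Finset.range (σ.reg 4)).filter (fun k => k + k + 2 ≤ σ.reg 12) =
      Finset.range (σ.reg 12 / 2) := by
    ext k
    simp only [Finset.mem_filter, Finset.mem_range]
    omega
  rw [this, Finset.card_range]

theorem sub_div_ne_zero_iff (v j : ℕ) :
    v / 2 ^ j - v / 2 ^ (j + 1) - v / 2 ^ (j + 1) ≠ 0 ↔ v.testBit j := by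
  rw [Nat.testBit_eq_decide_div_mod_eq, pow_succ, ← Nat.div_div_eq_div_mul, decide_eq_true_iff]
  omega

theorem run_bitsRowC {x : ℕ} (h12 : σ.reg 12 = x) (hx : x ≤ σ.reg 4) :
    (bitsRowC.run O σ).reg 11 = σ.reg 11 + σ.reg 3 ∧
      (∀ a ≠ 6, (bitsRowC.run O σ).arr a = σ.arr a) ∧
      (∀ p < σ.reg 11, (bitsRowC.run O σ).arr 6 p = σ.arr 6 p) ∧
      ∀ j < σ.reg 3, (bitsRowC.run O σ).arr 6 (σ.reg 11 + j) ≠ 0 ↔ x.testBit j := by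
  have h := run_loop O (i := 14) (n := 3) (c := .seq (.set 15 halfE) <|
    .seq (.put 6 (.reg 11) (.sub (.sub (.reg 12) (.reg 15)) (.reg 15))) <|
    .seq (.set 12 (.reg 15)) (.set 11 (.add (.reg 11) (.lit 1)))) (by decide) (σ := σ)
    (fun k τ => τ.reg 4 = σ.reg 4 ∧ τ.reg 12 = x / 2 ^ k ∧ τ.reg 11 = σ.reg 11 + k ∧
      (∀ a ≠ 6, τ.arr a = σ.arr a) ∧ (∀ p < σ.reg 11, τ.arr 6 p = σ.arr 6 p) ∧
      ∀ j < k, τ.arr 6 (σ.reg 11 + j) ≠ 0 ↔ x.testBit j)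
    ⟨Store.setReg_reg_of_ne _ _ (by omega), by simp [Store.setReg_reg, h12],
      by simp [Store.setReg_reg], fun _ _ => rfl, fun _ _ => rfl, fun j hj => by omega⟩ ?_
  · exact h.2.2
  rintro k - τ ⟨t1, t2, t3, t4, t5, t6⟩ -
  have hh : halfE.eval O τ [] = x / 2 ^ (k + 1) := by
    rw [eval_halfE (by rw [t1, t2]; exact (Nat.div_le_self _ _).trans hx), t2,
      Nat.div_div_eq_div_mul,
      pow_succ]
  refine ⟨?_, ?_, ?_, fun a ha => ?_, fun p hp => ?_, fun j hj => ?_⟩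
  · simp [run, Store.setReg_reg, t1]
  · simp [run, Store.setReg_reg, eval, hh]
  · simp [run, Store.setReg_reg, eval, t3]; omega
  · simp [run, eval, Store.setArr_arr_of_ne _ _ _ ha, t4 a ha]
  · have hp' : p ≠ σ.reg 11 + k := by omega
    simp [run, eval, Store.setArr_arr, Store.setReg_reg, t3, hp', t5 p hp]
  · have e : ((Cmd.seq (.set 15 halfE) <|
        .seq (.put 6 (.reg 11) (.sub (.sub (.reg 12) (.reg 15)) (.reg 15))) <|
        .seq (.set 12 (.reg 15)) (.set 11 (.add (.reg 11) (.lit 1)))).run O τ).arr 6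
          (σ.reg 11 + j) =
        if j = k then x / 2 ^ k - x / 2 ^ (k + 1) - x / 2 ^ (k + 1) else
          τ.arr 6 (σ.reg 11 + j) := by
      simp [run, eval, Store.setArr_arr, Store.setReg_reg, t3, t2, hh]
    rw [Store.setReg_arr, e]
    split_ifs with hjk
    · rw [hjk]; exact sub_div_ne_zero_iff x k
    · exact t6 j (by omega)

theorem run_bitsC : (∀ a ≠ 5, a ≠ 6 → (bitsC.run O σ).arr a = σ.arr a) ∧
    ∀ x < σ.reg 4, ∀ j < σ.reg 3,
      (bitsC.run O σ).arr 6 ((bitsC.run O σ).arr 5 x + j) ≠ 0 ↔ x.testBit j := by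
  have h := run_loop O (i := 10) (n := 4) (c := .seq (.put 5 (.reg 10) (.reg 11)) <|
    .seq (.set 12 (.reg 10)) bitsRowC) (by decide) (σ := σ.setReg 11 0)
    (fun k τ => τ.reg 3 = σ.reg 3 ∧ τ.reg 4 = σ.reg 4 ∧
      (∀ a ≠ 5, a ≠ 6 → τ.arr a = σ.arr a) ∧
      (∀ x < k, τ.arr 5 x + σ.reg 3 ≤ τ.reg 11) ∧
      ∀ x < k, ∀ j < σ.reg 3, τ.arr 6 (τ.arr 5 x + j) ≠ 0 ↔ x.testBit j)
    ⟨by simp [Store.setReg_reg], by simp [Store.setReg_reg], fun _ _ _ => rfl,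
      fun x hx => by omega, fun x hx => by omega⟩ ?_
  · have e : (σ.setReg 11 0).reg 4 = σ.reg 4 := Store.setReg_reg_of_ne _ _ (by omega)
    rw [e] at h
    exact ⟨h.2.2.1, h.2.2.2.2⟩
  rintro k hk τ ⟨t1, t2, t3, t4, t5⟩ h10
  have hk : k < σ.reg 4 := by simpa [Store.setReg_reg] using hk
  set υ := (τ.setArr 5 k (τ.reg 11)).setReg 12 k with hυ
  have e : (Cmd.seq (.put 5 (.reg 10) (.reg 11)) <|
      .seq (.set 12 (.reg 10)) bitsRowC).run O τ = bitsRowC.run O υ := by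
    simp only [run, eval, h10, Store.setArr_reg]
    rw [hυ]
  have u3 : υ.reg 3 = σ.reg 3 := by simp [hυ, Store.setReg_reg, t1]
  have u4 : υ.reg 4 = σ.reg 4 := by simp [hυ, Store.setReg_reg, t2]
  have u11 : υ.reg 11 = τ.reg 11 := by simp [hυ, Store.setReg_reg]
  have u5 : ∀ x, υ.arr 5 x = if x = k then τ.reg 11 else τ.arr 5 x := fun x => by
    rw [hυ, Store.setReg_arr, Store.setArr_arr]; simp
  have u6 : υ.arr 6 = τ.arr 6 := by
    rw [hυ, Store.setReg_arr, Store.setArr_arr_of_ne _ _ _ (by omega)]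
  obtain ⟨r1, r2, r3, r4⟩ := run_bitsRowC (O := O) (σ := υ) (x := k) (by simp [hυ])
    (by rw [u4]; omega)
  rw [u11, u3] at r1
  rw [u11, u6] at r3
  rw [u11, u3] at r4
  rw [e]
  simp only [Store.setReg_arr]
  rw [r2 5 (by omega)]
  refine ⟨?_, ?_, fun a ha ha' => ?_, fun x hx => ?_, fun x hx j hj => ?_⟩
  · rw [Store.setReg_reg_of_ne _ _ (by omega), run_reg_of_notMem O _ (by decide), u3]
  · rw [Store.setReg_reg_of_ne _ _ (by omega), run_reg_of_notMem O _ (by decide), u4]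
  · rw [r2 a ha', hυ, Store.setReg_arr, Store.setArr_arr_of_ne _ _ _ ha, t3 a ha ha']
  · rw [Store.setReg_reg_of_ne _ _ (by omega), r1, u5]
    split_ifs with hxk
    · omega
    · have := t4 x (by omega); omega
  · rw [u5]
    split_ifs with hxk
    · rw [hxk]; exact r4 j hj
    · have := t4 x (by omega)
      rw [r3 _ (by omega)]
      exact t5 x (by omega) j hj

theorem run_stopsC {Λ : Shape} {n : ℕ} {𝒢 : Set (Set (Fin n))} {prof : Fin n → ℕ}
    (h0 : σ.reg 0 = Λ.L) (hk : σ.arr 0 = Λ.kind) :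
    (∀ a ≠ 7, (stopsC.run O σ).arr a = σ.arr a) ∧
      ∀ (ψ : Fml (Fin n) 𝒢) t, Λ.At prof ψ t → (stopsC.run O σ).arr 7 t = t + ψ.width := by
  have h := run_loop O (i := 6) (n := 0)
    (c := .seq (.set 14 (.sub (.sub (.reg 0) (.lit 1)) (.reg 6))) <|
      .put 7 (.reg 14) <| .ite (.get 0 (.reg 14))
        (.ite (.eq (.get 0 (.reg 14)) (.lit 2)) (.get 7 (.get 7 (.add (.reg 14) (.lit 1))))
          (.get 7 (.add (.reg 14) (.lit 1))))
        (.add (.reg 14) (.lit 1))) (by decide) (σ := σ)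
    (fun k τ => τ.reg 0 = Λ.L ∧ (∀ a ≠ 7, τ.arr a = σ.arr a) ∧
      ∀ (ψ : Fml (Fin n) 𝒢) t, Λ.L - k ≤ t → Λ.At prof ψ t → τ.arr 7 t = t + ψ.width)
    ⟨by rw [Store.setReg_reg_of_ne _ _ (by omega), h0], fun _ _ => rfl, fun ψ t ht hψ => by
      have := hψ.lt; omega⟩ ?_
  · rw [h0] at h
    exact ⟨h.2.1, fun ψ t => h.2.2 ψ t (by omega)⟩
  rintro k hkL τ ⟨t1, t2, t3⟩ h6
  rw [h0] at hkL
  set u := Λ.L - 1 - k with hu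
  have k0 : τ.arr 0 u = Λ.kind u := by rw [t2 0 (by omega), hk]
  have e : (Cmd.seq (.set 14 (.sub (.sub (.reg 0) (.lit 1)) (.reg 6))) <|
      .put 7 (.reg 14) <| .ite (.get 0 (.reg 14))
        (.ite (.eq (.get 0 (.reg 14)) (.lit 2)) (.get 7 (.get 7 (.add (.reg 14) (.lit 1))))
          (.get 7 (.add (.reg 14) (.lit 1))))
        (.add (.reg 14) (.lit 1))).run O τ = (τ.setReg 14 u).setArr 7 u
        (if Λ.kind u ≠ 0 then if Λ.kind u = 2 then τ.arr 7 (τ.arr 7 (u + 1)) else τ.arr 7 (u + 1)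
          else u + 1) := by
    simp only [run, eval, eval_eq, Store.setReg_reg_self, Store.setReg_arr, t1, h6, ← hu, k0]
    simp
  rw [e]
  refine ⟨?_, fun a ha => ?_, fun ψ t ht hψ => ?_⟩
  · simp [Store.setReg_reg, t1]
  · rw [Store.setReg_arr, Store.setArr_arr_of_ne _ _ _ ha, Store.setReg_arr, t2 a ha]
  rw [Store.setReg_arr, Store.setArr_arr]
  by_cases htu : t = u
  swap
  · rw [if_neg (by simp [htu])]
    exact t3 ψ t (by omega) hψ
  rw [if_pos ⟨rfl, htu⟩]
  subst htu
  have hlt := hψ.lt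
  cases ψ with
  | prop p => rw [if_neg (by simp [hψ.2.1])]; rfl
  | conj φ ψ =>
    have h1 := t3 φ (u + 1) (by omega) hψ.2.2.1
    have h2 := t3 ψ (u + 1 + φ.width) (by omega) hψ.2.2.2
    rw [if_pos (by simp [hψ.2.1]), if_pos hψ.2.1, h1, h2, Fml.width]
    omega
  | neg φ =>
    rw [if_pos (by simp [hψ.2.1]), if_neg (by simp [hψ.2.1]), t3 φ (u + 1) (by omega) hψ.2.2,
      Fml.width]
    omega
  | know i φ | every G φ | common G φ =>
    rw [if_pos (by simp [hψ.2.1]), if_neg (by simp [hψ.2.1]), t3 φ (u + 1) (by omega) hψ.2.2.2,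
      Fml.width]
    omega

theorem sum_range_ite_eq_count {N : ℕ} (f : ℕ → ℕ) (l : List ℕ) (hl : l.length ≤ N)
    (hf : ∀ i (h : i < l.length), f i = l[i]) (q : ℕ) :
    ∑ k ∈ Finset.range N, (if k < l.length then if f k = q then 1 else 0 else 0) = l.count q := by
  induction l using List.reverseRecOn with
  | nil => simp
  | append_singleton l p ih =>
    rw [List.length_append, List.length_singleton] at *
    have hp : f l.length = p := by rw [hf l.length (by simp)]; simp
    have ih := ih (by omega) fun i h => by
      rw [hf i (by simp; omega), List.getElem_append_left h]
    rw [List.count_append, ← ih]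
    have e : ∀ k, (if k < l.length + 1 then if f k = q then 1 else 0 else 0) =
        (if k < l.length then if f k = q then 1 else 0 else 0) +
          if l.length = k then [p].count q else 0 := by
      intro k
      rcases lt_trichotomy k l.length with h | h | h
      · simp [h, h.ne', h.trans (Nat.lt_succ_self _)]
      · subst h
        simp [hp, List.count_singleton]
      · have h1 : ¬ k < l.length + 1 := by omega
        have h2 : ¬ k < l.length := by omega
        simp [h1, h2, h.ne]
    simp only [e]
    rw [Finset.sum_add_distrib, Finset.sum_ite_eq, if_pos (by simp; omega)]

theorem run_keepC {L : ℕ} {l : List ℕ} (h1 : σ.reg 1 = l.length) (h2 : σ.reg 2 = L + 1)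
    (h3 : ∀ i (h : i < l.length), σ.arr 3 i = l[i])
    (hb : ∀ k, (keep (L + 1) (l.take k)).length ≤ σ.reg 4) :
    (keepC.run O σ).reg 5 = (keep (L + 1) l).length ∧
      (∀ a ≠ 4, (keepC.run O σ).arr a = σ.arr a) ∧
      ∀ i (h : i < (keep (L + 1) l).length), (keepC.run O σ).arr 4 i = (keep (L + 1) l)[i] := by
  have h := run_loop O (i := 6) (n := 1) (c := keepBodyC) (by decide) (σ := σ.setReg 5 0)
    (fun k τ => τ.reg 2 = L + 1 ∧ τ.reg 4 = σ.reg 4 ∧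
      τ.reg 5 = (keep (L + 1) (l.take k)).length ∧ (∀ a ≠ 4, τ.arr a = σ.arr a) ∧
      ∀ i (h : i < (keep (L + 1) (l.take k)).length), τ.arr 4 i = (keep (L + 1) (l.take k))[i])
    ⟨by simp [Store.setReg_reg, h2], by simp [Store.setReg_reg], by simp [Store.setReg_reg, keep],
      fun _ _ => rfl, fun i hi => by simp [keep] at hi⟩ ?_
  · have e : (σ.setReg 5 0).reg 1 = l.length := by simp [Store.setReg_reg, h1]
    rw [e, List.take_length] at h
    exact h.2.2
  rintro k hk τ ⟨t1, t2, t3, t4, t5⟩ h6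
  have hk : k < l.length := by simpa [Store.setReg_reg, h1] using hk
  have hq : τ.arr 3 k = l[k] := by rw [t4 3 (by omega), h3 k hk]
  have hcount : countE.eval O (τ.setReg 13 l[k]) [] = (keep (L + 1) (l.take k)).count l[k] := by
    rw [← sum_range_ite_eq_count (N := σ.reg 4) (τ.arr 4) _ (hb k) t5]
    simp only [countE, eval, Store.setReg_reg_of_ne τ l[k] (show 4 ≠ 13 by omega), t2]
    refine Finset.sum_congr rfl fun j _ => ?_
    rw [Expr.and, eval_ite, eval_eq]
    simp only [Expr.lt, eval, List.getD_cons_zero, Store.setReg_arr, Store.setReg_reg_self,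
      Store.setReg_reg_of_ne τ l[k] (show 5 ≠ 13 by omega), t3]
    refine if_congr ?_ rfl rfl
    omega
  have e : keepBodyC.run O τ = if (keep (L + 1) (l.take k)).count l[k] < L + 1 then
      ((τ.setReg 13 l[k]).setArr 4 (τ.reg 5) l[k]).setReg 5 (τ.reg 5 + 1) else
        τ.setReg 13 l[k] := by
    have e1 : (Expr.get 3 (.reg 6)).eval O τ [] = l[k] := by simp only [eval, h6, hq]
    have e2 : (Expr.lt countE (.reg 2)).eval O (τ.setReg 13 l[k]) [] ≠ 0 ↔
        (keep (L + 1) (l.take k)).count l[k] < L + 1 := by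
      rw [← hcount, ← t1]
      have := holds_lt (O := O) (σ := τ.setReg 13 l[k]) (ρ := []) (e := countE) (f := .reg 2)
      simpa [Holds, eval, Store.setReg_reg] using this
    rw [keepBodyC, run, run, e1, run]
    refine if_congr e2 ?_ rfl
    simp [run, eval, Store.setReg_reg]
  rw [List.take_succ_eq_append_getElem hk, keep_append_singleton, e]
  split_ifs with hc
  · refine ⟨?_, ?_, ?_, fun a ha => ?_, fun i hi => ?_⟩
    · simp [Store.setReg_reg, t1]
    · simp [Store.setReg_reg, t2]
    · simp [Store.setReg_reg, t3]
    · simp [Store.setArr_arr_of_ne _ _ _ ha, t4 a ha]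
    · rw [Store.setReg_arr, Store.setReg_arr, Store.setArr_arr, t3]
      simp only [List.length_append, List.length_singleton] at hi
      by_cases hik : i = (keep (L + 1) (l.take k)).length
      · subst hik; simp
      · rw [if_neg (by simp [hik]), List.getElem_append_left (by omega)]
        exact t5 i (by omega)
  · exact ⟨by simp [Store.setReg_reg, t1], by simp [Store.setReg_reg, t2],
      by simp [Store.setReg_reg, t3], fun a ha => t4 a ha, fun i hi => t5 i hi⟩

end

/-! ### The decision procedure -/

/-- The store holds the number of tokens of `φ`, their kinds and indices, the number of agents, and
the profiles of the agents. -/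
structure Loaded {n : ℕ} {𝒢 : Set (Set (Fin n))} (A₁ : Set (Fin n)) (prof : Fin n → ℕ) (Λ : Shape)
    (φ : Fml (Fin n) 𝒢) (σ : Store) : Prop where
  reg_zero : σ.reg 0 = Λ.L
  reg_one : σ.reg 1 = n
  kind : σ.arr 0 = Λ.kind
  idx : σ.arr 1 = Λ.idx
  prof_eq : ∀ i : Fin n, σ.arr 3 i = prof i
  prof_lt : ∀ i, prof i < 2 ^ (Λ.L + 1)
  at_zero : Λ.At prof φ 0
  exists_at : ∀ t < Λ.L, ∃ ψ : Fml (Fin n) 𝒢, Λ.At prof ψ t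
  trans_iff : ∀ i, (prof i).testBit Λ.L ↔ i ∈ A₁

/-- The decision procedure for a store as in `Loaded`. -/
def decideP : Prog :=
  sizesC.code 20 ;; powerC.code 20 ;; bitsC.code 20 ;; stopsC.code 20 ;; keepC.code 20 ;;
    eliminate.code 20 ;; answerC.code 20

/-- The coefficient in the time bound for `decideP`. -/
def decideSize : ℕ := sizesC.size + powerC.size + bitsC.size + stopsC.size +
  (keepBodyC.size + 10) + eliminate.size + answerC.size

/-- The exponent in the time bound for `decideP`. -/
def decideDeg : ℕ := sizesC.deg + powerC.deg + bitsC.deg + stopsC.deg + keepBodyC.deg +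
  eliminate.deg + answerC.deg

/-- Bounds the time of a loop over all agents. -/
theorem Cmd.time_loop_le {β : ℕ → ℕ} {B n i r : ℕ} {c : Cmd} (hB : 1 ≤ B) (hn : 0 < n)
    (hr : β r = n) (h : ∀ s ∈ c.counters, β s ≤ B) :
    (Cmd.loop i r c).time β ≤ (c.size + 7) * (n * B ^ c.deg) := by
  have h1 := c.time_le hB h
  have h2 : 1 ≤ B ^ c.deg := Nat.one_le_pow _ _ hB
  have h3 : 1 ≤ n * B ^ c.deg := one_le_mul hn h2
  rw [time, hr]
  calc 3 + n * (c.time β + 4) ≤ 3 * (n * B ^ c.deg) + n * (c.size * B ^ c.deg + 4 * B ^ c.deg) := by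
        have : n * (c.time β + 4) ≤ n * (c.size * B ^ c.deg + 4 * B ^ c.deg) :=
          Nat.mul_le_mul_left n (by omega)
        omega
    _ = (c.size + 7) * (n * B ^ c.deg) := by ring

theorem le_mul_mul_pow {a s n B d D : ℕ} (h : a ≤ s * (n * B ^ d)) (hB : 1 ≤ B) (hd : d ≤ D) :
    a ≤ s * (n * B ^ D) :=
  h.trans (Nat.mul_le_mul_left _ (Nat.mul_le_mul_left _ (Nat.pow_le_pow_right hB hd)))

theorem le_mul_mul_pow' {a s n B d D : ℕ} (h : a ≤ s * B ^ d) (hn : 0 < n) (hB : 1 ≤ B)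
    (hd : d ≤ D) : a ≤ s * (n * B ^ D) :=
  le_mul_mul_pow (h.trans (Nat.mul_le_mul_left _ (Nat.le_mul_of_pos_left _ hn))) hB hd

theorem Shape.le_N (Λ : Shape) : 4 * Λ.L + 2 ≤ Λ.N := Nat.lt_two_pow_self.le

theorem length_keep_le_N (Λ : Shape) {l : List ℕ} (hl : ∀ q ∈ l, q < 2 ^ (Λ.L + 1)) :
    (keep (Λ.L + 1) l).length ≤ Λ.N := by
  refine (length_keep_le _ _ _ hl).trans ?_
  have h1 : Λ.L + 1 ≤ 2 ^ (Λ.L + 1) := Nat.lt_two_pow_self.le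
  calc 2 ^ (Λ.L + 1) * (Λ.L + 1) ≤ 2 ^ (Λ.L + 1) * 2 ^ (Λ.L + 1) := Nat.mul_le_mul_left _ h1
    _ = 2 ^ (Λ.L + 1 + (Λ.L + 1)) := (pow_add _ _ _).symm
    _ ≤ Λ.N := Nat.pow_le_pow_right (by omega) (by omega)

open Classical in
/-- The procedure is correct and takes time linear in the number of agents, since after `keepC` at
most `N` agents are left, and polynomial in the number `N` of codes. -/
theorem runs_decideP (O : ℕ → ℕ → ℕ) {n : ℕ} (hn : 0 < n) {𝒢 : Set (Set (Fin n))}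
    {A₁ A₂ : Set (Fin n)} (hA : A₁ ∪ A₂ = Set.univ) (h𝒢 : ∀ G ∈ 𝒢, G.Nonempty) {prof : Fin n → ℕ}
    {Λ : Shape} {φ : Fml (Fin n) 𝒢} {σ : Store} (h : Loaded A₁ prof Λ φ σ) :
    ∃ τ, Runs O decideP σ (decideSize * (n * Λ.N ^ decideDeg)) τ ∧
      τ.reg 0 = if φ.SatMixedRST A₁ A₂ then 1 else 0 := by
  have hB : 1 ≤ Λ.N := Nat.one_le_two_pow
  have hW := Λ.le_N
  set l : List ℕ := List.ofFn prof with hl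
  have hllen : l.length = n := by simp [hl]
  have hlget : ∀ i (hi : i < l.length), σ.arr 3 i = l[i] := fun i hi => by
    have := h.prof_eq ⟨i, by omega⟩
    simpa [hl] using this
  have hllt : ∀ q ∈ l, q < 2 ^ (Λ.L + 1) := fun q hq => by
    obtain ⟨i, rfl⟩ := (List.mem_ofFn' _ _).1 hq
    exact h.prof_lt i
  -- sizes
  set σ₁ := sizesC.run O σ with hσ₁
  obtain ⟨a2, a3, a4, aa⟩ := run_sizesC (O := O) (σ := σ)
  rw [h.reg_zero] at a2 a3
  have ar : ∀ r, r ∉ sizesC.targets → σ₁.reg r = σ.reg r := fun r hr => run_reg_of_notMem O _ hr σ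
  obtain ⟨τ₁, r1, g1⟩ := sizesC.runs_code O (D := 20) (by omega) (by decide) (by decide)
    (Agree.refl 20 σ)
  have T1 := le_mul_mul_pow' (D := decideDeg) (sizesC.time_le (β := σ.reg) hB (by
    have : sizesC.counters = [] := by decide
    simp [this])) hn hB
    (by unfold decideDeg; omega)
  -- the number of codes
  set σ₂ := powerC.run O σ₁ with hσ₂
  obtain ⟨b4, ba⟩ := run_powerC (O := O) a4
  have br : ∀ r, r ∉ powerC.targets → σ₂.reg r = σ₁.reg r := fun r hr =>
    run_reg_of_notMem O _ hr σ₁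
  rw [a3] at b4
  obtain ⟨τ₂, r2, g2⟩ := powerC.runs_code O (D := 20) (by omega) (by decide) (by decide) g1
  have T2 := le_mul_mul_pow' (D := decideDeg) (powerC.time_le (β := σ₁.reg) hB (by
    have : powerC.counters = [3] := by decide
    simpa [this, hσ₁, a3] using hW)) hn hB (by unfold decideDeg; omega)
  -- the table of bits
  set σ₃ := bitsC.run O σ₂ with hσ₃
  obtain ⟨ca, cb⟩ := run_bitsC (O := O) (σ := σ₂)
  have cr : ∀ r, r ∉ bitsC.targets → σ₃.reg r = σ₂.reg r := fun r hr =>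
    run_reg_of_notMem O _ hr σ₂
  have σ₂4 : σ₂.reg 4 = Λ.N := b4
  have σ₂3 : σ₂.reg 3 = 4 * Λ.L + 2 := (br 3 (by decide)).trans a3
  rw [σ₂4, σ₂3] at cb
  obtain ⟨τ₃, r3, g3⟩ := bitsC.runs_code O (D := 20) (by omega) (by decide) (by decide) g2
  have T3 := le_mul_mul_pow' (D := decideDeg) (bitsC.time_le (β := σ₂.reg) hB (fun r hr => by
    have : r = 3 ∨ r = 4 := (by decide : ∀ r ∈ bitsC.counters, r = 3 ∨ r = 4) r hr
    rcases this with rfl | rfl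
    · rw [σ₂3]; exact hW
    · rw [σ₂4])) hn hB (by unfold decideDeg; omega)
  -- the ends of subformulas
  set σ₄ := stopsC.run O σ₃ with hσ₄
  have σ₃0 : σ₃.reg 0 = Λ.L := by
    rw [cr 0 (by decide), br 0 (by decide), ar 0 (by decide), h.reg_zero]
  have σ₃a0 : σ₃.arr 0 = Λ.kind := by
    rw [ca 0 (by omega) (by omega), ba, aa, h.kind]
  obtain ⟨da, dt⟩ := run_stopsC (O := O) (𝒢 := 𝒢) (prof := prof) σ₃0 σ₃a0
  have dr : ∀ r, r ∉ stopsC.targets → σ₄.reg r = σ₃.reg r := fun r hr =>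
    run_reg_of_notMem O _ hr σ₃
  obtain ⟨τ₄, r4, g4⟩ := stopsC.runs_code O (D := 20) (by omega) (by decide) (by decide) g3
  have T4 := le_mul_mul_pow' (D := decideDeg) (stopsC.time_le (β := σ₃.reg) hB (by
    have : stopsC.counters = [0] := by decide
    rw [this]
    simp only [List.mem_singleton, forall_eq, σ₃0]
    omega)) hn hB (by unfold decideDeg; omega)
  -- the list of profiles
  set σ₅ := keepC.run O σ₄ with hσ₅
  have σ₄1 : σ₄.reg 1 = n := by
    rw [dr 1 (by decide), cr 1 (by decide), br 1 (by decide), ar 1 (by decide), h.reg_one]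
  have σ₄2 : σ₄.reg 2 = Λ.L + 1 := by
    rw [dr 2 (by decide), cr 2 (by decide), br 2 (by decide), a2]
  have σ₄4 : σ₄.reg 4 = Λ.N := by rw [dr 4 (by decide), cr 4 (by decide), σ₂4]
  have σ₄a : ∀ a ≠ 5, a ≠ 6 → a ≠ 7 → σ₄.arr a = σ.arr a := fun a h5 h6 h7 => by
    rw [da a h7, ca a h5 h6, ba, aa]
  obtain ⟨e5, ea, el⟩ := run_keepC (O := O) (l := l) (σ := σ₄) (L := Λ.L)
    (by rw [σ₄1, hllen]) σ₄2
    (fun i hi => by rw [σ₄a 3 (by omega) (by omega) (by omega)]; exact hlget i hi)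
    (fun k => by
      rw [σ₄4]
      exact length_keep_le_N Λ fun q hq => hllt q (List.mem_of_mem_take hq))
  have er : ∀ r, r ∉ keepC.targets → σ₅.reg r = σ₄.reg r := fun r hr =>
    run_reg_of_notMem O _ hr σ₄
  obtain ⟨τ₅, r5, g5⟩ := keepC.runs_code O (D := 20) (by omega) (by decide) (by decide) g4
  have T5 : keepC.time σ₄.reg ≤ (keepBodyC.size + 10) * (n * Λ.N ^ decideDeg) := by
    refine le_mul_mul_pow (d := keepBodyC.deg) ?_ hB (by unfold decideDeg; omega)
    have h1 := Cmd.time_loop_le (i := 6) (c := keepBodyC) hB hn σ₄1 (by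
      have : keepBodyC.counters = [4] := by decide
      rw [this]
      simp [σ₄4])
    have h2 : 1 ≤ n * Λ.N ^ keepBodyC.deg := one_le_mul hn (Nat.one_le_pow _ _ hB)
    have h3 : keepC.time σ₄.reg = 3 + (Cmd.loop 6 1 keepBodyC).time σ₄.reg := rfl
    rw [h3]
    rw [add_mul] at h1 ⊢
    omega
  -- the elimination
  set Λ' : Shape := ⟨Λ.L, Λ.kind, Λ.idx, σ₅.arr 7⟩ with hΛ'
  have hd : Λ'.Describes 𝒢 prof A₁ := by
    refine ⟨fun t ht => ?_, fun ψ t hψ => ?_, h.trans_iff, h𝒢⟩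
    · obtain ⟨ψ, hψ⟩ := h.exists_at t ht
      exact ⟨ψ, Shape.At.of_eq (Λ := Λ) (Λ' := Λ') rfl rfl rfl hψ⟩
    · rw [hΛ']
      simp only
      rw [ea 7 (by omega)]
      exact dt ψ t (Shape.At.of_eq (Λ := Λ') (Λ' := Λ) rfl rfl rfl hψ)
  have ready : Ready Λ' (keep (Λ'.L + 1) l) σ₅ := by
    refine ⟨?_, ?_, ?_, e5, ?_, ?_, rfl, el, fun q hq => ?_, ?_, fun t ht h2 => ?_⟩
    · rw [er 0 (by decide), dr 0 (by decide), σ₃0]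
    · rw [er 2 (by decide), σ₄2]
    · rw [er 4 (by decide), σ₄4]; rfl
    · rw [ea 0 (by omega), da 0 (by omega), σ₃a0]
    · rw [ea 1 (by omega), σ₄a 1 (by omega) (by omega) (by omega), h.idx]
    · have hq' : q ∈ l := by
        have := List.count_pos_iff.2 hq
        rw [count_keep] at this
        exact List.count_pos_iff.1 (by omega)
      exact (hllt q hq').trans_le (Nat.pow_le_pow_right (by omega)
        (by show Λ.L + 1 ≤ 4 * Λ.L + 2; omega))
    · rw [ea 6 (by omega), ea 5 (by omega), da 6 (by omega), da 5 (by omega)]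
      exact cb
    · obtain ⟨ψ, hψ⟩ := hd.exists_at t ht
      cases ψ with
      | prop | neg | know | every | common => have := hψ.2.1; omega
      | conj φ ψ =>
        rw [hd.stop_eq φ _ hψ.2.2.1]
        have := hψ.2.2.2.lt
        omega
  set σ₆ := eliminate.run O σ₅ with hσ₆
  obtain ⟨f1, f2⟩ := run_eliminate (O := O) ready
  obtain ⟨τ₆, r6, g6⟩ := eliminate.runs_code O (D := 20) (by omega) (by decide) (by decide) g5
  have hlen : σ₅.reg 5 ≤ Λ.N := by rw [e5]; exact length_keep_le_N Λ hllt
  have T6 := le_mul_mul_pow' (D := decideDeg) (eliminate.time_le (β := σ₅.reg) hB (fun r hr => by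
    have : r = 0 ∨ r = 2 ∨ r = 4 ∨ r = 5 :=
      (by decide : ∀ r ∈ eliminate.counters, r = 0 ∨ r = 2 ∨ r = 4 ∨ r = 5) r hr
    have h0 : σ₅.reg 0 = Λ.L := ready.reg_zero
    have h2 : σ₅.reg 2 = Λ.L + 1 := ready.reg_two
    have h4 : σ₅.reg 4 = Λ.N := ready.reg_four
    rcases this with rfl | rfl | rfl | rfl <;> omega)) hn hB (by unfold decideDeg; omega)
  -- the answer
  obtain ⟨τ₇, r7, g7⟩ := answerC.runs_code O (D := 20) (by omega) (by decide) (by decide) g6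
  have T7 := le_mul_mul_pow' (D := decideDeg) (answerC.time_le (β := σ₆.reg) hB (by
    have : answerC.counters = [4] := by decide
    rw [this]
    simp only [List.mem_singleton, forall_eq, hσ₆, f1.reg_four]
    exact le_rfl)) hn hB (by unfold decideDeg; omega)
  refine ⟨τ₇, (r1.seq (r2.seq (r3.seq (r4.seq (r5.seq (r6.seq r7)))))).mono ?_, ?_⟩
  · exact (Nat.add_le_add T1 (Nat.add_le_add T2 (Nat.add_le_add T3 (Nat.add_le_add T4
      (Nat.add_le_add T5 (Nat.add_le_add T6 T7)))))).trans (le_of_eq (by unfold decideSize; ring))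
  · rw [g7.1 0 (by omega), answerC, run, Store.setReg_reg_self, eval_ite]
    simp only [eval_lit]
    refine if_congr ?_ rfl rfl
    rw [Shape.sat_iff_exists_survivor hd hA hn
      (Shape.At.of_eq (Λ := Λ) (Λ' := Λ') rfl rfl rfl h.at_zero)]
    refine (holds_sum (O := O) (σ := σ₆) (ρ := [])).trans ?_
    rw [f1.reg_four]
    constructor
    · rintro ⟨x, hx, hx'⟩
      rw [holds_and, holds_get, eval_var_zero, f2 x hx, holds_bitS f1 (by exact hx)
        (by rw [eval_lit]; omega)] at hx'
      exact ⟨x, hx'⟩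
    · rintro ⟨x, hx, hS⟩
      have hxN := (Shape.survivors_subset _ hx).1
      refine ⟨x, hxN, ?_⟩
      rw [holds_and, holds_get, eval_var_zero, f2 x hxN, holds_bitS f1 (by exact hxN)
        (by rw [eval_lit]; omega)]
      exact ⟨hx, hS⟩

/-! ### The profiles of the agents -/

/-- The number with binary digits `b, f 0, f 1, …, f (k - 1)`, the most significant one first. -/
def digits (b : ℕ) (f : ℕ → ℕ) : ℕ → ℕ
  | 0 => b
  | k + 1 => 2 * digits b f k + f k

section digits

variable {b : ℕ} {f : ℕ → ℕ}

theorem digits_lt (hb : b ≤ 1) (hf : ∀ k, f k ≤ 1) (k : ℕ) : digits b f k < 2 ^ (k + 1) := by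
  induction k with
  | zero => simp [digits]; omega
  | succ k ih => have := hf k; rw [digits, pow_succ]; omega

theorem testBit_digits_self (hb : b ≤ 1) (hf : ∀ k, f k ≤ 1) (k : ℕ) :
    (digits b f k).testBit k ↔ b = 1 := by
  induction k with
  | zero => simp [digits]; omega
  | succ k ih =>
    have := hf k
    rw [digits, Nat.testBit_succ, show (2 * digits b f k + f k) / 2 = digits b f k by omega, ih]

theorem testBit_digits (hf : ∀ k, f k ≤ 1) {k j : ℕ} (hj : j < k) :
    (digits b f k).testBit j ↔ f (k - 1 - j) = 1 := by
  induction k generalizing j with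
  | zero => omega
  | succ k ih =>
    have := hf k
    cases j with
    | zero =>
      rw [digits, Nat.testBit_zero, Nat.add_sub_cancel, Nat.sub_zero, decide_eq_true_eq]
      omega
    | succ j =>
      rw [digits, Nat.testBit_succ, show (2 * digits b f k + f k) / 2 = digits b f k by omega,
        ih (by omega), show k + 1 - 1 - (j + 1) = k - 1 - j by omega]

end digits

theorem Fml.length_tokens {n : ℕ} {𝒢 : Set (Set (Fin n))} (name : 𝒢 → ℕ) (φ : Fml (Fin n) 𝒢) :
    (φ.tokens name).length = φ.width := by
  induction φ <;> simp_all [tokens, width]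

theorem Fml.snd_lt_of_mem_tokens {n : ℕ} {𝒢 : Set (Set (Fin n))} {name : 𝒢 → ℕ}
    {φ : Fml (Fin n) 𝒢} {x : ℕ × ℕ} (hx : x ∈ φ.tokens name) (h3 : x.1 = 3) : x.2 < n := by
  induction φ with
  | prop | neg | every | common => simp only [tokens, List.mem_cons] at hx; aesop
  | conj => simp only [tokens, List.mem_cons, List.mem_append] at hx; aesop
  | know i φ ih =>
    rcases List.mem_cons.1 hx with rfl | hx
    · exact i.2
    · exact ih hx

theorem Fml.snd_mem_range_of_mem_tokens {n : ℕ} {𝒢 : Set (Set (Fin n))} {name : 𝒢 → ℕ}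
    {φ : Fml (Fin n) 𝒢} {x : ℕ × ℕ} (hx : x ∈ φ.tokens name) (h4 : 4 ≤ x.1) :
    x.2 ∈ Set.range name := by
  induction φ with
  | prop | neg | every | common | know => simp only [tokens, List.mem_cons] at hx; aesop
  | conj => simp only [tokens, List.mem_cons, List.mem_append] at hx; aesop

/-- The shape of a formula, read off from its tokens. -/
def Fml.shape {n : ℕ} {𝒢 : Set (Set (Fin n))} (name : 𝒢 → ℕ) (φ : Fml (Fin n) 𝒢) : Shape where
  L := (φ.tokens name).length
  kind j := ((φ.tokens name).getD j (0, 0)).1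
  idx j := ((φ.tokens name).getD j (0, 0)).2
  finish _ := 0

section profile

variable {n : ℕ} {𝒢 : Set (Set (Fin n))} {name : 𝒢 → ℕ} {Λ : Shape} {A₁ : Set (Fin n)}

theorem memberOracle_le_one (name : 𝒢 → ℕ) (j g : ℕ) : memberOracle name j g ≤ 1 := by
  unfold memberOracle; split <;> simp

theorem memberOracle_eq_one_iff (hname : Function.Injective name) (i : Fin n) (G : 𝒢) :
    memberOracle name i (name G) = 1 ↔ i ∈ G.1 := by
  unfold memberOracle
  constructor
  · intro h
    by_contra hi
    rw [if_neg] at h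
    · exact zero_ne_one h
    · rintro ⟨j, H, hj, hH, hm⟩
      rw [Fin.ext hj, hname hH] at hm
      exact hi hm
  · intro h
    rw [if_pos ⟨i, G, rfl, rfl, h⟩]

/-- Tells (by `1` or `0`) whether agent `i` takes part in the modal operator with the given kind and
index. -/
noncomputable def involved (name : 𝒢 → ℕ) (kind idx i : ℕ) : ℕ :=
  if kind < 3 then 0 else if kind = 3 then (if idx = i then 1 else 0) else memberOracle name i idx

theorem involved_le_one (name : 𝒢 → ℕ) (kind idx i : ℕ) : involved name kind idx i ≤ 1 := by
  unfold involved
  split_ifs <;> first | omega | exact memberOracle_le_one _ _ _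

open Classical in
/-- The profile of agent `i` after `k` steps. For `k = L` it is complete: bit `t < L` tells whether
`i` takes part in the operator at position `t`, bit `L` whether `i ∈ A₁`. Positions are processed
from right to left. -/
noncomputable def profile (A₁ : Set (Fin n)) (name : 𝒢 → ℕ) (Λ : Shape) (k : ℕ) (i : Fin n) : ℕ :=
  digits (if i ∈ A₁ then 1 else 0)
    (fun k => involved name (Λ.kind (Λ.L - 1 - k)) (Λ.idx (Λ.L - 1 - k)) i) k

theorem profile_lt (i : Fin n) : profile A₁ name Λ Λ.L i < 2 ^ (Λ.L + 1) :=
  digits_lt (by split <;> simp) (fun _ => involved_le_one _ _ _ _) _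

theorem testBit_profile_self (i : Fin n) : (profile A₁ name Λ Λ.L i).testBit Λ.L ↔ i ∈ A₁ := by
  rw [profile, testBit_digits_self (by split <;> simp) fun _ => involved_le_one _ _ _ _]
  simp

theorem testBit_profile (i : Fin n) {t : ℕ} (ht : t < Λ.L) :
    (profile A₁ name Λ Λ.L i).testBit t ↔ involved name (Λ.kind t) (Λ.idx t) i = 1 := by
  rw [profile, testBit_digits (fun _ => involved_le_one _ _ _ _) ht,
    show Λ.L - 1 - (Λ.L - 1 - t) = t by omega]

/-- A formula occurs where its tokens are. -/
theorem at_of_tokens (hname : Function.Injective name) (ψ : Fml (Fin n) 𝒢) {o : ℕ}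
    (hL : o + ψ.width ≤ Λ.L)
    (h : ∀ j (hj : j < (ψ.tokens name).length),
      (Λ.kind (o + j), Λ.idx (o + j)) = (ψ.tokens name)[j]) :
    Λ.At (profile A₁ name Λ Λ.L) ψ o := by
  have tail : ∀ {x : ℕ × ℕ} {l : List (ℕ × ℕ)} {o : ℕ},
      (∀ j (hj : j < (x :: l).length), (Λ.kind (o + j), Λ.idx (o + j)) = (x :: l)[j]) →
      (Λ.kind o = x.1 ∧ Λ.idx o = x.2) ∧
        ∀ j (hj : j < l.length), (Λ.kind (o + 1 + j), Λ.idx (o + 1 + j)) = l[j] := by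
    intro x l o h
    refine ⟨Prod.ext_iff.1 (h 0 (by simp)), fun j hj => ?_⟩
    have := h (j + 1) (by simpa using hj)
    rwa [List.getElem_cons_succ, show o + (j + 1) = o + 1 + j by omega] at this
  induction ψ generalizing o with
  | prop p => exact ⟨hL, (tail h).1⟩
  | neg φ ih =>
    simp only [Fml.width] at hL
    exact ⟨by omega, (tail h).1.1, ih (by omega) (tail h).2⟩
  | conj φ ψ ih ih' =>
    simp only [Fml.width] at hL
    have h2 := (tail h).2
    refine ⟨by omega, (tail h).1.1, ih (by omega) fun j hj => ?_, ih' (by omega) fun j hj => ?_⟩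
    · rw [h2 j (by rw [List.length_append]; omega), List.getElem_append_left hj]
    · have := h2 (φ.width + j) (by rw [List.length_append, Fml.length_tokens]; omega)
      rw [List.getElem_append_right (by rw [Fml.length_tokens]; omega)] at this
      simpa [Fml.length_tokens, add_assoc] using this
  | know i φ ih =>
    simp only [Fml.width] at hL
    refine ⟨by omega, (tail h).1.1, fun j => ?_, ih (by omega) (tail h).2⟩
    rw [testBit_profile _ (by omega), (tail h).1.1, (tail h).1.2]
    simp [involved, Fin.ext_iff, eq_comm]
  | every G φ ih | common G φ ih =>
    simp only [Fml.width] at hL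
    refine ⟨by omega, (tail h).1.1, fun j => ?_, ih (by omega) (tail h).2⟩
    rw [testBit_profile _ (by omega), (tail h).1.1, (tail h).1.2,
      ← memberOracle_eq_one_iff hname]
    simp [involved]

theorem Shape.At.exists_at {prof : Fin n → ℕ} {ψ : Fml (Fin n) 𝒢} {o : ℕ} (h : Λ.At prof ψ o)
    {t : ℕ} (ho : o ≤ t) (ht : t < o + ψ.width) : ∃ χ : Fml (Fin n) 𝒢, Λ.At prof χ t := by
  obtain rfl | ho' := ho.eq_or_lt
  · exact ⟨ψ, h⟩
  clear ho
  induction ψ generalizing o with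
  | prop p => simp only [Fml.width] at ht; omega
  | neg φ ih =>
    simp only [Fml.width] at ht
    obtain rfl | h1 := Nat.eq_or_lt_of_le ho'
    · exact ⟨φ, h.2.2⟩
    · exact ih h.2.2 (by omega) h1
  | conj φ ψ ih ih' =>
    simp only [Fml.width] at ht
    obtain rfl | h1 := Nat.eq_or_lt_of_le ho'
    · exact ⟨φ, h.2.2.1⟩
    rcases lt_trichotomy t (o + 1 + φ.width) with h2 | rfl | h2
    · exact ih h.2.2.1 h2 h1
    · exact ⟨ψ, h.2.2.2⟩
    · exact ih' h.2.2.2 (by omega) h2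
  | know i φ ih | every G φ ih | common G φ ih =>
    simp only [Fml.width] at ht
    obtain rfl | h1 := Nat.eq_or_lt_of_le ho'
    · exact ⟨φ, h.2.2.2⟩
    · exact ih h.2.2.2 (by omega) h1

theorem loaded_profile (hname : Function.Injective name) {φ : Fml (Fin n) 𝒢} {σ : Store}
    (h0 : σ.reg 0 = (φ.shape name).L) (h1 : σ.reg 1 = n) (hk : σ.arr 0 = (φ.shape name).kind)
    (hi : σ.arr 1 = (φ.shape name).idx)
    (hp : ∀ i : Fin n, σ.arr 3 i = profile A₁ name (φ.shape name) (φ.shape name).L i) :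
    Loaded A₁ (profile A₁ name (φ.shape name) (φ.shape name).L) (φ.shape name) φ σ := by
  have hL : (φ.shape name).L = φ.width := φ.length_tokens name
  have hat : (φ.shape name).At (profile A₁ name (φ.shape name) (φ.shape name).L) φ 0 := by
    refine at_of_tokens hname φ (by rw [hL]; omega) fun j hj => ?_
    simp [Fml.shape, hj]
  exact ⟨h0, h1, hk, hi, hp, profile_lt, hat,
    fun t ht => hat.exists_at (Nat.zero_le t) (by omega), testBit_profile_self⟩

end profile

/-! ### Loading the profiles with an oracle -/

/-- The entry of position `reg 15` in the profile of agent `reg 6`. -/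
def involvedE : Expr := .ite (lt (.get 0 (.reg 15)) (.lit 3)) (.lit 0) <|
  .ite (eq (.get 0 (.reg 15)) (.lit 3)) (eq (.get 1 (.reg 15)) (.reg 6))
    (.ask (.reg 6) (.get 1 (.reg 15)))

/-- Extends the profile in register `13` by one binary digit. -/
def digitC : Cmd := .seq (.set 15 (.sub (.sub (.reg 0) (.lit 1)) (.reg 14))) <|
  .set 13 (.add (.add (.reg 13) (.reg 13)) involvedE)

/-- Computes the profile of agent `reg 6`. -/
def profileC : Cmd := .seq (.set 13 (.ite (.get 2 (.reg 6)) (.lit 1) (.lit 0))) <|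
  .seq (.loop 14 0 digitC) (.put 3 (.reg 6) (.reg 13))

/-- Computes the profiles of all agents. -/
def profilesC : Cmd := .loop 6 1 profileC

section oracle

variable {n : ℕ} {𝒢 : Set (Set (Fin n))} {name : 𝒢 → ℕ} {Λ : Shape} {A₁ : Set (Fin n)}
  {σ : Store}

open Classical in
theorem run_profileC (i : Fin n) (h0 : σ.reg 0 = Λ.L) (hk : σ.arr 0 = Λ.kind)
    (hi : σ.arr 1 = Λ.idx) (h2 : σ.arr 2 i = if i ∈ A₁ then 1 else 0) (h6 : σ.reg 6 = i) :
    (profileC.run (memberOracle name) σ).arr =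
      (σ.setArr 3 i (profile A₁ name Λ Λ.L i)).arr := by
  set τ := σ.setReg 13 (if i ∈ A₁ then 1 else 0) with hτ
  have step : (Cmd.set 13 (.ite (.get 2 (.reg 6)) (.lit 1) (.lit 0))).run (memberOracle name) σ
      = τ := by
    simp [run, eval, h6, h2, hτ]
  have ht : 14 ∉ digitC.targets := by decide
  have key := run_loop (memberOracle name) ht (n := 0) (σ := τ)
    (fun (k : ℕ) (υ : Store) => υ.arr = σ.arr ∧ υ.reg 0 = Λ.L ∧ υ.reg 6 = (i : ℕ) ∧
      υ.reg 13 = profile A₁ name Λ k i) (by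
      refine ⟨rfl, ?_, ?_, ?_⟩ <;> simp [hτ, Store.setReg_reg, h0, h6, profile, digits]) (by
      rintro k - υ ⟨ha, hr0, hr6, hr13⟩ h14
      set u := Λ.L - 1 - k with hu
      have e : digitC.run (memberOracle name) υ =
          (υ.setReg 15 u).setReg 13 (profile A₁ name Λ (k + 1) i) := by
        simp only [digitC, run, involvedE, eval_eq, eval, lt, ha,
          Store.setReg_reg_self, Store.setReg_reg, Store.setReg_arr, hr0, h14, ← hu, hk, hi,
          hr6, hr13]
        congr 1
        simp only [profile, digits, involved, ← hu]
        norm_num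
        rw [two_mul]
        split_ifs <;> first | rfl | omega
      rw [e]
      refine ⟨ha, ?_, ?_, ?_⟩ <;> simp [Store.setReg_reg, hr0, hr6])
  obtain ⟨ha, -, hr6, hr13⟩ := key
  have : τ.reg 0 = Λ.L := by simp [hτ, Store.setReg_reg, h0]
  rw [this] at hr13
  rw [profileC, run, step, run, run, eval, eval, hr6, hr13]
  simp only [Store.setArr, ha]

open Classical in
theorem run_profilesC (h0 : σ.reg 0 = Λ.L) (h1 : σ.reg 1 = n) (hk : σ.arr 0 = Λ.kind)
    (hi : σ.arr 1 = Λ.idx) (h2 : ∀ i : Fin n, σ.arr 2 i = if i ∈ A₁ then 1 else 0) :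
    (∀ a ≠ 3, (profilesC.run (memberOracle name) σ).arr a = σ.arr a) ∧
    ∀ i : Fin n, (profilesC.run (memberOracle name) σ).arr 3 i = profile A₁ name Λ Λ.L i := by
  have ht : 6 ∉ profileC.targets := by decide
  have key := run_loop (memberOracle name) ht (n := 1) (σ := σ)
    (fun (k : ℕ) (υ : Store) => υ.reg 0 = Λ.L ∧ (∀ a ≠ 3, υ.arr a = σ.arr a) ∧
      ∀ i : Fin n, (i : ℕ) < k → υ.arr 3 i = profile A₁ name Λ Λ.L i) (by
      refine ⟨?_, fun _ _ => rfl, fun i hi => absurd hi (Nat.not_lt_zero _)⟩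
      simp [Store.setReg_reg, h0]) (by
      rintro k hkn υ ⟨hr0, ha, hp⟩ h6
      rw [h1] at hkn
      have e := run_profileC (σ := υ) (name := name) (A₁ := A₁) (Λ := Λ) ⟨k, hkn⟩ hr0
        (by rw [ha 0 (by omega), hk]) (by rw [ha 1 (by omega), hi])
        (by rw [ha 2 (by omega), h2]) h6
      refine ⟨?_, fun a h3 => ?_, fun i hik => ?_⟩
      · rw [Store.setReg_reg_of_ne _ _ (by omega), run_reg_of_notMem _ _ (by decide), hr0]
      · rw [Store.setReg_arr, e, Store.setArr_arr_of_ne _ _ _ h3, ha a h3]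
      · rw [Store.setReg_arr, e, Store.setArr_arr]
        by_cases h : (i : ℕ) = k
        · rw [if_pos ⟨rfl, h⟩, show i = ⟨k, hkn⟩ from Fin.ext h]
        · rw [if_neg (by simp [h]), hp i (by omega)])
  rw [h1] at key
  exact ⟨key.2.1, fun i => key.2.2 i i.2⟩

/-- The uniform decision procedure. -/
def uniformP : Prog := profilesC.code 20 ;; decideP

/-- The coefficient in the time bound for `uniformP`. -/
def uniformSize : ℕ := profileC.size + 7 + decideSize

/-- The exponent in the time bound for `uniformP`. -/
def uniformDeg : ℕ := profileC.deg + decideDeg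

open Classical in
theorem runs_uniformP (hn : 0 < n) {A₂ : Set (Fin n)} (hA : A₁ ∪ A₂ = Set.univ)
    (h𝒢 : ∀ G ∈ 𝒢, G.Nonempty) (hname : Function.Injective name) (φ : Fml (Fin n) 𝒢) :
    ∃ τ, Runs (memberOracle name) uniformP (agentsFormulaInput A₁ name φ)
      (uniformSize * (n * (φ.shape name).N ^ uniformDeg)) τ ∧
      τ.reg 0 = if φ.SatMixedRST A₁ A₂ then 1 else 0 := by
  set σ := agentsFormulaInput A₁ name φ with hσ
  set Λ := φ.shape name with hΛ
  have hB : 1 ≤ Λ.N := Nat.one_le_two_pow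
  have hW := Λ.le_N
  have h0 : σ.reg 0 = Λ.L := by simp [hσ, agentsFormulaInput, formulaInput, hΛ, Fml.shape]
  have h1 : σ.reg 1 = n := by simp [hσ, agentsFormulaInput]
  have hk : σ.arr 0 = Λ.kind := by
    ext; simp [hσ, agentsFormulaInput, formulaInput, hΛ, Fml.shape]
  have hi : σ.arr 1 = Λ.idx := by
    ext; simp [hσ, agentsFormulaInput, formulaInput, hΛ, Fml.shape]
  have h2 : ∀ i : Fin n, σ.arr 2 i = if i ∈ A₁ then 1 else 0 := fun i => by
    simp [hσ, agentsFormulaInput, ← Fin.ext_iff]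
  obtain ⟨ha, hp⟩ := run_profilesC (name := name) h0 h1 hk hi h2
  obtain ⟨τ, r1, g1, g2⟩ := profilesC.runs_code (memberOracle name) (D := 20) (by omega) (by decide)
    (by decide) (Agree.refl 20 σ)
  have T1 := le_mul_mul_pow (D := uniformDeg)
    (Cmd.time_loop_le (i := 6) (c := profileC) hB hn h1 (by
    have : profileC.counters = [0] := by decide
    rw [this]
    simp only [List.mem_singleton, forall_eq, h0]
    omega)) hB (by unfold uniformDeg; omega)
  have hl : Loaded A₁ (profile A₁ name Λ Λ.L) Λ φ τ := by
    refine loaded_profile hname ?_ ?_ ?_ ?_ fun i => ?_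
    · rw [g1 0 (by omega), run_reg_of_notMem _ _ (by decide), h0]
    · rw [g1 1 (by omega), run_reg_of_notMem _ _ (by decide), h1]
    · rw [g2, ha 0 (by omega), hk]
    · rw [g2, ha 1 (by omega), hi]
    · rw [g2, hp i]
  obtain ⟨υ, r2, h⟩ := runs_decideP (memberOracle name) hn hA h𝒢 hl
  refine ⟨υ, (r1.seq r2).mono ?_, h⟩
  refine (Nat.add_le_add T1 (le_mul_mul_pow le_rfl hB (D := uniformDeg)
    (by unfold uniformDeg; omega))).trans (le_of_eq ?_)
  unfold uniformSize
  ring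

end oracle

/-! ### Loading the profiles with a search tree -/

/-- `body 0`, …, `body (n - 1)` in turn, after an assignment to a scratch register that stands for
the empty program. -/
def Prog.upTo (body : ℕ → Prog) : ℕ → Prog
  | 0 => .const 12 0
  | n + 1 => upTo body n ;; body n

/-- Agent by agent, `reg 11 := 2 * PROF[i] + χ i` is written back to `PROF[i]`, where `PROF` is
array `3`. -/
def rowP (χ : ℕ → ℕ) (n : ℕ) : Prog :=
  .upTo (fun i => .const 10 i ;; .load 11 3 10 ;; .add 11 11 11 ;; .const 12 (χ i) ;;
    .add 11 11 12 ;; .store 3 10 11) n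

/-- `PROF[i] := b i` for all `i < n`. -/
def fillP (b : ℕ → ℕ) (n : ℕ) : Prog :=
  .upTo (fun i => .const 10 i ;; .const 11 (b i) ;; .store 3 10 11) n

/-- The registers below `9` and all arrays but array `3` are kept, and the first `n` entries of
array `3` are given by `f`. -/
def Rewrites (n : ℕ) (f : ℕ → ℕ) (σ τ : Store) : Prop :=
  (∀ r < 9, τ.reg r = σ.reg r) ∧ (∀ a ≠ 3, τ.arr a = σ.arr a) ∧ ∀ i < n, τ.arr 3 i = f i

section

variable {O : ℕ → ℕ → ℕ}

theorem runs_upTo {f : ℕ → ℕ} {body : ℕ → Prog} {T : ℕ} {σ : Store}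
    (h : ∀ i τ, τ.arr 3 i = σ.arr 3 i → ∃ υ, Runs O (body i) τ T υ ∧ (∀ r < 9, υ.reg r = τ.reg r) ∧
      υ.arr = (τ.setArr 3 i (f i)).arr) (n : ℕ) :
    ∃ τ, Runs O (.upTo body n) σ (1 + T * n) τ ∧ Rewrites n f σ τ := by
  suffices ∃ τ, Runs O (.upTo body n) σ (1 + T * n) τ ∧ Rewrites n f σ τ ∧
      ∀ i, n ≤ i → τ.arr 3 i = σ.arr 3 i from
    let ⟨τ, h1, h2, _⟩ := this
    ⟨τ, h1, h2⟩
  induction n with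
  | zero =>
    exact ⟨_, (Exec.const σ 12 0).runs, ⟨fun r hr => Store.setReg_reg_of_ne _ _ (by omega),
      fun _ _ => rfl, fun _ hi => absurd hi (Nat.not_lt_zero _)⟩, fun _ _ => rfl⟩
  | succ n ih =>
    obtain ⟨τ, h1, ⟨h2, h3, h4⟩, h5⟩ := ih
    obtain ⟨υ, k1, k2, k3⟩ := h n τ (h5 n le_rfl)
    refine ⟨υ, (h1.seq k1).mono (by rw [mul_add]; omega),
      ⟨fun r hr => (k2 r hr).trans (h2 r hr), fun a ha => ?_, fun i hi => ?_⟩, fun i hi => ?_⟩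
    · rw [k3, Store.setArr_arr_of_ne _ _ _ ha, h3 a ha]
    · rw [k3, Store.setArr_arr]
      split_ifs with hin
      · rw [hin.2]
      · exact h4 i (by omega)
    · rw [k3, Store.setArr_arr, if_neg (by omega), h5 i (by omega)]

theorem runs_rowP (χ : ℕ → ℕ) (n : ℕ) (σ : Store) :
    ∃ τ, Runs O (rowP χ n) σ (1 + 6 * n) τ ∧ Rewrites n (fun i => 2 * σ.arr 3 i + χ i) σ τ := by
  refine runs_upTo (fun i τ h => ⟨_, (Exec.const τ 10 i).runs.seq ((Exec.load _ 11 3 10).runs.seq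
    ((Exec.add _ 11 11 11).runs.seq ((Exec.const _ 12 (χ i)).runs.seq
      ((Exec.add _ 11 11 12).runs.seq (Exec.store _ 3 10 11).runs)))), fun r hr => ?_, ?_⟩) n
  · have h10 : r ≠ 10 := by omega
    have h11 : r ≠ 11 := by omega
    have h12 : r ≠ 12 := by omega
    simp [Store.setReg_reg, h10, h11, h12]
  · simp [Store.setReg_reg, Store.setArr, h, two_mul]

theorem runs_fillP (b : ℕ → ℕ) (n : ℕ) (σ : Store) :
    ∃ τ, Runs O (fillP b n) σ (1 + 3 * n) τ ∧ Rewrites n b σ τ := by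
  refine runs_upTo (fun i τ _ => ⟨_, (Exec.const τ 10 i).runs.seq
    ((Exec.const _ 11 (b i)).runs.seq (Exec.store _ 3 10 11).runs), fun r hr => ?_, ?_⟩) n
  · have h10 : r ≠ 10 := by omega
    have h11 : r ≠ 11 := by omega
    simp [Store.setReg_reg, h10, h11]
  · simp [Store.setReg_reg, Store.setArr]

/-- A finite set of numbers can be split at any given size. -/
theorem exists_card_filter_lt_eq (S : Finset ℕ) {a : ℕ} (ha : a ≤ S.card) :
    ∃ m, (S.filter (· < m)).card = a := by
  have step : ∀ m, (S.filter (· < m + 1)).card ≤ (S.filter (· < m)).card + 1 := fun m => by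
    refine (Finset.card_le_card (t := insert m (S.filter (· < m))) fun x hx => ?_).trans
      (Finset.card_insert_le _ _)
    simp only [Finset.mem_insert, Finset.mem_filter] at hx ⊢
    rcases Nat.lt_succ_iff_lt_or_eq.1 hx.2 with h | h
    · exact .inr ⟨hx.1, h⟩
    · exact .inl h
  have reach : ∀ m, ∀ a ≤ (S.filter (· < m)).card, ∃ m', (S.filter (· < m')).card = a := by
    intro m
    induction m with
    | zero => intro a ha; exact ⟨0, by simp at ha ⊢; omega⟩
    | succ m ih =>
      intro a ha
      have := step m
      rcases Nat.lt_or_ge (S.filter (· < m)).card a with h | h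
      · exact ⟨m + 1, by omega⟩
      · exact ih a h
  refine reach (S.sup id + 1) a (ha.trans (le_of_eq ?_))
  have : ∀ x ∈ S, x < S.sup id + 1 := fun x hx => Nat.lt_succ_of_le (Finset.le_sup (f := id) hx)
  rw [Finset.filter_true_of_mem this]

/-- There is a binary search tree of depth `d` for the keys in `S`. In register `8` it expects a
key `k`, and it runs the program `leaf k`; register `9` is used for the comparisons. -/
theorem exists_search {leaf : ℕ → Prog} {R : Store → Store → Prop} {T : ℕ}
    (hR : ∀ σ v τ, R (σ.setReg 9 v) τ → R σ τ) (d : ℕ) (S : Finset ℕ) (hS : S.card ≤ 2 ^ d)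
    (hleaf : ∀ k ∈ S, ∀ σ, σ.reg 8 = k → ∃ τ, Runs O (leaf k) σ T τ ∧ R σ τ) :
    ∃ P, ∀ σ, σ.reg 8 ∈ S → ∃ τ, Runs O P σ (T + 3 * d) τ ∧ R σ τ := by
  induction d generalizing S with
  | zero =>
    rcases S.eq_empty_or_nonempty with rfl | ⟨k, hk⟩
    · exact ⟨.const 9 0, fun σ h => absurd h (Finset.notMem_empty _)⟩
    · refine ⟨leaf k, fun σ h => hleaf k hk σ ?_⟩
      exact Finset.card_le_one.1 (by simpa using hS) _ h _ hk
  | succ d ih =>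
    rw [pow_succ] at hS
    obtain ⟨m, hm⟩ := exists_card_filter_lt_eq S (a := min (2 ^ d) S.card) (min_le_right _ _)
    have hsum := Finset.card_filter_add_card_filter_not (s := S) (· < m)
    obtain ⟨P, hP⟩ := ih (S.filter (· < m)) (by omega)
      fun k hk => hleaf k (Finset.mem_filter.1 hk).1
    obtain ⟨Q, hQ⟩ := ih (S.filter fun k => ¬ k < m) (by omega)
      fun k hk => hleaf k (Finset.mem_filter.1 hk).1
    refine ⟨.const 9 m ;; .sub 9 9 8 ;; .ite 9 P Q, fun σ h => ?_⟩
    set υ := (σ.setReg 9 m).setReg 9 ((σ.setReg 9 m).reg 9 - (σ.setReg 9 m).reg 8) with hυ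
    have h8 : υ.reg 8 = σ.reg 8 := by simp [hυ, Store.setReg_reg]
    have h9 : υ.reg 9 = m - σ.reg 8 := by simp [hυ, Store.setReg_reg]
    have main : ∃ τ, Runs O (.ite 9 P Q) υ (T + 3 * d + 1) τ ∧ R υ τ := by
      by_cases hlt : σ.reg 8 < m
      · obtain ⟨τ, h1, h2⟩ := hP υ (by rw [h8]; exact Finset.mem_filter.2 ⟨h, hlt⟩)
        exact ⟨τ, .ite (fun _ => h1) fun h0 => by omega, h2⟩
      · obtain ⟨τ, h1, h2⟩ := hQ υ (by rw [h8]; exact Finset.mem_filter.2 ⟨h, hlt⟩)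
        exact ⟨τ, .ite (fun h0 => by omega) fun _ => h1, h2⟩
    obtain ⟨τ, h1, h2⟩ := main
    exact ⟨τ, ((Exec.const σ 9 m).runs.seq ((Exec.sub _ 9 9 8).runs.seq h1)).mono (by omega),
      hR _ _ _ (hR _ _ _ h2)⟩

theorem Rewrites.of_setReg {n : ℕ} {f : ℕ → ℕ} {σ τ : Store} {x v : ℕ} (hx : 9 ≤ x)
    (h : Rewrites n f (σ.setReg x v) τ) : Rewrites n f σ τ :=
  ⟨fun r hr => (h.1 r hr).trans (Store.setReg_reg_of_ne _ _ (by omega)), h.2⟩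

/-- Searching for a key takes time linear in `n` if there are at most `2 ^ n` keys. -/
theorem exists_search_rowP (χ : ℕ → ℕ → ℕ) {n : ℕ} (S : Finset ℕ) (hS : S.card ≤ 2 ^ n) :
    ∃ P, ∀ σ, σ.reg 8 ∈ S → ∃ τ, Runs O P σ (1 + 9 * n) τ ∧
      Rewrites n (fun i => 2 * σ.arr 3 i + χ (σ.reg 8) i) σ τ := by
  obtain ⟨P, hP⟩ := exists_search (O := O) (leaf := fun k => rowP (χ k) n) (T := 1 + 6 * n)
    (R := fun σ τ => Rewrites n (fun i => 2 * σ.arr 3 i + χ (σ.reg 8) i) σ τ)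
    (fun σ v τ h => h.of_setReg le_rfl) n S hS
    (fun k _ σ h => by obtain ⟨τ, h1, h2⟩ := runs_rowP (O := O) (χ k) n σ; exact ⟨τ, h1, h ▸ h2⟩)
  refine ⟨P, fun σ h => ?_⟩
  obtain ⟨τ, h1, h2⟩ := hP σ h
  exact ⟨τ, h1.mono (by omega), h2⟩

/-- Decrements the position in register `6` and extends the profiles of the `n` agents by the digit
for that position; `P` and `Q` do so for the operators `K_i` and for `E_G`, `C_G`. -/
def stepP (P Q : Prog) (n : ℕ) : Prog :=
  .const 7 1 ;; .sub 6 6 7 ;; .load 7 0 6 ;; .load 8 1 6 ;; .const 9 3 ;; .sub 10 9 7 ;;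
    .ite 10 (rowP (fun _ => 0) n) (.sub 10 7 9 ;; .ite 10 Q P)

theorem runs_stepP {n : ℕ} {𝒢 : Set (Set (Fin n))} {name : 𝒢 → ℕ} {P Q : Prog}
    (hP : ∀ σ, σ.reg 8 < n → ∃ τ, Runs O P σ (1 + 9 * n) τ ∧
      Rewrites n (fun i => 2 * σ.arr 3 i + if σ.reg 8 = i then 1 else 0) σ τ)
    (hQ : ∀ σ, σ.reg 8 ∈ Set.range name → ∃ τ, Runs O Q σ (1 + 9 * n) τ ∧
      Rewrites n (fun i => 2 * σ.arr 3 i + memberOracle name i (σ.reg 8)) σ τ)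
    {σ : Store} {m : ℕ} (h6 : σ.reg 6 = m + 1) (h3 : σ.arr 0 m = 3 → σ.arr 1 m < n)
    (h4 : 4 ≤ σ.arr 0 m → σ.arr 1 m ∈ Set.range name) :
    ∃ τ, Runs O (stepP P Q n) σ (10 + 9 * n) τ ∧ (∀ r < 6, τ.reg r = σ.reg r) ∧ τ.reg 6 = m ∧
      (∀ a ≠ 3, τ.arr a = σ.arr a) ∧
      ∀ i < n, τ.arr 3 i = 2 * σ.arr 3 i + involved name (σ.arr 0 m) (σ.arr 1 m) i := by
  obtain ⟨υ, hυ, hrun⟩ : ∃ υ, υ = _ ∧ ∀ {R : Prog} {T : ℕ} {τ : Store}, Runs O R υ T τ →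
      Runs O (.const 7 1 ;; .sub 6 6 7 ;; .load 7 0 6 ;; .load 8 1 6 ;; .const 9 3 ;;
        .sub 10 9 7 ;; R) σ (1 + (1 + (1 + (1 + (1 + (1 + T)))))) τ :=
    ⟨_, rfl, fun h => (Exec.const σ 7 1).runs.seq ((Exec.sub _ 6 6 7).runs.seq
      ((Exec.load _ 7 0 6).runs.seq ((Exec.load _ 8 1 6).runs.seq ((Exec.const _ 9 3).runs.seq
        ((Exec.sub _ 10 9 7).runs.seq h)))))⟩
  have ur : ∀ r < 6, υ.reg r = σ.reg r := fun r hr => by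
    have h6 : r ≠ 6 := by omega
    have h7 : r ≠ 7 := by omega
    have h8 : r ≠ 8 := by omega
    have h9 : r ≠ 9 := by omega
    have h10 : r ≠ 10 := by omega
    simp [hυ, Store.setReg_reg, h6, h7, h8, h9, h10]
  have ua : υ.arr = σ.arr := by simp [hυ]
  have u6 : υ.reg 6 = m := by simp [hυ, Store.setReg_reg, h6]
  have u7 : υ.reg 7 = σ.arr 0 m := by simp [hυ, Store.setReg_reg, h6]
  have u8 : υ.reg 8 = σ.arr 1 m := by simp [hυ, Store.setReg_reg, h6]
  have u9 : υ.reg 9 = 3 := by simp [hυ, Store.setReg_reg]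
  have u10 : υ.reg 10 = 3 - σ.arr 0 m := by simp [hυ, Store.setReg_reg, h6]
  clear hυ
  suffices ∃ τ, Runs O (.ite 10 (rowP (fun _ => 0) n) (.sub 10 7 9 ;; .ite 10 Q P)) υ
      (4 + 9 * n) τ ∧
      Rewrites n (fun i => 2 * σ.arr 3 i + involved name (σ.arr 0 m) (σ.arr 1 m) i) υ τ by
    obtain ⟨τ, r1, r2, r3, r4⟩ := this
    exact ⟨τ, (hrun r1).mono (by omega), fun r hr => (r2 r (by omega)).trans (ur r hr),
      (r2 6 (by omega)).trans u6, fun a ha => (r3 a ha).trans (by rw [ua]), r4⟩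
  set ω := υ.setReg 10 (υ.reg 7 - υ.reg 9) with hω
  have w8 : ω.reg 8 = σ.arr 1 m := by simp [hω, Store.setReg_reg, u8]
  have w10 : ω.reg 10 = σ.arr 0 m - 3 := by simp [hω, u7, u9]
  have wa : ω.arr = σ.arr := ua
  have wrun : Runs O (.sub 10 7 9) υ 1 ω := (Exec.sub υ 10 7 9).runs
  rcases lt_trichotomy (σ.arr 0 m) 3 with hk | hk | hk
  · obtain ⟨τ, r1, r2⟩ := runs_rowP (O := O) (fun _ => 0) n υ
    refine ⟨τ, (Runs.ite (T := 1 + 6 * n) (fun _ => r1) fun h => by omega).mono (by omega), ?_⟩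
    rw [ua] at r2
    have : (fun i => involved name (σ.arr 0 m) (σ.arr 1 m) i) = fun _ => 0 := by
      funext i; simp [involved, hk]
    simpa only [congr_fun this] using r2
  · obtain ⟨τ, r1, r2⟩ := hP ω (by rw [w8]; exact h3 hk)
    refine ⟨τ, (Runs.ite (T := 1 + (1 + 9 * n + 1)) (fun h => by omega) fun _ =>
      wrun.seq (.ite (fun h => by omega) fun _ => r1)).mono (by omega), ?_⟩
    rw [wa, w8] at r2
    have : ∀ i, involved name (σ.arr 0 m) (σ.arr 1 m) i = if σ.arr 1 m = i then 1 else 0 :=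
      fun i => by simp [involved, hk]
    simpa only [this] using r2.of_setReg (by omega)
  · obtain ⟨τ, r1, r2⟩ := hQ ω (by rw [w8]; exact h4 hk)
    refine ⟨τ, (Runs.ite (T := 1 + (1 + 9 * n + 1)) (fun h => by omega) fun _ =>
      wrun.seq (.ite (fun _ => r1) fun h => by omega)).mono (by omega), ?_⟩
    rw [wa, w8] at r2
    have : ∀ i, involved name (σ.arr 0 m) (σ.arr 1 m) i = memberOracle name i (σ.arr 1 m) :=
      fun i => by rw [involved, if_neg (by omega), if_neg (by omega)]
    simpa only [this] using r2.of_setReg (by omega)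

/-- Computes the profiles of all agents; `b` is the characteristic function of `A₁`. -/
def loadP (P Q : Prog) (b : ℕ → ℕ) (n : ℕ) : Prog :=
  .const 1 n ;; fillP b n ;; .const 6 0 ;; .add 6 0 6 ;; .loop 6 (stepP P Q n)

end

section

variable {n : ℕ} {𝒢 : Set (Set (Fin n))} {name : 𝒢 → ℕ} {A₁ : Set (Fin n)}

open Classical in
theorem runs_loadP {O : ℕ → ℕ → ℕ} {P Q : Prog}
    (hP : ∀ σ, σ.reg 8 < n → ∃ τ, Runs O P σ (1 + 9 * n) τ ∧
      Rewrites n (fun i => 2 * σ.arr 3 i + if σ.reg 8 = i then 1 else 0) σ τ)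
    (hQ : ∀ σ, σ.reg 8 ∈ Set.range name → ∃ τ, Runs O Q σ (1 + 9 * n) τ ∧
      Rewrites n (fun i => 2 * σ.arr 3 i + memberOracle name i (σ.reg 8)) σ τ)
    {b : ℕ → ℕ} (hb : ∀ i : Fin n, b i = if i ∈ A₁ then 1 else 0) (hname : Function.Injective name)
    (φ : Fml (Fin n) 𝒢) :
    ∃ τ, Runs O (loadP P Q b n) (formulaInput name φ)
        (5 + 3 * n + (φ.shape name).L * (11 + 9 * n)) τ ∧
      Loaded A₁ (profile A₁ name (φ.shape name) (φ.shape name).L) (φ.shape name) φ τ := by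
  set Λ := φ.shape name with hΛ
  set σ := formulaInput name φ with hσ
  have hσ0 : σ.reg 0 = Λ.L := by simp [hσ, formulaInput, hΛ, Fml.shape]
  have hk : σ.arr 0 = Λ.kind := by ext; simp [hσ, formulaInput, hΛ, Fml.shape]
  have hi : σ.arr 1 = Λ.idx := by ext; simp [hσ, formulaInput, hΛ, Fml.shape]
  have mem : ∀ t < Λ.L, (Λ.kind t, Λ.idx t) ∈ φ.tokens name := fun t ht => by
    have ht' : t < (φ.tokens name).length := ht
    simp [hΛ, Fml.shape, ht']
  have loop : ∀ m ≤ Λ.L, ∀ υ : Store, υ.reg 0 = Λ.L → υ.reg 1 = n → υ.arr 0 = Λ.kind →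
      υ.arr 1 = Λ.idx → υ.reg 6 = m →
      (∀ i : Fin n, υ.arr 3 i = profile A₁ name Λ (Λ.L - m) i) →
      ∃ τ, Runs O (.loop 6 (stepP P Q n)) υ (1 + m * (11 + 9 * n)) τ ∧
        Loaded A₁ (profile A₁ name Λ Λ.L) Λ φ τ := by
    intro m
    induction m with
    | zero =>
      intro _ υ h0 h1 ha hb h6 hp
      exact ⟨υ, (Runs.loopDone h6).mono (by omega), loaded_profile hname h0 h1 ha hb hp⟩
    | succ m ih =>
      intro hm υ h0 h1 ha hb h6 hp
      obtain ⟨ω, r1, r2, r3, r4, r5⟩ := runs_stepP (O := O) (name := name) hP hQ (σ := υ) h6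
        (fun h3 => by
          rw [ha] at h3
          rw [hb]
          exact Fml.snd_lt_of_mem_tokens (mem m hm) h3)
        (fun h4 => by
          rw [ha] at h4
          rw [hb]
          exact Fml.snd_mem_range_of_mem_tokens (mem m hm) h4)
      obtain ⟨τ, k1, k2⟩ := ih (by omega) ω (by rw [r2 0 (by omega), h0])
        (by rw [r2 1 (by omega), h1]) (by rw [r4 0 (by omega), ha]) (by rw [r4 1 (by omega), hb]) r3
        (fun i => by
          rw [r5 i i.2, hp i, ha, hb, show Λ.L - m = Λ.L - (m + 1) + 1 by omega]
          simp only [profile, digits]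
          rw [show Λ.L - 1 - (Λ.L - (m + 1)) = m by omega])
      refine ⟨τ, (Runs.loopStep (by omega) r1 k1).mono ?_, k2⟩
      rw [add_mul]
      omega
  obtain ⟨υ, f1, f2, f3, f4⟩ := runs_fillP (O := O) b n (σ.setReg 1 n)
  obtain ⟨τ, k1, k2⟩ := loop Λ.L le_rfl ((υ.setReg 6 0).setReg 6
      ((υ.setReg 6 0).reg 0 + (υ.setReg 6 0).reg 6))
    (by simp [Store.setReg_reg, f2, hσ0]) (by simp [Store.setReg_reg, f2])
    (by simp [f3, hk]) (by simp [f3, hi]) (by simp [Store.setReg_reg, f2, hσ0])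
    (fun i => by simp [f4, hb, profile, digits])
  exact ⟨τ, ((Exec.const σ 1 n).runs.seq (f1.seq ((Exec.const υ 6 0).runs.seq
    ((Exec.add _ 6 0 6).runs.seq k1)))).mono (by omega), k2⟩

open Classical in
/-- For fixed agents and sets, the membership relation can be built into the program. With the names
of the sets in a search tree of depth `n`, all memberships in one set are found in time linear in
`n`; to run an algorithm for membership once per agent would take quadratic time. -/
theorem exists_runs_formulaInput (hn : 0 < n) {A₂ : Set (Fin n)} (hA : A₁ ∪ A₂ = Set.univ)
    (h𝒢 : ∀ G ∈ 𝒢, G.Nonempty) (hname : Function.Injective name) (O : ℕ → ℕ → ℕ) :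
    ∃ P, ∀ φ : Fml (Fin n) 𝒢, ∃ τ, Runs O P (formulaInput name φ)
      ((28 + decideSize) * (n * (φ.shape name).N ^ (decideDeg + 1))) τ ∧
      τ.reg 0 = if φ.SatMixedRST A₁ A₂ then 1 else 0 := by
  obtain ⟨P, hP⟩ := exists_search_rowP (O := O) (fun k i => if k = i then 1 else 0) (n := n)
    (Finset.range n) (by rw [Finset.card_range]; exact Nat.lt_two_pow_self.le)
  obtain ⟨Q, hQ⟩ := exists_search_rowP (O := O) (fun k i => memberOracle name i k) (n := n)
    (Set.toFinite (Set.range name)).toFinset (by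
      rw [← Set.ncard_eq_toFinset_card (Set.range name), ← Nat.card_coe_set_eq,
        Nat.card_range_of_injective hname]
      refine (Nat.card_le_card_of_injective Subtype.val Subtype.val_injective).trans ?_
      simp)
  simp only [Finset.mem_range, Set.Finite.mem_toFinset] at hP hQ
  set b : ℕ → ℕ := fun j => if ∃ i ∈ A₁, (i : ℕ) = j then 1 else 0 with hb
  refine ⟨loadP P Q b n ;; decideP, fun φ => ?_⟩
  obtain ⟨υ, r1, hl⟩ := runs_loadP (A₁ := A₁) hP hQ (b := b)
    (fun i => by simp [hb, ← Fin.ext_iff]) hname φ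
  obtain ⟨τ, r2, h⟩ := runs_decideP O hn hA h𝒢 hl
  refine ⟨τ, (r1.seq r2).mono ?_, h⟩
  set Λ := φ.shape name
  have hB : 1 ≤ Λ.N := Nat.one_le_two_pow
  have hW := Λ.le_N
  rw [add_mul]
  refine Nat.add_le_add ?_ (le_mul_mul_pow le_rfl hB (by omega))
  calc 5 + 3 * n + Λ.L * (11 + 9 * n) ≤ 5 * (n * Λ.N) + 3 * (n * Λ.N) + Λ.N * (20 * n) := by
        have h1 : n * 1 ≤ n * Λ.N := Nat.mul_le_mul_left n hB
        have h2 : Λ.L * (11 + 9 * n) ≤ Λ.N * (20 * n) := Nat.mul_le_mul (by omega) (by omega)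
        omega
    _ = 28 * (n * Λ.N ^ 1) := by ring
    _ ≤ 28 * (n * Λ.N ^ (decideDeg + 1)) := le_mul_mul_pow le_rfl hB (by omega)

end

/-! ### The exponent -/

/-- The number of codes is `2 ^ O(|φ|)`. -/
theorem N_pow_le {n : ℕ} {𝒢 : Set (Set (Fin n))} (name : 𝒢 → ℕ) (φ : Fml (Fin n) 𝒢) {d D : ℕ}
    (hd : d ≤ D) : (φ.shape name).N ^ d ≤ 2 ^ (6 * D * φ.length) := by
  have h1 : (φ.shape name).L = φ.width := φ.length_tokens name
  have h2 := φ.width_pos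
  have h3 := φ.width_le_length
  rw [Shape.N, h1, ← pow_mul]
  refine Nat.pow_le_pow_right (by omega) ?_
  calc (4 * φ.width + 2) * d ≤ 6 * φ.length * D := Nat.mul_le_mul (by omega) hd
    _ = 6 * D * φ.length := by ring

end MixedRST

theorem theorem4p16 :
    ∃ c : ℕ, 0 < c ∧
      (∀ K : ℕ, ∃ C : ℕ, ∀ (n : ℕ), 0 < n →
        ∀ (A₁ A₂ : Set (Fin n)), A₁ ∪ A₂ = Set.univ →
        ∀ (𝒢 : Set (Set (Fin n))), (∀ G ∈ 𝒢, G.Nonempty) →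
        ∀ (name : 𝒢 → ℕ), Function.Injective name →
        MixedRST.LinearMembership name K →
        ∃ P : MixedRST.Prog, ∀ φ : MixedRST.Fml (Fin n) 𝒢,
          MixedRST.DecidesIn MixedRST.noOracle P (MixedRST.formulaInput name φ)
            (φ.SatMixedRST A₁ A₂) (C * (n * 2 ^ (c * φ.length)))) ∧
      (∃ (C : ℕ) (P : MixedRST.Prog), ∀ (n : ℕ), 0 < n →
        ∀ (A₁ A₂ : Set (Fin n)), A₁ ∪ A₂ = Set.univ →
        ∀ (𝒢 : Set (Set (Fin n))), (∀ G ∈ 𝒢, G.Nonempty) →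
        ∀ (name : 𝒢 → ℕ), Function.Injective name →
        ∀ φ : MixedRST.Fml (Fin n) 𝒢,
          MixedRST.DecidesIn (MixedRST.memberOracle name) P
            (MixedRST.agentsFormulaInput A₁ name φ)
            (φ.SatMixedRST A₁ A₂) (C * (n * 2 ^ (c * φ.length)))) := by
  set D := MixedRST.decideDeg + 1 + MixedRST.uniformDeg with hD
  refine ⟨6 * D, by omega, fun K => ⟨28 + MixedRST.decideSize, ?_⟩,
    MixedRST.uniformSize, MixedRST.uniformP, ?_⟩
  · intro n hn A₁ A₂ hA 𝒢 h𝒢 name hname _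
    obtain ⟨P, hP⟩ :=
      MixedRST.exists_runs_formulaInput hn hA h𝒢 hname MixedRST.noOracle
    refine ⟨P, fun φ => ?_⟩
    obtain ⟨τ, ⟨t, ht, hx⟩, h⟩ := hP φ
    exact ⟨t, τ, hx, ht.trans (Nat.mul_le_mul_left _ (Nat.mul_le_mul_left _
      (MixedRST.N_pow_le name φ (by omega)))), h⟩
  · intro n hn A₁ A₂ hA 𝒢 h𝒢 name hname φ
    obtain ⟨τ, ⟨t, ht, hx⟩, h⟩ := MixedRST.runs_uniformP hn hA h𝒢 hname φ
    exact ⟨t, τ, hx, ht.trans (Nat.mul_le_mul_left _ (Nat.mul_le_mul_left _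
      (MixedRST.N_pow_le name φ (by omega)))), h⟩
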